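/- **Model.** Let $(\Omega,\mathcal F,(\mathcal F_t)_{t\ge 0},\mathbb P)$ be a filtered probability space with $\mathcal F_0$ $\mathbb P$-trivial, let $P^0$ be a càdlàg $(\mathcal F_t)$-martingale, $\gamma>0$, and let $h(x)=\eta x$ be an impact function (so $\eta>0$). Let $0<\tau_1<\tau_2<\cdots$ be random times whose counting process $N_t=\max\{k:\tau_k\le t\}$ is a Poisson process with rate $\theta>0$, and let $\widetilde Y_1,\widetilde Y_2,\dots$ be i.i.d. $(0,\infty]$-valued random variables with law $\mu=\delta_\infty$ (infinite dark-pool liquidity). Assume that $\mathcal F_\infty=\bigvee_t\mathcal F_t$, $(N_t)$ and $(\widetilde Y_i)$ are independent. For a dark-pool order $\widehat X\in\mathbb R$ with minimum quantity level $\Xi\in[0,|\widehat X|]$, the part of the $i$-th incoming order that is executed is $Y_i=\operatorname{sgn}(\widehat X)\min\{\widetilde Y_i,\,|\widehat X|-\sum_{j<i}|Y_j|\}$ if $\widetilde Y_i\ge\Xi$, and $Y_i=0$ otherwise; put $Z_t=\sum_{i=1}^{N_t}Y_i$. Let $(\mathcal G_t)$ be the right-continuous filtration generated by $(\mathcal F_t)$,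 $Z$ and the processes $(\tau_i\wedge t)_{t\ge0}$, $i\ge1$. For $X_0\in\mathbb R$ and $T>0$, let $\mathcal X(X_0,T)$ be the set of admissible strategies $\chi=(\widehat X,\Xi,\xi,\rho)$: $\widehat X\in\mathbb R$, $\Xi\in[0,|\widehat X|]$, $\rho$ is a $(\mathcal G_t)$-stopping time with $\rho<T$ a.s., $\xi$ is $(\mathcal G_t)$-predictable and a.s. integrable on $[0,T]$, $\int_0^t\xi_s\,ds$ is a.s. bounded uniformly in $t\in[0,T]$ and $\omega$, and $X_0+\int_0^T\xi_t\,dt+Z_\rho=0$ a.s. With virtual permanent impact $\alpha=0$, slippage $\beta=0$ and temporary cross-impact $\kappa=0$, the costs of $\chi$ are the $(-\infty,\infty]$-valued random variable $$\mathcal C_T^\chi=X_0P^0_0+\int_0^T\xi_t\Big(P^0_t+\gamma\int_0^t\xi_s\,ds+\eta\,\xi_t\Big)dt+\sum_{i=1}^{N_\rho}Y_i\Big(P^0_{\tau_i}+\gamma\int_0^{\tau_i}\xi_s\,ds\Big).$$ **Proposition.** If $\frac{\gamma}{\eta}<2\theta$, then for every $X_0\in\mathbb R$ $$\lim_{T\uparrow\infty}\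 \inf_{\chi\in\mathcal X(X_0,T)}\mathbb E[\,\mathcal C^\chi_T\,]=-\frac{\gamma^2}{2}\,X_0^2\,\frac{1}{2\eta\theta-\gamma},$$ where the infimum is over those admissible $\chi$ for which $\mathbb E[\mathcal C_T^\chi]$ is defined in $[-\infty,\infty]$. -/

import Mathlib

open MeasureTheory ProbabilityTheory Filter Topology Set
open scoped NNReal ENNReal

namespace DarkPool

/-! ### Extended-real integrals -/

/-- The integral of an extended-real-valued function in the extended sense,
`∫ f⁺ - ∫ f⁻`; it is meaningful as soon as `HasExtIntegral ν f`. -/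
noncomputable def extIntegral {α : Type*} [MeasurableSpace α] (ν : Measure α) (f : α → EReal) :
    EReal :=
  ((∫⁻ x, (f x).toENNReal ∂ν : ℝ≥0∞) : EReal) - ((∫⁻ x, (-f x).toENNReal ∂ν : ℝ≥0∞) : EReal)

/-- The integral of `f` exists in `[-∞, ∞]`: its positive part or its negative part has a finite
integral. -/
def HasExtIntegral {α : Type*} [MeasurableSpace α] (ν : Measure α) (f : α → EReal) : Prop :=
  (∫⁻ x, (f x).toENNReal ∂ν) ≠ ⊤ ∨ (∫⁻ x, (-f x).toENNReal ∂ν) ≠ ⊤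

/-! ### The Almgren–Chriss model -/

/-- Impact functions: continuous, strictly increasing, zero at zero, and `x ↦ x h(x)` convex. -/
structure IsImpactFunction (h : ℝ → ℝ) : Prop where
  continuous : Continuous h
  strictMono : StrictMono h
  map_zero : h 0 = 0
  convexOn : ConvexOn ℝ univ (fun x => x * h x)

/-- A real function on `[0, ∞)` is càdlàg: right-continuous with (finite) left limits. -/
def IsCadlag (f : ℝ≥0 → ℝ) : Prop :=
  ∀ t, ContinuousWithinAt f (Ioi t) t ∧ ∃ l : ℝ, Tendsto f (𝓝[<] t) (𝓝 l)

/-- An Almgren–Chriss model `(γ, h, P⁰)` on the filtered space `(Ω, 𝓕, P)`. -/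
structure AlmgrenChrissModel {Ω : Type*} [mΩ : MeasurableSpace Ω] (P : Measure Ω) where
  /-- the filtration `(𝓕_t)` -/
  𝓕 : Filtration ℝ≥0 mΩ
  /-- `𝓕_0` is trivial -/
  trivial_zero : ∀ A : Set Ω, MeasurableSet[𝓕 0] A → P A = 0 ∨ P A = 1
  /-- the unaffected price process `P⁰` -/
  P0 : ℝ≥0 → Ω → ℝ
  martingale : Martingale P0 𝓕 P
  cadlag : ∀ ω, IsCadlag (fun t => P0 t ω)
  /-- the permanent-impact parameter -/
  γ : ℝ
  γ_pos : 0 < γ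
  /-- the temporary-impact function -/
  h : ℝ → ℝ
  isImpactFunction : IsImpactFunction h

/-! ### The dark pool -/

/-- The additional parameters `(α, β, κ, (τ_i), (Ỹ_i))` of a dark-pool extension. Sequences are
indexed from `0`: `τ i` and `Ytilde i` are the arrival time and the size of the `(i+1)`-st incoming
matching order. The slippage function `β` is an impact function or vanishes identically. -/
structure DarkPoolExtension (Ω : Type*) [MeasurableSpace Ω] where
  α : ℝ
  α_mem : α ∈ Icc (0 : ℝ) 1
  β : ℝ → ℝ
  β_impact : IsImpactFunction β ∨ β = 0
  κ : ℝ
  κ_nonneg : 0 ≤ κ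
  τ : ℕ → Ω → ℝ≥0
  τ_measurable : ∀ i, Measurable (τ i)
  τ_pos : ∀ ω, 0 < τ 0 ω
  τ_strictMono : ∀ ω, StrictMono (fun i => τ i ω)
  Ytilde : ℕ → Ω → ℝ≥0∞
  Ytilde_measurable : ∀ i, Measurable (Ytilde i)

namespace DarkPoolExtension

variable {Ω : Type*} [mΩ : MeasurableSpace Ω] (D : DarkPoolExtension Ω)

/-- `N_t`, the number of matching orders that have arrived by time `t`. -/
noncomputable def N (t : ℝ≥0) (ω : Ω) : ℕ := {i : ℕ | D.τ i ω ≤ t}.ncard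

/-- The unfilled size of a dark-pool order of `Xhat` shares with minimum quantity level `Ξ` before
the arrival of the order with index `i`: an incoming order that is smaller than `Ξ` has no effect,
any other one is executed against the remainder as far as possible. -/
noncomputable def remaining (Xhat Ξ : ℝ) (ω : Ω) : ℕ → ℝ
  | 0 => |Xhat|
  | i + 1 =>
    if ENNReal.ofReal Ξ ≤ D.Ytilde i ω then
      remaining Xhat Ξ ω i - (min (D.Ytilde i ω) (ENNReal.ofReal (remaining Xhat Ξ ω i))).toReal
    else remaining Xhat Ξ ω i

/-- The (signed) part `Y_i` of the `i`-th incoming order that is executed against `Xhat`. -/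
noncomputable def Y (Xhat Ξ : ℝ) (i : ℕ) (ω : Ω) : ℝ :=
  Real.sign Xhat * (D.remaining Xhat Ξ ω i - D.remaining Xhat Ξ ω (i + 1))

/-- `Z_t`, the number of shares executed in the dark pool until time `t` (without
cancellation). -/
noncomputable def Z (Xhat Ξ : ℝ) (t : ℝ≥0) (ω : Ω) : ℝ :=
  ∑ i ∈ Finset.range (D.N t ω), D.Y Xhat Ξ i ω

lemma measurable_N (t : ℝ≥0) : Measurable (D.N t) := by
  have h : Measurable (fun ω => {i : ℕ | D.τ i ω ≤ t}) :=
    measurable_set_iff.2 fun i =>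
      measurableSet_setOfPred.1 (measurableSet_le (D.τ_measurable i) measurable_const)
  exact measurable_ncard.comp h

lemma measurable_remaining (Xhat Ξ : ℝ) (i : ℕ) :
    Measurable (fun ω => D.remaining Xhat Ξ ω i) := by
  induction i with
  | zero => exact measurable_const
  | succ i ih =>
    refine Measurable.ite (measurableSet_le measurable_const (D.Ytilde_measurable i)) ?_ ih
    exact ih.sub ((D.Ytilde_measurable i).min ih.ennreal_ofReal).ennreal_toReal

lemma measurable_Y (Xhat Ξ : ℝ) (i : ℕ) : Measurable (D.Y Xhat Ξ i) :=
  measurable_const.mul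
    ((D.measurable_remaining Xhat Ξ i).sub (D.measurable_remaining Xhat Ξ (i + 1)))

lemma measurable_Z (Xhat Ξ : ℝ) (t : ℝ≥0) : Measurable (D.Z Xhat Ξ t) := by
  have h : Measurable (fun p : ℕ × Ω => ∑ i ∈ Finset.range p.1, D.Y Xhat Ξ i p.2) :=
    measurable_from_prod_countable_right fun n =>
      Finset.measurable_sum (Finset.range n) fun i _ => D.measurable_Y Xhat Ξ i
  exact h.comp ((D.measurable_N t).prodMk measurable_id)

/-- The filtration generated by `Z` and all the processes `t ↦ τ_i ∧ t`. -/
noncomputable def observation (Xhat Ξ : ℝ) : Filtration ℝ≥0 mΩ :=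
  Filtration.natural (fun t => D.Z Xhat Ξ t) (fun t => (D.measurable_Z Xhat Ξ t).stronglyMeasurable)
    ⊔ ⨆ i : ℕ, Filtration.natural (fun t ω => min (D.τ i ω) t)
      (fun _ => ((D.τ_measurable i).min measurable_const).stronglyMeasurable)

variable {P : Measure Ω}

/-- The right-continuous filtration `(𝓖_t)` generated by `(𝓕_t)`, `Z` and the processes
`t ↦ τ_i ∧ t`. -/
noncomputable def 𝓖 (M : AlmgrenChrissModel P) (Xhat Ξ : ℝ) : Filtration ℝ≥0 mΩ :=
  Filtration.rightCont (M.𝓕 ⊔ D.observation Xhat Ξ)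

/-- The integer-valued process `N` has stationary independent increments, and `N_t - N_s` is
Poisson distributed with parameter `θ (t - s)`; being the counting process of the positive, strictly
increasing times `τ_i`, it is then a Poisson process with rate `θ`. -/
def IsPoisson (P : Measure Ω) (θ : ℝ≥0) : Prop :=
  HasIndepIncrements (fun t ω => (D.N t ω : ℤ)) P ∧
  ∀ s t : ℝ≥0, s ≤ t →
    HasLaw (fun ω => (D.N t ω : ℤ) - (D.N s ω : ℤ))
      ((poissonMeasure (θ * (t - s))).map (Nat.cast : ℕ → ℤ)) P

/-- Zero slippage; `N` is a Poisson process with rate `θ > 0`; the sizes of the incoming orders are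
i.i.d. with law `μ` on `(0, ∞]`, unbounded from above; the price model (i.e. the information
`𝓕_∞ = ⋁ 𝓕_t`, to which `P⁰` is adapted), the process `N` and the sequence `(Ỹ_i)` are
independent. -/
structure IndependenceAssumption (M : AlmgrenChrissModel P) (θ : ℝ≥0) (μ : Measure ℝ≥0∞) :
    Prop where
  β_eq_zero : D.β = 0
  θ_pos : 0 < θ
  isPoisson : D.IsPoisson P θ
  iIndepFun_Ytilde : iIndepFun D.Ytilde P
  hasLaw_Ytilde : ∀ i, HasLaw (D.Ytilde i) μ P
  law_zero : μ {0} = 0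
  law_Ici_pos : ∀ x : ℝ, 0 < x → 0 < μ (Ici (ENNReal.ofReal x))
  iIndep : ProbabilityTheory.iIndep
    (![⨆ t, (M.𝓕 t : MeasurableSpace Ω),
       ⨆ t : ℝ≥0, MeasurableSpace.comap (D.N t) inferInstance,
       ⨆ i : ℕ, MeasurableSpace.comap (D.Ytilde i) inferInstance]) P

end DarkPoolExtension

/-! ### Strategies and costs -/

/-- A quadruple `(X̂, Ξ, ξ, ρ)`: dark-pool order, minimum quantity level, trading speed at the
exchange, cancellation time. -/
structure Strategy (Ω : Type*) where
  Xhat : ℝ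
  Ξ : ℝ
  ξ : ℝ≥0 → Ω → ℝ
  ρ : Ω → ℝ≥0

namespace Strategy

variable {Ω : Type*} [mΩ : MeasurableSpace Ω] {P : Measure Ω}

/-- `∫_0^t ξ_s ds`. -/
noncomputable def traded (χ : Strategy Ω) (t : ℝ≥0) (ω : Ω) : ℝ :=
  ∫ s in (0 : ℝ)..t, χ.ξ s.toNNReal ω

/-- Admissibility of `χ` for the initial position `X₀` and the horizon `T`. -/
structure IsAdmissible (M : AlmgrenChrissModel P) (D : DarkPoolExtension Ω) (X₀ : ℝ) (T : ℝ≥0)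
    (χ : Strategy Ω) : Prop where
  Ξ_mem : χ.Ξ ∈ Icc 0 |χ.Xhat|
  isStoppingTime : IsStoppingTime (D.𝓖 M χ.Xhat χ.Ξ) (fun ω => (χ.ρ ω : WithTop ℝ≥0))
  ρ_lt : ∀ᵐ ω ∂P, χ.ρ ω < T
  predictable : IsStronglyPredictable (D.𝓖 M χ.Xhat χ.Ξ) χ.ξ
  integrable : ∀ᵐ ω ∂P, IntervalIntegrable (fun s : ℝ => χ.ξ s.toNNReal ω) volume 0 T
  bounded : ∃ C : ℝ, ∀ᵐ ω ∂P, ∀ t ≤ T, |χ.traded t ω| ≤ C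
  liquidation : ∀ᵐ ω ∂P, X₀ + χ.traded T ω + D.Z χ.Xhat χ.Ξ (χ.ρ ω) ω = 0

/-- The price `P^χ_t` at the exchange. -/
noncomputable def price (M : AlmgrenChrissModel P) (χ : Strategy Ω) (t : ℝ≥0) (ω : Ω) : ℝ :=
  M.P0 t ω + M.γ * χ.traded t ω + M.h (χ.ξ t ω)

/-- The price in the dark pool at time `t`. -/
noncomputable def darkPrice (M : AlmgrenChrissModel P) (D : DarkPoolExtension Ω) (χ : Strategy Ω)
    (t : ℝ≥0) (ω : Ω) : ℝ :=
  M.P0 t ω + M.γ * χ.traded t ω + D.κ * M.h (χ.ξ t ω)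

/-- The costs `C_T^χ`. The expenses `∫_0^T ξ_t P^χ_t dt` at the exchange may be `+∞`, hence are an
extended integral. As the `τ_i` are strictly increasing, `Z_{τ_i -}` is the sum of the executions
with index smaller than `i`. -/
noncomputable def cost (M : AlmgrenChrissModel P) (D : DarkPoolExtension Ω) (X₀ : ℝ) (T : ℝ≥0)
    (χ : Strategy Ω) (ω : Ω) : EReal :=
  ((X₀ * M.P0 0 ω : ℝ) : EReal)
    + extIntegral (volume.restrict (Ioc (0 : ℝ) T))
        (fun t => ((χ.ξ t.toNNReal ω * χ.price M t.toNNReal ω : ℝ) : EReal))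
    + ((D.α * M.γ * ∫ t in (0 : ℝ)..T,
          D.Z χ.Xhat χ.Ξ (min (χ.ρ ω) t.toNNReal) ω * χ.ξ t.toNNReal ω : ℝ) : EReal)
    + ((∑ i ∈ Finset.range (D.N (χ.ρ ω) ω), D.Y χ.Xhat χ.Ξ i ω *
          (χ.darkPrice M D (D.τ i ω) ω
            + D.α * M.γ * (∑ j ∈ Finset.range i, D.Y χ.Xhat χ.Ξ j ω)
            + D.β (D.Y χ.Xhat χ.Ξ i ω)) : ℝ) : EReal)

end Strategy

/-- The infimum of the expected costs over all admissible strategies whose expected costs are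
defined. -/
noncomputable def minimalExpectedCost {Ω : Type*} [MeasurableSpace Ω] {P : Measure Ω}
    (M : AlmgrenChrissModel P) (D : DarkPoolExtension Ω) (X₀ : ℝ) (T : ℝ≥0) : EReal :=
  ⨅ χ ∈ {χ : Strategy Ω | χ.IsAdmissible M D X₀ T ∧ HasExtIntegral P (χ.cost M D X₀ T)},
    extIntegral P (χ.cost M D X₀ T)

end DarkPool

namespace DarkPool

set_option linter.unusedSectionVars false

/-! ### Absolutely continuous paths -/

/-! Every incoming order is infinite, so the first arrival τ = `D.τ 0` fills the whole dark-pool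
order q = `Xhat` and later arrivals do nothing. When ξ² is integrable on [0, T], the costs split
into `priceCost`, linear in P⁰, and `impactCost`, free of P⁰ (`cost_eq`); otherwise they are +∞
(`cost_eq_top`).

Price part. By summation by parts `priceCost` is formally -∫ B dP⁰, with B the bounded position, and
is a limit of transforms of P⁰ along grids. P⁰ remains a martingale for (𝓖_t), because up to null
sets the extra information is a function of N, which is independent of 𝓕_∞. The mean ought to be 0,
but for a mere martingale such a limit need not be integrable. The lower bound only needs mean ≥ 0
once the positive part is integrable, and this follows from the directional convexity of
Burkholder's function (`integrable_and_integral_nonneg_of_tendsto_transform`). The strategies used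
for the upper bound have bounded speed, and there a submartingale estimate gives integrability
(`integrable_priceCost_of_bounded`).

Impact part. With X_t = X₀ + ∫₀ᵗ ξ and g(x) = γqx + γq²/2, one minimises the mean of η∫ξ² + 1_{τ≤ρ}
g(X_τ). As τ is memoryless, this is a stationary control problem, and v(x) = min(γq²/2 - γ²q²/(4ηθ)
+ γqx, 0) is a subsolution of its Hamilton-Jacobi-Bellman equation. Integrating along the path up to
τ ∧ ρ (`impactCost_ge`) and using the compensator formula for k = g - v (`integral_at_arrival`)
gives a mean of at least γX₀²/2 + v(X₀). Since γ < 2ηθ, the quadratic in q is convex, and minimising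
it gives the claimed constant, for every T (`quadratic_bound`).

Sharpness. Take the minimising q, trade at the HJB-optimal constant speed -γq/(2η) until τ, cancel
at T/2 and liquidate the rest evenly over (T/2, T]. As T → ∞ the cost of this last phase vanishes,
and the means converge to the bound. -/

lemma absolutelyContinuousOnInterval_min_zero {f : ℝ → ℝ} {a b : ℝ}
    (hf : AbsolutelyContinuousOnInterval f a b) :
    AbsolutelyContinuousOnInterval (fun x => min (f x) 0) a b := by
  rw [absolutelyContinuousOnInterval_iff] at hf ⊢
  intro ε hε
  obtain ⟨δ, hδ, H⟩ := hf ε hε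
  refine ⟨δ, hδ, fun E hE hE' => (Finset.sum_le_sum fun i _ => ?_).trans_lt (H E hE hE')⟩
  rw [Real.dist_eq, Real.dist_eq]
  simpa using abs_min_sub_min_le_max (f (E.2 i).1) 0 (f (E.2 i).2) 0

lemma ae_hasDerivAt_primitive {ξ : ℝ → ℝ} {T : ℝ} (hξ : IntervalIntegrable ξ volume 0 T) :
    ∀ᵐ s, s ∈ uIcc 0 T → HasDerivAt (fun s => ∫ u in (0 : ℝ)..s, ξ u) (ξ s) s := by
  filter_upwards [hξ.ae_hasDerivAt_integral] with s hs hsT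
  exact hs hsT 0 left_mem_uIcc

/-- Integration by parts for absolutely continuous functions. Consequently linear permanent impact
at the exchange depends on the net traded volume only. -/
lemma integral_mul_primitive {ξ : ℝ → ℝ} {T : ℝ} (hξ : IntervalIntegrable ξ volume 0 T) :
    ∫ s in (0 : ℝ)..T, ξ s * ∫ u in (0 : ℝ)..s, ξ u = (∫ u in (0 : ℝ)..T, ξ u) ^ 2 / 2 := by
  have hA := hξ.absolutelyContinuousOnInterval_intervalIntegral (c := 0) left_mem_uIcc
  have h := hA.integral_deriv_mul_eq_sub hA
  have h2 : ∫ s in (0 : ℝ)..T, 2 * (ξ s * ∫ u in (0 : ℝ)..s, ξ u)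
      = (∫ u in (0 : ℝ)..T, ξ u) ^ 2 := by
    rw [intervalIntegral.integral_same, mul_zero, sub_zero, ← sq] at h
    rw [← h]
    apply intervalIntegral.integral_congr_ae
    filter_upwards [ae_hasDerivAt_primitive hξ] with s hs hsT
    rw [(hs (uIoc_subset_uIcc hsT)).deriv]
    ring
  rw [intervalIntegral.integral_const_mul] at h2
  linarith

/-- Verification along one path: v = min(a + b·, 0) satisfies ηξ² + G + v′ξ ≥ 0 for every speed ξ,
and integrating this inequality in time gives the claim. Where v is affine it comes from completing
the square, where v = 0 from G ≥ 0. -/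
lemma min_affine_le_of_subsolution {ξ G : ℝ → ℝ} {t x₀ a b η : ℝ} (ht : 0 ≤ t) (hη : 0 < η)
    (hξ : IntervalIntegrable ξ volume 0 t)
    (hξ2 : IntervalIntegrable (fun s => ξ s ^ 2) volume 0 t)
    (hG : Continuous G) (hG0 : ∀ y, 0 ≤ a + b * y → 0 ≤ G y)
    (hGb : ∀ y, a + b * y < 0 → b ^ 2 ≤ 4 * η * G y) :
    min (a + b * x₀) 0 ≤ min (a + b * (x₀ + ∫ u in (0 : ℝ)..t, ξ u)) 0
      + ∫ s in (0 : ℝ)..t, (η * ξ s ^ 2 + G (x₀ + ∫ u in (0 : ℝ)..s, ξ u)) := by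
  have hA := hξ.absolutelyContinuousOnInterval_intervalIntegral (c := 0) left_mem_uIcc
  have hconst : ∀ c : ℝ, AbsolutelyContinuousOnInterval (fun _ => c) 0 t := fun c =>
    (LipschitzOnWith.of_dist_le_mul (K := 0) (by simp)).absolutelyContinuousOnInterval
  have hv : AbsolutelyContinuousOnInterval (fun s => a + b * (x₀ + ∫ u in (0 : ℝ)..s, ξ u)) 0 t :=
    (hconst a).fun_add (((hconst x₀).fun_add hA).const_mul b)
  have hφ := absolutelyContinuousOnInterval_min_zero hv
  have hFTC := hφ.integral_deriv_eq_sub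
  have hGi : IntervalIntegrable (fun s => G (x₀ + ∫ u in (0 : ℝ)..s, ξ u)) volume 0 t :=
    (hG.comp_continuousOn ((continuousOn_const).add hA.continuousOn)).intervalIntegrable
  have hi : IntervalIntegrable (fun s => η * ξ s ^ 2 + G (x₀ + ∫ u in (0 : ℝ)..s, ξ u))
      volume 0 t := (hξ2.const_mul η).add hGi
  have key : 0 ≤ ∫ s in (0 : ℝ)..t,
      ((η * ξ s ^ 2 + G (x₀ + ∫ u in (0 : ℝ)..s, ξ u))
        + deriv (fun s => min (a + b * (x₀ + ∫ u in (0 : ℝ)..s, ξ u)) 0) s) := by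
    apply intervalIntegral.integral_nonneg_of_ae_restrict ht
    rw [EventuallyLE, ae_restrict_iff' measurableSet_Icc]
    filter_upwards [ae_hasDerivAt_primitive hξ, hφ.ae_differentiableAt] with s hs hd hsT
    rw [← uIcc_of_le ht] at hsT
    have hs := hs hsT
    have hd := hd hsT
    have hvd : HasDerivAt (fun s => a + b * (x₀ + ∫ u in (0 : ℝ)..s, ξ u)) (b * ξ s) s :=
      ((hs.const_add x₀).const_mul b).const_add a
    set v := fun s => a + b * (x₀ + ∫ u in (0 : ℝ)..s, ξ u) with hvdef
    show 0 ≤ _ + deriv (fun s => min (v s) 0) s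
    rcases lt_or_ge (v s) 0 with hneg | hpos
    · have : (fun s => min (v s) 0) =ᶠ[𝓝 s] v := by
        filter_upwards [hvd.continuousAt.eventually_lt continuousAt_const hneg] with r hr
        exact min_eq_left hr.le
      rw [this.deriv_eq, hvd.deriv]
      have := hGb _ hneg
      -- 4η(ηξ² + G + bξ) is at least (2ηξ + b)², since 4ηG ≥ b² here.
      have h1 : 0 ≤ (2 * η * ξ s + b) ^ 2 := sq_nonneg _
      nlinarith
    -- Where v ≥ 0 the truncated function attains its global maximum 0, so its derivative vanishes;
    -- the kink needs no separate treatment.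
    · have : IsLocalMax (fun s => min (v s) 0) s := by
        refine Eventually.of_forall fun r => ?_
        show min (v r) 0 ≤ min (v s) 0
        rw [min_eq_right hpos]
        exact min_le_right _ _
      rw [this.deriv_eq_zero]
      have := hG0 _ hpos
      have h2 := sq_nonneg (ξ s)
      positivity
  rw [intervalIntegral.integral_add hi hφ.intervalIntegrable_deriv, hFTC] at key
  simp only [intervalIntegral.integral_same, add_zero] at key
  linarith

/-! ### Burkholder's function -/

/-- The negative of Burkholder's function for the weak-type inequality: it equals `x² - y²` on
`|x| + |y| ≤ 1` and `2|x| - 1` elsewhere, and is convex along directions `(1, b)`, `|b| ≤ 1`. -/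
noncomputable def burkholder (x y : ℝ) : ℝ :=
  2 * |x| - 1 + (max (1 - |x|) 0) ^ 2 - (min |y| (max (1 - |x|) 0)) ^ 2

/-- The slope at `(x, y)` of a line in direction `(1, b)` that supports `burkholder`. -/
noncomputable def burkholderSlope (x y b : ℝ) : ℝ :=
  if |x| + |y| ≤ 1 then 2 * x - 2 * b * y else if 0 ≤ x then 2 else -2

lemma continuous_burkholder : Continuous (fun p : ℝ × ℝ => burkholder p.1 p.2) := by
  unfold burkholder
  fun_prop

lemma burkholder_of_le {x y : ℝ} (h : |x| + |y| ≤ 1) : burkholder x y = x ^ 2 - y ^ 2 := by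
  have hx := abs_nonneg x
  have hy := abs_nonneg y
  rw [burkholder, max_eq_left (by linarith), min_eq_left (by linarith), sq_abs]
  nlinarith [sq_abs x]

lemma burkholder_of_ge {x y : ℝ} (h : 1 ≤ |x| + |y|) : burkholder x y = 2 * |x| - 1 := by
  rw [burkholder, min_eq_right (max_le (by linarith) (abs_nonneg y))]
  ring

lemma two_mul_abs_sub_one_le_burkholder (x y : ℝ) : 2 * |x| - 1 ≤ burkholder x y := by
  have h0 : (0 : ℝ) ≤ max (1 - |x|) 0 := le_max_right _ _
  have h : (min |y| (max (1 - |x|) 0)) ^ 2 ≤ (max (1 - |x|) 0) ^ 2 :=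
    pow_le_pow_left₀ (le_min (abs_nonneg y) h0) (min_le_right _ _) 2
  unfold burkholder
  linarith

lemma sq_sub_sq_le_burkholder {x y : ℝ} (hx : |x| ≤ 1) : x ^ 2 - y ^ 2 ≤ burkholder x y := by
  rcases le_total (|x| + |y|) 1 with h | h
  · rw [burkholder_of_le h]
  · rw [burkholder_of_ge h]
    nlinarith [sq_abs x, sq_abs y, abs_nonneg y]

lemma burkholder_le (x y : ℝ) : burkholder x y ≤ 2 * |x| := by
  rcases le_total (|x| + |y|) 1 with h | h
  · rw [burkholder_of_le h]
    nlinarith [sq_abs x, abs_nonneg x, abs_nonneg y, sq_nonneg y]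
  · rw [burkholder_of_ge h]
    linarith

lemma abs_burkholderSlope_le {x y b : ℝ} (hb : |b| ≤ 1) : |burkholderSlope x y b| ≤ 2 := by
  unfold burkholderSlope
  split_ifs with h h'
  · have h1 : |b * y| ≤ |y| := by
      rw [abs_mul]
      exact mul_le_of_le_one_left (abs_nonneg y) hb
    have h2 : |2 * x - 2 * b * y| ≤ |2 * x| + |2 * (b * y)| := by
      rw [show 2 * b * y = 2 * (b * y) by ring]
      exact abs_sub _ _
    rw [abs_mul, abs_mul, abs_two] at h2
    linarith
  · simp
  · simp

/-- In the diamond |x| + |y| ≤ 1 the function is x² - y², whose second derivative along (1, b) is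
2(1 - b²) ≥ 0. Elsewhere it equals its global minorant 2|x| - 1. -/
lemma burkholder_add_slope_mul_le {x y b h : ℝ} (hb : |b| ≤ 1) :
    burkholder x y + burkholderSlope x y b * h ≤ burkholder (x + h) (y + b * h) := by
  have hs := abs_le.1 (abs_burkholderSlope_le (x := x) (y := y) hb)
  have hb2 : b ^ 2 ≤ 1 := by nlinarith [sq_abs b, abs_nonneg b]
  have hF := two_mul_abs_sub_one_le_burkholder (x + h) (y + b * h)
  by_cases hxy : |x| + |y| ≤ 1
  · rw [burkholder_of_le hxy]
    have hsl : burkholderSlope x y b = 2 * x - 2 * b * y := by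
      rw [burkholderSlope, if_pos hxy]
    rw [hsl] at hs ⊢
    have hquad : ∀ k : ℝ, x ^ 2 - y ^ 2 + (2 * x - 2 * b * y) * k
        ≤ (x + k) ^ 2 - (y + b * k) ^ 2 := fun k => by nlinarith [sq_nonneg k]
    rcases le_total (|x + h|) 1 with hX | hX
    · exact (hquad h).trans (sq_sub_sq_le_burkholder hX)
    -- Beyond |x| = 1, compare at the crossing point x = ±1: there the supporting line is at most 1
    -- = 2|x| - 1, and from there on its slope is at most 2 in absolute value.
    · refine le_trans ?_ hF
      rcases le_abs'.1 hX with hX' | hX'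
      · rw [abs_of_nonpos (by linarith)]
        have h1 := hquad (-1 - x)
        have h2 := sq_nonneg (y + b * (-1 - x))
        nlinarith [mul_nonneg (show 0 ≤ 2 + (2 * x - 2 * b * y) by linarith)
          (show 0 ≤ -1 - x - h by linarith)]
      · rw [abs_of_nonneg (by linarith)]
        have h1 := hquad (1 - x)
        have h2 := sq_nonneg (y + b * (1 - x))
        nlinarith [mul_nonneg (show 0 ≤ 2 - (2 * x - 2 * b * y) by linarith)
          (show 0 ≤ x + h - 1 by linarith)]
  · rw [burkholder_of_ge (by linarith)]
    refine le_trans ?_ hF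
    rw [burkholderSlope, if_neg hxy]
    split_ifs with h0
    · rw [abs_of_nonneg h0]
      linarith [le_abs_self (x + h)]
    · rw [abs_of_neg (by linarith)]
      linarith [neg_le_abs (x + h)]

/-- The starting value: the transform begins at 0, which the shift by 1/2 in `compTrunc` places at y
= -1/2. -/
lemma neg_quarter_le_burkholder (x : ℝ) : 0 ≤ burkholder x (-(1 / 2)) + 1 / 4 := by
  have hy : |(-(1 / 2) : ℝ)| = 1 / 2 := by norm_num [abs_of_nonneg]
  rcases le_total (|x| + |(-(1 / 2) : ℝ)|) 1 with h | h
  · rw [burkholder_of_le h]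
    nlinarith [sq_nonneg x]
  · rw [burkholder_of_ge h]
    rw [hy] at h
    linarith

/-- The truncation of `y ↦ y` at scale `n`, compensated in `x` so as to be convex along the
directions `(1, b)`, `|b| ≤ 1`. -/
noncomputable def compTrunc (n x y : ℝ) : ℝ :=
  n * (burkholder (x / n) (y / n - 1 / 2) + 1 / 4)

lemma compTrunc_le_const {n : ℝ} (hn : 0 < n) (x y : ℝ) : compTrunc n x y ≤ 2 * |x| + n := by
  have h := burkholder_le (x / n) (y / n - 1 / 2)
  have : compTrunc n x y ≤ n * (2 * |x / n| + 1 / 4) :=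
    mul_le_mul_of_nonneg_left (by linarith) hn.le
  rw [abs_div, abs_of_pos hn] at this
  have e : n * (2 * (|x| / n) + 1 / 4) = 2 * |x| + n / 4 := by field_simp
  linarith

lemma le_compTrunc {n : ℝ} (hn : 0 < n) (x y : ℝ) : -n ≤ compTrunc n x y := by
  have h := two_mul_abs_sub_one_le_burkholder (x / n) (y / n - 1 / 2)
  have h' := abs_nonneg (x / n)
  have : n * (-1) ≤ compTrunc n x y := mul_le_mul_of_nonneg_left (by linarith) hn.le
  linarith

/-- Unlike `compTrunc_le_const`, this bound does not depend on n, so it serves as the majorant when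
n → ∞. -/
lemma compTrunc_le {n : ℝ} (hn : 0 < n) (x y : ℝ) :
    compTrunc n x y ≤ max y 0 + 2 * |x| := by
  have key : ∀ u v : ℝ, burkholder u (v - 1 / 2) + 1 / 4 ≤ max v 0 + 2 * |u| := by
    intro u v
    have h1 := le_max_left v 0
    have h2 := le_max_right v 0
    have h3 := abs_nonneg u
    rcases le_total (|u| + |v - 1 / 2|) 1 with h | h
    · rw [burkholder_of_le h]
      have : |u| ≤ 1 := by linarith [abs_nonneg (v - 1 / 2)]
      nlinarith [sq_abs u, sq_nonneg v]
    · rw [burkholder_of_ge h]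
      linarith
  have := mul_le_mul_of_nonneg_left (key (x / n) (y / n)) hn.le
  refine this.trans (le_of_eq ?_)
  rw [abs_div, abs_of_pos hn, mul_add, mul_max_of_nonneg _ _ hn.le]
  field_simp
  simp

/-- For large n the rescaled point lies in the diamond, where u² - (v - 1/2)² + 1/4 = v + u² - v².
The shift by 1/2 thus creates the linear term that survives the rescaling. -/
lemma compTrunc_eventuallyEq (x y : ℝ) :
    ∀ᶠ n : ℝ in atTop, compTrunc n x y = y + (x ^ 2 - y ^ 2) / n := by
  filter_upwards [eventually_gt_atTop 0, eventually_ge_atTop (2 * (|x| + |y|))] with n hn hn'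
  have h : |x / n| + |y / n - 1 / 2| ≤ 1 := by
    have h1 : |y / n - 1 / 2| ≤ |y / n| + |(1 / 2 : ℝ)| := abs_sub _ _
    have h2 : |x / n| + |y / n| ≤ 1 / 2 := by
      rw [abs_div, abs_div, abs_of_pos hn, ← add_div, div_le_iff₀ hn]
      linarith
    rw [abs_of_pos (by norm_num : (0 : ℝ) < 1 / 2)] at h1
    linarith
  rw [compTrunc, burkholder_of_le h]
  field_simp
  ring

lemma tendsto_compTrunc (x y : ℝ) :
    Tendsto (fun n : ℕ => compTrunc (n + 1) x y) atTop (𝓝 y) := by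
  have h : Tendsto (fun n : ℝ => y + (x ^ 2 - y ^ 2) / n) atTop (𝓝 (y + 0)) :=
    tendsto_const_nhds.add (tendsto_const_nhds.div_atTop tendsto_id)
  rw [add_zero] at h
  have h' : Tendsto (fun n : ℝ => compTrunc n x y) atTop (𝓝 y) :=
    h.congr' ((compTrunc_eventuallyEq x y).mono fun n hn => hn.symm)
  exact h'.comp (tendsto_atTop_add_const_right _ _ tendsto_natCast_atTop_atTop)

lemma continuous_compTrunc (n : ℝ) : Continuous (fun p : ℝ × ℝ => compTrunc n p.1 p.2) := by
  have : Continuous (fun p : ℝ × ℝ => (p.1 / n, p.2 / n - 1 / 2)) := by fun_prop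
  exact continuous_const.mul ((continuous_burkholder.comp this).add continuous_const)

lemma continuous_compTrunc_right (n x : ℝ) : Continuous (compTrunc n x) :=
  (continuous_compTrunc n).comp (continuous_const.prodMk continuous_id)

/-! ### Martingale transforms -/

section Transform

variable {Ω : Type*} [mΩ : MeasurableSpace Ω] {P : Measure Ω} [IsProbabilityMeasure P]
  {𝓖 : Filtration ℝ≥0 mΩ} {X : ℝ≥0 → Ω → ℝ}

lemma integral_mul_increment_eq_zero (hX : Martingale X 𝓖 P) {s t : ℝ≥0} (hst : s ≤ t)
    {φ : Ω → ℝ} (hφ : StronglyMeasurable[𝓖 s] φ) {C : ℝ} (hC : ∀ ω, |φ ω| ≤ C) :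
    ∫ ω, φ ω * (X t ω - X s ω) ∂P = 0 := by
  have hint : Integrable (X t - X s) P := (hX.integrable t).sub (hX.integrable s)
  have h := condExp_stronglyMeasurable_mul_of_bound (𝓖.le s) hφ hint C
    (Eventually.of_forall hC)
  have h0 : P[X t - X s | 𝓖 s] =ᵐ[P] 0 := by
    filter_upwards [condExp_sub (hX.integrable t) (hX.integrable s) (𝓖 s),
      hX.condExp_ae_eq hst, hX.condExp_ae_eq le_rfl] with ω h1 h2 h3
    rw [h1, Pi.sub_apply, h2, h3]
    simp
  have h1 : P[φ * (X t - X s) | 𝓖 s] =ᵐ[P] 0 := by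
    filter_upwards [h, h0] with ω h1 h2
    rw [h1, Pi.mul_apply, h2]
    simp
  have h2 := integral_condExp (μ := P) (f := φ * (X t - X s)) (𝓖.le s)
  rw [integral_congr_ae h1] at h2
  simpa using h2.symm

/-- The transform of `X` by `b` along the times `t`. -/
def transform (X : ℝ≥0 → Ω → ℝ) (t : ℕ → ℝ≥0) (b : ℕ → Ω → ℝ) (k : ℕ) (ω : Ω) : ℝ :=
  ∑ j ∈ Finset.range k, b j ω * (X (t (j + 1)) ω - X (t j) ω)

lemma stronglyMeasurable_transform (hX : Martingale X 𝓖 P) {t : ℕ → ℝ≥0} (ht : Monotone t)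
    {b : ℕ → Ω → ℝ} (hb : ∀ k, StronglyMeasurable[𝓖 (t k)] (b k)) (k : ℕ) :
    StronglyMeasurable[𝓖 (t k)] (transform X t b k) := by
  refine Finset.stronglyMeasurable_fun_sum _ fun j hj => ?_
  have hjk : j < k := Finset.mem_range.1 hj
  exact ((hb j).mono (𝓖.mono (ht hjk.le))).mul
    (((hX.stronglyMeasurable _).mono (𝓖.mono (ht hjk))).sub
      ((hX.stronglyMeasurable _).mono (𝓖.mono (ht hjk.le))))

lemma integrable_compTrunc {n : ℝ} (hn : 0 < n) {U V : Ω → ℝ} (hU : Integrable U P)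
    (hV : AEStronglyMeasurable V P) : Integrable (fun ω => compTrunc n (U ω) (V ω)) P := by
  refine Integrable.mono' ((hU.abs.const_mul 2).add (integrable_const n)) ?_
    (Eventually.of_forall fun ω => ?_)
  · have h : AEStronglyMeasurable (fun ω => (U ω, V ω)) P := hU.1.prodMk hV
    exact (continuous_compTrunc n).comp_aestronglyMeasurable (f := fun ω => (U ω, V ω)) h
  · have h1 := compTrunc_le_const hn (U ω) (V ω)
    have h2 := le_compTrunc hn (U ω) (V ω)
    have h3 := abs_nonneg (U ω)
    show |compTrunc n (U ω) (V ω)| ≤ 2 * |U ω| + n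
    rw [abs_le]
    constructor <;> linarith

/-- The pair (X, transform) moves in the direction (1, b_k) with |b_k| ≤ 1. By convexity `compTrunc`
grows by at least a bounded 𝓖-measurable slope times the increment of X, which has mean zero. So the
mean is nondecreasing in k, and it starts nonnegative. -/
lemma integral_compTrunc_transform_nonneg (hX : Martingale X 𝓖 P) {t : ℕ → ℝ≥0}
    (ht : Monotone t) {b : ℕ → Ω → ℝ} (hb : ∀ k, StronglyMeasurable[𝓖 (t k)] (b k))
    (hb1 : ∀ k ω, |b k ω| ≤ 1) {n : ℝ} (hn : 0 < n) (k : ℕ) :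
    0 ≤ ∫ ω, compTrunc n (X (t k) ω) (transform X t b k ω) ∂P := by
  induction k with
  | zero =>
    refine integral_nonneg fun ω => ?_
    have := neg_quarter_le_burkholder (X (t 0) ω / n)
    simp only [transform, Finset.range_zero, Finset.sum_empty, compTrunc, zero_div, zero_sub,
      Pi.zero_apply]
    positivity
  | succ k ih =>
    have hL : StronglyMeasurable[𝓖 (t k)] (transform X t b k) :=
      stronglyMeasurable_transform hX ht hb k
    have hXk : StronglyMeasurable[𝓖 (t k)] (X (t k)) := hX.stronglyMeasurable _
    have hk : t k ≤ t (k + 1) := ht k.le_succ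
    set φ : Ω → ℝ := fun ω =>
      burkholderSlope (X (t k) ω / n) (transform X t b k ω / n - 1 / 2) (b k ω) with hφdef
    have hφ : StronglyMeasurable[𝓖 (t k)] φ := by
      apply Measurable.stronglyMeasurable
      have h1 := hL.measurable
      have h2 := hXk.measurable
      have h3 := (hb k).measurable
      refine Measurable.ite ?_ (by fun_prop) (Measurable.ite ?_ measurable_const measurable_const)
      · apply measurableSet_le <;> fun_prop
      · apply measurableSet_le <;> fun_prop
    have hφ2 : ∀ ω, |φ ω| ≤ 2 := fun ω => abs_burkholderSlope_le (hb1 k ω)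
    have hinc := integral_mul_increment_eq_zero hX hk hφ hφ2
    have hi1 := integrable_compTrunc hn (hX.integrable (t k))
      ((hL.mono (𝓖.le _)).aestronglyMeasurable)
    have hi2 := integrable_compTrunc hn (hX.integrable (t (k + 1)))
      (((stronglyMeasurable_transform hX ht hb (k + 1)).mono (𝓖.le _)).aestronglyMeasurable)
    have hi3 : Integrable (fun ω => φ ω * (X (t (k + 1)) ω - X (t k) ω)) P :=
      ((hX.integrable _).sub (hX.integrable _)).bdd_mul
        (hφ.mono (𝓖.le _)).aestronglyMeasurable (Eventually.of_forall hφ2)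
    calc 0 ≤ _ := ih
      _ = ∫ ω, (compTrunc n (X (t k) ω) (transform X t b k ω)
            + φ ω * (X (t (k + 1)) ω - X (t k) ω)) ∂P := by
          rw [integral_add hi1 hi3, hinc, add_zero]
      _ ≤ _ := by
          refine integral_mono (hi1.add hi3) hi2 fun ω => ?_
          have h := burkholder_add_slope_mul_le (x := X (t k) ω / n)
            (y := transform X t b k ω / n - 1 / 2)
            (h := (X (t (k + 1)) ω - X (t k) ω) / n) (hb1 k ω)
          have e1 : X (t k) ω / n + (X (t (k + 1)) ω - X (t k) ω) / n = X (t (k + 1)) ω / n := by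
            ring
          have e2 : transform X t b k ω / n - 1 / 2
              + b k ω * ((X (t (k + 1)) ω - X (t k) ω) / n)
              = transform X t b (k + 1) ω / n - 1 / 2 := by
            rw [transform, transform, Finset.sum_range_succ]
            ring
          rw [e1, e2] at h
          have h' := mul_le_mul_of_nonneg_left h hn.le
          have e3 : n * (burkholderSlope (X (t k) ω / n) (transform X t b k ω / n - 1 / 2) (b k ω)
              * ((X (t (k + 1)) ω - X (t k) ω) / n)) = φ ω * (X (t (k + 1)) ω - X (t k) ω) := by
            rw [hφdef]
            field_simp
          simp only [compTrunc]
          linarith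

/-- At a fixed scale n all the truncated transforms are dominated by 2|X_T| + n, so the limit along
the grids needs only X_T integrable. -/
lemma integral_compTrunc_nonneg_of_tendsto (hX : Martingale X 𝓖 P) {T : ℝ≥0}
    {t : ℕ → ℕ → ℝ≥0} (ht : ∀ m, Monotone (t m)) {K : ℕ → ℕ} (hK : ∀ m, t m (K m) = T)
    {b : ℕ → ℕ → Ω → ℝ} (hb : ∀ m k, StronglyMeasurable[𝓖 (t m k)] (b m k))
    (hb1 : ∀ m k ω, |b m k ω| ≤ 1) {L : Ω → ℝ}
    (hL : ∀ᵐ ω ∂P, Tendsto (fun m => transform X (t m) (b m) (K m) ω) atTop (𝓝 (L ω)))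
    {n : ℝ} (hn : 0 < n) : 0 ≤ ∫ ω, compTrunc n (X T ω) (L ω) ∂P := by
  have hmeas : ∀ m, AEStronglyMeasurable (transform X (t m) (b m) (K m)) P := fun m =>
    ((stronglyMeasurable_transform hX (ht m) (hb m) (K m)).mono (𝓖.le _)).aestronglyMeasurable
  have hlim : Tendsto (fun m => ∫ ω, compTrunc n (X T ω) (transform X (t m) (b m) (K m) ω) ∂P)
      atTop (𝓝 (∫ ω, compTrunc n (X T ω) (L ω) ∂P)) := by
    refine tendsto_integral_of_dominated_convergence (fun ω => 2 * |X T ω| + n)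
      (fun m => (integrable_compTrunc hn (hX.integrable T) (hmeas m)).1)
      (((hX.integrable T).abs.const_mul 2).add (integrable_const n)) (fun m => ?_) ?_
    · refine Eventually.of_forall fun ω => ?_
      have h1 := compTrunc_le_const hn (X T ω) (transform X (t m) (b m) (K m) ω)
      have h2 := le_compTrunc hn (X T ω) (transform X (t m) (b m) (K m) ω)
      have h3 := abs_nonneg (X T ω)
      rw [Real.norm_eq_abs, abs_le]
      constructor <;> linarith
    · filter_upwards [hL] with ω hω
      exact Tendsto.comp (g := compTrunc n (X T ω)) (continuous_compTrunc_right n _).continuousAt hω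
  refine ge_of_tendsto' hlim fun m => ?_
  have := integral_compTrunc_transform_nonneg hX (ht m) (hb m) (hb1 m) hn (K m)
  rwa [hK m] at this

/-- A limit of transforms of a martingale by uniformly bounded integrands has nonnegative mean as
soon as its positive part is integrable. -/
theorem integrable_and_integral_nonneg_of_tendsto_transform (hX : Martingale X 𝓖 P) {T : ℝ≥0}
    {t : ℕ → ℕ → ℝ≥0} (ht : ∀ m, Monotone (t m)) {K : ℕ → ℕ} (hK : ∀ m, t m (K m) = T)
    {b : ℕ → ℕ → Ω → ℝ} (hb : ∀ m k, StronglyMeasurable[𝓖 (t m k)] (b m k))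
    (hb1 : ∀ m k ω, |b m k ω| ≤ 1) {L : Ω → ℝ}
    (hL : ∀ᵐ ω ∂P, Tendsto (fun m => transform X (t m) (b m) (K m) ω) atTop (𝓝 (L ω)))
    {F : Ω → ℝ} (hF : Integrable F P) (hLF : ∀ᵐ ω ∂P, L ω ≤ F ω) :
    Integrable L P ∧ 0 ≤ ∫ ω, L ω ∂P := by
  have hLm : AEStronglyMeasurable L P := aestronglyMeasurable_of_tendsto_ae atTop
    (fun m => ((stronglyMeasurable_transform hX (ht m) (hb m) (K m)).mono
      (𝓖.le _)).aestronglyMeasurable) hL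
  have hV : ∀ n : ℕ, 0 ≤ ∫ ω, compTrunc (n + 1) (X T ω) (L ω) ∂P := fun n =>
    integral_compTrunc_nonneg_of_tendsto hX ht hK hb hb1 hL (by positivity)
  set H : Ω → ℝ := fun ω => max (F ω) 0 + 2 * |X T ω| with hH
  have hHi : Integrable H P := hF.pos_part.add ((hX.integrable T).abs.const_mul 2)
  have hVi : ∀ n : ℕ, Integrable (fun ω => compTrunc (n + 1) (X T ω) (L ω)) P := fun n =>
    integrable_compTrunc (by positivity) (hX.integrable T) hLm
  have hle : ∀ n : ℕ, ∀ᵐ ω ∂P, compTrunc (n + 1) (X T ω) (L ω) ≤ H ω := fun n => by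
    filter_upwards [hLF] with ω hω
    exact (compTrunc_le (by positivity) _ _).trans
      (add_le_add_left (max_le_max_right 0 hω) _)
  -- Fatou as n → ∞ for H minus the truncations, which is nonnegative almost surely with mean at
  -- most E[H]. The resulting bound E[H - L] ≤ E[H] gives both the integrability of L and E[L] ≥ 0.
  have hfatou : ∫⁻ ω, ENNReal.ofReal (H ω - L ω) ∂P ≤ ENNReal.ofReal (∫ ω, H ω ∂P) := by
    calc ∫⁻ ω, ENNReal.ofReal (H ω - L ω) ∂P
        = ∫⁻ ω, liminf (fun n : ℕ => ENNReal.ofReal (H ω - compTrunc (n + 1) (X T ω) (L ω)))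
            atTop ∂P := by
          refine lintegral_congr fun ω => (Tendsto.liminf_eq ?_).symm
          exact ENNReal.tendsto_ofReal (tendsto_const_nhds.sub (tendsto_compTrunc _ _))
      _ ≤ liminf (fun n : ℕ =>
            ∫⁻ ω, ENNReal.ofReal (H ω - compTrunc (n + 1) (X T ω) (L ω)) ∂P) atTop :=
          lintegral_liminf_le' fun n => (hHi.sub (hVi n)).1.aemeasurable.ennreal_ofReal
      _ ≤ liminf (fun _ : ℕ => ENNReal.ofReal (∫ ω, H ω ∂P)) atTop := by
          refine liminf_le_liminf (Eventually.of_forall fun n => ?_)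
          have hi : Integrable (fun ω => H ω - compTrunc (n + 1) (X T ω) (L ω)) P :=
            hHi.sub (hVi n)
          rw [← ofReal_integral_eq_lintegral_ofReal hi
            ((hle n).mono fun ω hω => sub_nonneg.2 hω)]
          refine ENNReal.ofReal_le_ofReal ?_
          rw [integral_sub hHi (hVi n)]
          have := hV n
          linarith
      _ = _ := by simp
  have hHL : ∀ᵐ ω ∂P, 0 ≤ H ω - L ω := by
    filter_upwards [hLF] with ω hω
    have h1 := le_max_left (F ω) 0
    have h2 := abs_nonneg (X T ω)
    simp only [hH]
    linarith
  have hHLi : Integrable (fun ω => H ω - L ω) P :=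
    (lintegral_ofReal_ne_top_iff_integrable (hHi.1.sub hLm) hHL).1
      (hfatou.trans_lt ENNReal.ofReal_lt_top).ne
  have hLi : Integrable L P := by
    have := hHi.sub hHLi
    refine this.congr (Eventually.of_forall fun ω => ?_)
    simp
  refine ⟨hLi, ?_⟩
  rw [← ofReal_integral_eq_lintegral_ofReal hHLi hHL, ENNReal.ofReal_le_ofReal_iff
    (integral_nonneg fun ω => by positivity), integral_sub hHi hLi] at hfatou
  linarith

end Transform

/-! ### The counting process and the execution of the dark-pool order -/

namespace DarkPoolExtension

variable {Ω : Type*} [mΩ : MeasurableSpace Ω] (D : DarkPoolExtension Ω)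

lemma τ_zero_le (i : ℕ) (ω : Ω) : D.τ 0 ω ≤ D.τ i ω := (D.τ_strictMono ω).monotone (Nat.zero_le i)

lemma N_eq_zero_of_lt {t : ℝ≥0} {ω : Ω} (h : t < D.τ 0 ω) : D.N t ω = 0 := by
  have : {i : ℕ | D.τ i ω ≤ t} = ∅ := by
    ext i
    simpa using h.trans_le (D.τ_zero_le i ω)
  rw [N, this, ncard_empty]

/-- Finiteness matters because `ncard` of an infinite set is 0. -/
lemma lt_N_iff {t : ℝ≥0} {ω : Ω} (hfin : {i : ℕ | D.τ i ω ≤ t}.Finite) (i : ℕ) :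
    i < D.N t ω ↔ D.τ i ω ≤ t := by
  constructor
  · intro h
    by_contra hi
    have hsub : {j : ℕ | D.τ j ω ≤ t} ⊆ (Finset.range i : Set ℕ) := fun j hj => by
      have : D.τ j ω < D.τ i ω := lt_of_le_of_lt hj (not_le.1 hi)
      simpa using (D.τ_strictMono ω).lt_iff_lt.1 this
    have := ncard_le_ncard hsub (Finset.finite_toSet _)
    rw [ncard_coe_finset, Finset.card_range] at this
    exact absurd h (not_lt.2 this)
  · intro h
    have hsub : (Finset.range (i + 1) : Set ℕ) ⊆ {j : ℕ | D.τ j ω ≤ t} := fun j hj => by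
      have hj' : j ≤ i := by simpa [Nat.lt_succ_iff] using hj
      exact ((D.τ_strictMono ω).monotone hj').trans h
    have := ncard_le_ncard hsub hfin
    rw [ncard_coe_finset, Finset.card_range] at this
    exact this

/-- The paths on which the arrival times do not accumulate and all incoming orders are infinite. -/
def Regular (ω : Ω) : Prop :=
  (∀ t, {i : ℕ | D.τ i ω ≤ t}.Finite) ∧ ∀ i, D.Ytilde i ω = ⊤

variable {D} in
lemma Regular.lt_N_iff {ω : Ω} (h : D.Regular ω) (t : ℝ≥0) (i : ℕ) :
    i < D.N t ω ↔ D.τ i ω ≤ t := D.lt_N_iff (h.1 t) i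

variable {D} in
lemma Regular.remaining_succ {ω : Ω} (h : D.Regular ω) (Xhat Ξ : ℝ) (i : ℕ) :
    D.remaining Xhat Ξ ω (i + 1) = 0 := by
  have hnn : 0 ≤ D.remaining Xhat Ξ ω i := by
    induction i with
    | zero => exact abs_nonneg _
    | succ i ih =>
      rw [remaining, h.2 i, if_pos le_top, min_eq_right le_top, ENNReal.toReal_ofReal ih, sub_self]
  rw [remaining, h.2 i, if_pos le_top, min_eq_right le_top, ENNReal.toReal_ofReal hnn, sub_self]

variable {D} in
lemma Regular.Y_zero {ω : Ω} (h : D.Regular ω) (Xhat Ξ : ℝ) : D.Y Xhat Ξ 0 ω = Xhat := by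
  rw [Y, h.remaining_succ, remaining, sub_zero]
  rcases lt_trichotomy Xhat 0 with hX | rfl | hX
  · rw [Real.sign_of_neg hX, abs_of_neg hX]
    ring
  · simp
  · rw [Real.sign_of_pos hX, abs_of_pos hX, one_mul]

variable {D} in
lemma Regular.Y_succ {ω : Ω} (h : D.Regular ω) (Xhat Ξ : ℝ) (i : ℕ) :
    D.Y Xhat Ξ (i + 1) ω = 0 := by
  rw [Y, h.remaining_succ, h.remaining_succ, sub_zero, mul_zero]

variable {D} in
-- The first infinite order executes all of `Xhat`, so every sum over executions reduces to its term
-- of index 0.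
lemma Regular.sum_Y_mul {ω : Ω} (h : D.Regular ω) (Xhat Ξ : ℝ) (t : ℝ≥0) (c : ℕ → ℝ) :
    ∑ i ∈ Finset.range (D.N t ω), D.Y Xhat Ξ i ω * c i
      = if D.τ 0 ω ≤ t then Xhat * c 0 else 0 := by
  split_ifs with ht
  · have hN : 0 < D.N t ω := (h.lt_N_iff t 0).2 ht
    rw [Finset.sum_eq_single 0, h.Y_zero]
    · intro i _ hi
      obtain ⟨j, rfl⟩ := Nat.exists_eq_succ_of_ne_zero hi
      rw [h.Y_succ, zero_mul]
    · intro h0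
      exact absurd (Finset.mem_range.2 hN) h0
  · rw [D.N_eq_zero_of_lt (not_le.1 ht), Finset.range_zero, Finset.sum_empty]

variable {D} in
lemma Regular.Z_eq {ω : Ω} (h : D.Regular ω) (Xhat Ξ : ℝ) (t : ℝ≥0) :
    D.Z Xhat Ξ t ω = if D.τ 0 ω ≤ t then Xhat else 0 := by
  have := h.sum_Y_mul Xhat Ξ t (fun _ => 1)
  simpa [Z] using this

variable {P : Measure Ω} [IsProbabilityMeasure P] {D} {M : AlmgrenChrissModel P} {θ : ℝ≥0}

/-- If the arrival times accumulated before t, then `ncard` would give N_n = 0 for integers n ≥ t,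
although N_q ≥ 1 at a rational q between the first two arrivals. This contradicts the almost sure
nonnegativity of countably many Poisson increments N_n - N_q. -/
lemma IsPoisson.ae_finite (h : D.IsPoisson P θ) :
    ∀ᵐ ω ∂P, ∀ t, {i : ℕ | D.τ i ω ≤ t}.Finite := by
  have hmono : ∀ s t : ℝ≥0, s ≤ t → ∀ᵐ ω ∂P, 0 ≤ (D.N t ω : ℤ) - D.N s ω := by
    intro s t hst
    rw [(h.2 s t hst).ae_iff (p := fun z : ℤ => 0 ≤ z) (Measurable.of_discrete)]
    rw [ae_map_iff (Measurable.of_discrete).aemeasurable (MeasurableSet.of_discrete)]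
    exact Eventually.of_forall fun n => Int.natCast_nonneg n
  have hall : ∀ᵐ ω ∂P, ∀ n : ℕ, ∀ q : ℚ, 0 ≤ q → ((q : ℝ).toNNReal ≤ n) →
      0 ≤ (D.N n ω : ℤ) - D.N ((q : ℝ).toNNReal) ω := by
    rw [ae_all_iff]; intro n
    rw [ae_all_iff]; intro q
    by_cases hq : 0 ≤ q
    · by_cases hqn : (q : ℝ).toNNReal ≤ n
      · filter_upwards [hmono _ _ hqn] with ω hω _ _ using hω
      · exact Eventually.of_forall fun ω _ h => absurd h hqn
    · exact Eventually.of_forall fun ω h => absurd h hq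
  filter_upwards [hall] with ω hω t
  by_contra hinf
  obtain ⟨n, hn⟩ := exists_nat_ge t
  have hle : ∀ i, D.τ i ω ≤ n := fun i => by
    obtain ⟨j, hj, hij⟩ := (Set.Infinite.exists_gt hinf) i
    exact (((D.τ_strictMono ω).monotone hij.le).trans hj).trans hn
  have hNn : D.N n ω = 0 := by
    have : {i : ℕ | D.τ i ω ≤ n} = univ := eq_univ_of_forall hle
    rw [N, this, ncard_univ, Nat.card_eq_zero_of_infinite]
  obtain ⟨q, hq0, hq1⟩ := exists_rat_btwn
    (show (D.τ 0 ω : ℝ) < D.τ 1 ω from NNReal.coe_lt_coe.2 (D.τ_strictMono ω one_pos))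
  have hq : (0 : ℝ) ≤ q := (NNReal.coe_nonneg _).trans hq0.le
  have hqc : ((q : ℝ).toNNReal : ℝ) = q := Real.coe_toNNReal _ hq
  have h0 : D.τ 0 ω ≤ (q : ℝ).toNNReal := by rw [← NNReal.coe_le_coe, hqc]; exact hq0.le
  have h1 : (q : ℝ).toNNReal < D.τ 1 ω := by rw [← NNReal.coe_lt_coe, hqc]; exact hq1
  have hfin : {i : ℕ | D.τ i ω ≤ (q : ℝ).toNNReal}.Finite := by
    refine (Set.finite_Iio 1).subset fun i hi => ?_
    exact (D.τ_strictMono ω).lt_iff_lt.1 (lt_of_le_of_lt hi h1)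
  have hNq : 0 < D.N ((q : ℝ).toNNReal) ω := (D.lt_N_iff hfin 0).2 h0
  have := hω n q (by exact_mod_cast hq) (h1.le.trans (hle 1))
  omega

lemma IndependenceAssumption.ae_regular (h : D.IndependenceAssumption M θ (Measure.dirac ⊤)) :
    ∀ᵐ ω ∂P, D.Regular ω := by
  have : ∀ᵐ ω ∂P, ∀ i, D.Ytilde i ω = ⊤ :=
    ae_all_iff.2 fun i => (h.hasLaw_Ytilde i).ae_eq_of_dirac
  filter_upwards [h.isPoisson.ae_finite, this] with ω h1 h2 using ⟨h1, h2⟩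

lemma IndependenceAssumption.measure_lt_τ (h : D.IndependenceAssumption M θ (Measure.dirac ⊤))
    (t : ℝ≥0) : P.real {ω | t < D.τ 0 ω} = Real.exp (-(θ * t)) := by
  have e : {ω | t < D.τ 0 ω} =ᵐ[P] {ω | (D.N t ω : ℤ) - D.N 0 ω = 0} := by
    filter_upwards [h.ae_regular] with ω hω
    have h0 : D.N 0 ω = 0 := D.N_eq_zero_of_lt (D.τ_pos ω)
    have h1 := hω.lt_N_iff t 0
    apply propext
    show t < D.τ 0 ω ↔ (D.N t ω : ℤ) - D.N 0 ω = 0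
    rw [h0, ← not_le, ← h1]
    simp
  rw [measureReal_congr e, (h.isPoisson.2 0 t zero_le).measureReal_eq
    (p := fun z : ℤ => z = 0) MeasurableSet.of_discrete,
    map_measureReal_apply Measurable.of_discrete MeasurableSet.of_discrete]
  have : (Nat.cast : ℕ → ℤ) ⁻¹' {x | x = 0} = {0} := by ext; simp
  rw [this, poissonMeasure_real_singleton]
  simp

/-! ### The enlarged filtration -/

lemma observation_le {Ω : Type*} {m : MeasurableSpace Ω} [mΩ : MeasurableSpace Ω]
    {D : DarkPoolExtension Ω} {Xhat Ξ : ℝ} {t : ℝ≥0}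
    (hZ : ∀ s ≤ t, Measurable[m] (D.Z Xhat Ξ s))
    (hτ : ∀ i, ∀ s ≤ t, Measurable[m] (fun ω => min (D.τ i ω) s)) :
    D.observation Xhat Ξ t ≤ m := by
  refine sup_le (iSup₂_le fun s hs => (hZ s hs).comap_le) ?_
  rw [iSup, Filtration.sSup_def]
  refine sSup_le ?_
  rintro _ ⟨_, ⟨i, rfl⟩, rfl⟩
  exact iSup₂_le fun s hs => (hτ i s hs).comap_le

lemma measurable_min_τ (Xhat Ξ : ℝ) (i : ℕ) (t : ℝ≥0) :
    Measurable[D.observation Xhat Ξ t] (fun ω => min (D.τ i ω) t) := by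
  have h1 : Filtration.natural (fun t ω => min (D.τ i ω) t)
      (fun _ => ((D.τ_measurable i).min measurable_const).stronglyMeasurable)
      ≤ D.observation Xhat Ξ :=
    le_sup_of_le_right (le_iSup (fun i : ℕ => Filtration.natural (fun t ω => min (D.τ i ω) t)
      (fun _ => ((D.τ_measurable i).min measurable_const).stronglyMeasurable)) i)
  have h2 := (Filtration.stronglyAdapted_natural
    (fun s => ((D.τ_measurable i).min (measurable_const (a := s))).stronglyMeasurable)) t
  exact (h2.mono (h1 t)).measurable

lemma 𝓖_eq (M : AlmgrenChrissModel P) (Xhat Ξ : ℝ) (t : ℝ≥0) :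
    D.𝓖 M Xhat Ξ t = ⨅ s > t, (M.𝓕 s ⊔ D.observation Xhat Ξ s) := by
  rw [𝓖, Filtration.rightCont_eq]
  rfl

lemma le_𝓖 (M : AlmgrenChrissModel P) (Xhat Ξ : ℝ) (t : ℝ≥0) :
    M.𝓕 t ⊔ D.observation Xhat Ξ t ≤ D.𝓖 M Xhat Ξ t :=
  Filtration.le_rightCont (M.𝓕 ⊔ D.observation Xhat Ξ) t

lemma 𝓖_le_of_lt (M : AlmgrenChrissModel P) (Xhat Ξ : ℝ) {s t : ℝ≥0} (h : t < s) :
    D.𝓖 M Xhat Ξ t ≤ M.𝓕 s ⊔ D.observation Xhat Ξ s := by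
  rw [𝓖_eq]
  exact iInf₂_le s h

lemma measurableSet_τ_le (M : AlmgrenChrissModel P) (Xhat Ξ : ℝ) (t : ℝ≥0) :
    MeasurableSet[D.𝓖 M Xhat Ξ t] {ω | D.τ 0 ω ≤ t} := by
  rw [𝓖_eq, MeasurableSpace.measurableSet_iInf]
  intro s
  rw [MeasurableSpace.measurableSet_iInf]
  intro hs
  -- Right-continuity is used here: min(τ, t) alone does not separate τ = t from τ > t, but min(τ,
  -- s) does for each s > t.
  have e : {ω | D.τ 0 ω ≤ t} = {ω | min (D.τ 0 ω) s ≤ t} := by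
    ext ω
    simp only [mem_ofPred_eq, min_le_iff]
    exact (or_iff_left (not_le.2 hs)).symm
  rw [e]
  exact measurableSet_le (((measurable_min_τ Xhat Ξ 0 s)).mono le_sup_right le_rfl)
    measurable_const

/-- The sets whose trace on `S` is the trace of an `m`-measurable set. -/
@[reducible] def traceSpace (m : MeasurableSpace Ω) (S : Set Ω) : MeasurableSpace Ω where
  MeasurableSet' A := ∃ F, MeasurableSet[m] F ∧ A ∩ S = F ∩ S
  measurableSet_empty := ⟨∅, @MeasurableSet.empty _ m, rfl⟩
  measurableSet_compl := by
    rintro A ⟨F, hF, hAF⟩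
    refine ⟨Fᶜ, hF.compl, ?_⟩
    ext ω
    have := Set.ext_iff.1 hAF ω
    simp only [mem_inter_iff, mem_compl_iff] at this ⊢
    tauto
  measurableSet_iUnion := by
    intro f hf
    choose F hF hfF using hf
    refine ⟨⋃ i, F i, MeasurableSet.iUnion hF, ?_⟩
    rw [iUnion_inter, iUnion_inter]
    exact iUnion_congr hfF

/-- On {t < τ} the observed processes are still deterministic up to time t: Z vanishes and τ_i ∧ s =
s. Hence the observation adds nothing to 𝓕_t there. -/
lemma exists_inter_lt_τ_eq {Xhat Ξ : ℝ} {t : ℝ≥0} {A : Set Ω}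
    (hA : MeasurableSet[M.𝓕 t ⊔ D.observation Xhat Ξ t] A) :
    ∃ F, MeasurableSet[M.𝓕 t] F ∧ A ∩ {ω | t < D.τ 0 ω} = F ∩ {ω | t < D.τ 0 ω} := by
  set S : Set Ω := {ω | t < D.τ 0 ω} with hS
  have hconst : ∀ {β : Type} [mβ : MeasurableSpace β] (f : Ω → β) (c : β), (∀ ω ∈ S, f ω = c) →
      Measurable[traceSpace (M.𝓕 t) S] f := by
    intro β mβ f c hf B _
    by_cases hc : c ∈ B
    · refine ⟨univ, @MeasurableSet.univ _ (M.𝓕 t), ?_⟩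
      ext ω
      simp only [mem_inter_iff, mem_preimage, mem_univ, true_and, and_iff_right_iff_imp]
      intro h
      rwa [hf ω h]
    · refine ⟨∅, @MeasurableSet.empty _ (M.𝓕 t), ?_⟩
      ext ω
      simp only [mem_inter_iff, mem_preimage, mem_empty_iff_false, false_and, iff_false, not_and]
      intro h h'
      rw [hf ω h'] at h
      exact hc h
  have hle : M.𝓕 t ⊔ D.observation Xhat Ξ t ≤ traceSpace (M.𝓕 t) S := by
    refine sup_le (fun F hF => ⟨F, hF, rfl⟩) (observation_le (fun s hs => ?_) fun i s hs => ?_)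
    · refine hconst _ 0 fun ω hω => ?_
      rw [Z, D.N_eq_zero_of_lt (lt_of_le_of_lt hs hω), Finset.range_zero, Finset.sum_empty]
    · refine hconst _ s fun ω hω => min_eq_right ?_
      exact (hs.trans (le_of_lt hω)).trans (D.τ_zero_le i ω)
  exact hle A hA

/-- The `σ`-algebra generated by the counting process and the null sets. -/
@[reducible] noncomputable def counting (D : DarkPoolExtension Ω) (P : Measure Ω) :
    MeasurableSpace Ω :=
  eventuallyMeasurableSpace (⨆ t : ℝ≥0, MeasurableSpace.comap (D.N t) inferInstance) (ae P)

/-- {τ_i ≤ t} and {i < N_t} agree on regular paths only, which is why `counting` contains the null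
sets. -/
lemma IndependenceAssumption.measurable_of_regular
    (h : D.IndependenceAssumption M θ (Measure.dirac ⊤)) (i : ℕ) :
    Measurable[D.counting P] (D.τ i) := by
  refine @measurable_of_Iic _ _ _ _ _ (D.counting P) _ _ _ _ fun t => ?_
  refine ⟨{ω | i < D.N t ω}, ?_, ?_⟩
  · refine (le_iSup (fun t : ℝ≥0 => MeasurableSpace.comap (D.N t) inferInstance) t) _ ?_
    exact ⟨Ioi i, MeasurableSet.of_discrete, rfl⟩
  · filter_upwards [h.ae_regular] with ω hω
    exact propext (hω.lt_N_iff t i).symm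

lemma IndependenceAssumption.observation_le_eventually
    (h : D.IndependenceAssumption M θ (Measure.dirac ⊤)) (Xhat Ξ : ℝ) (t : ℝ≥0) :
    D.observation Xhat Ξ t ≤ D.counting P := by
  refine observation_le (fun s _ => ?_) fun i s _ => ?_
  · have h1 : Measurable[D.counting P]
        (fun ω => if D.τ 0 ω ≤ s then Xhat else 0) :=
      Measurable.ite (measurableSet_le (h.measurable_of_regular 0) measurable_const)
        measurable_const measurable_const
    intro B hB
    refine EventuallyMeasurableSet.congr (h1 hB) ?_
    filter_upwards [h.ae_regular] with ω hω
    apply propext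
    show D.Z Xhat Ξ s ω ∈ B ↔ _ ∈ B
    rw [hω.Z_eq]
  · exact (h.measurable_of_regular i).min measurable_const

lemma IndependenceAssumption.measureReal_inter
    (h : D.IndependenceAssumption M θ (Measure.dirac ⊤)) {F H : Set Ω}
    (hF : MeasurableSet[⨆ t, (M.𝓕 t : MeasurableSpace Ω)] F)
    (hH : MeasurableSet[D.counting P] H) :
    P.real (F ∩ H) = P.real F * P.real H := by
  obtain ⟨H', hH', e⟩ := hH
  have hind := h.iIndep.indep (i := 0) (j := 1) (by decide)
  have := (Indep_iff _ _ P).1 hind F H' hF hH'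
  rw [measureReal_congr (EventuallyEq.rfl.inter e), measureReal_congr e, measureReal_def, this,
    ENNReal.toReal_mul]
  rfl

/-- On {r < τ} the set A may be replaced by some F in 𝓕_r, which is independent of τ. The factor is
then the ratio of two exponential tails. -/
lemma IndependenceAssumption.measure_inter_lt_τ_aux
    (h : D.IndependenceAssumption M θ (Measure.dirac ⊤)) {Xhat Ξ : ℝ} {r s : ℝ≥0} (hrs : r ≤ s)
    {A : Set Ω} (hA : MeasurableSet[M.𝓕 r ⊔ D.observation Xhat Ξ r] A) :
    P.real (A ∩ {ω | s < D.τ 0 ω})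
      = Real.exp (-(θ * (s - r))) * P.real (A ∩ {ω | r < D.τ 0 ω}) := by
  obtain ⟨F, hF, hAF⟩ := exists_inter_lt_τ_eq hA
  have hF' := le_iSup (fun t => (M.𝓕 t : MeasurableSpace Ω)) r F hF
  have hm : ∀ u : ℝ≥0, MeasurableSet[D.counting P] {ω | u < D.τ 0 ω} :=
    fun u => measurableSet_lt measurable_const (h.measurable_of_regular 0)
  have e : A ∩ {ω | s < D.τ 0 ω} = F ∩ {ω | s < D.τ 0 ω} := by
    have hsub : {ω | r < D.τ 0 ω} ∩ {ω | s < D.τ 0 ω} = {ω | s < D.τ 0 ω} :=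
      inter_eq_right.2 fun ω hω => lt_of_le_of_lt hrs hω
    rw [← hsub, ← inter_assoc, hAF, inter_assoc]
  rw [e, hAF, h.measureReal_inter hF' (hm s), h.measureReal_inter hF' (hm r), h.measure_lt_τ,
    h.measure_lt_τ, mul_left_comm, ← Real.exp_add]
  ring_nf

/-- The memoryless property of the first arrival time with respect to `(𝓖_t)`. -/
lemma IndependenceAssumption.measure_inter_lt_τ
    (h : D.IndependenceAssumption M θ (Measure.dirac ⊤)) {Xhat Ξ : ℝ} {t s : ℝ≥0} (hts : t ≤ s)
    {A : Set Ω} (hA : MeasurableSet[D.𝓖 M Xhat Ξ t] A) :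
    P.real (A ∩ {ω | s < D.τ 0 ω})
      = Real.exp (-(θ * (s - t))) * P.real (A ∩ {ω | t < D.τ 0 ω}) := by
  rcases hts.eq_or_lt with rfl | hts
  · simp
  have hAm : MeasurableSet A := (D.𝓖 M Xhat Ξ).le t A hA
  have hτ : ∀ r, MeasurableSet {ω | r < D.τ 0 ω} := fun r =>
    measurableSet_lt measurable_const (D.τ_measurable 0)
  -- A set in 𝓖_t belongs to the unregularised σ-algebra of every r > t. The formula holds at such
  -- r, and r ↓ t preserves it.
  have hev : ∀ᶠ r : ℝ≥0 in 𝓝[>] t, P.real (A ∩ {ω | s < D.τ 0 ω})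
      = Real.exp (-(θ * (s - r))) * P.real (A ∩ {ω | r < D.τ 0 ω}) := by
    filter_upwards [Ioo_mem_nhdsGT hts] with r hr
    exact h.measure_inter_lt_τ_aux hr.2.le (𝓖_le_of_lt M Xhat Ξ hr.1 A hA)
  have h1 : Tendsto (fun r : ℝ≥0 => Real.exp (-(θ * (s - r)))) (𝓝[>] t)
      (𝓝 (Real.exp (-(θ * (s - t))))) := by
    have : Continuous (fun r : ℝ≥0 => Real.exp (-((θ : ℝ) * (s - r)))) := by fun_prop
    exact (this.tendsto t).mono_left nhdsWithin_le_nhds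
  have h2 : Tendsto (fun r : ℝ≥0 => P.real (A ∩ {ω | r < D.τ 0 ω})) (𝓝[>] t)
      (𝓝 (P.real (A ∩ {ω | t < D.τ 0 ω}))) := by
    simp only [← integral_indicator_one (hAm.inter (hτ _))]
    refine tendsto_integral_filter_of_dominated_convergence (fun _ => 1)
      (Eventually.of_forall fun r =>
        (stronglyMeasurable_one.indicator (hAm.inter (hτ r))).aestronglyMeasurable)
      (Eventually.of_forall fun r => Eventually.of_forall fun ω => ?_) (integrable_const 1)
      (Eventually.of_forall fun ω => ?_)
    · by_cases hω : ω ∈ A ∩ {ω | r < D.τ 0 ω} <;> simp [indicator, hω]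
    · refine tendsto_const_nhds.congr' ?_
      by_cases hω : t < D.τ 0 ω
      · filter_upwards [Ioo_mem_nhdsGT hω] with r hr
        have : r < D.τ 0 ω := hr.2
        by_cases hωA : ω ∈ A <;> simp [indicator, hω, hωA, this]
      · filter_upwards [self_mem_nhdsWithin] with r hr
        have : ¬ r < D.τ 0 ω := fun h' => hω (lt_trans hr h')
        simp [indicator, hω, this]
  refine tendsto_nhds_unique (tendsto_const_nhds.congr' ?_) (h1.mul h2)
  exact hev

end DarkPoolExtension

/-! ### The price process is a martingale for the enlarged filtration -/

lemma generateFrom_inter_eq_sup {Ω : Type*} (m₁ m₂ : MeasurableSpace Ω) :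
    MeasurableSpace.generateFrom
      {A | ∃ F H, MeasurableSet[m₁] F ∧ MeasurableSet[m₂] H ∧ A = F ∩ H} = m₁ ⊔ m₂ := by
  refine le_antisymm (MeasurableSpace.generateFrom_le ?_) (sup_le (fun F hF => ?_) fun H hH => ?_)
  · rintro _ ⟨F, H, hF, hH, rfl⟩
    exact MeasurableSet.inter (le_sup_left (a := m₁) (b := m₂) F hF)
      (le_sup_right (a := m₁) (b := m₂) H hH)
  · exact MeasurableSpace.measurableSet_generateFrom
      ⟨F, univ, hF, @MeasurableSet.univ _ m₂, (inter_univ F).symm⟩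
  · exact MeasurableSpace.measurableSet_generateFrom
      ⟨univ, H, @MeasurableSet.univ _ m₁, hH, (univ_inter H).symm⟩

lemma isPiSystem_inter {Ω : Type*} (m₁ m₂ : MeasurableSpace Ω) :
    IsPiSystem {A : Set Ω | ∃ F H, MeasurableSet[m₁] F ∧ MeasurableSet[m₂] H ∧ A = F ∩ H} := by
  rintro _ ⟨F, H, hF, hH, rfl⟩ _ ⟨F', H', hF', hH', rfl⟩ _
  exact ⟨F ∩ F', H ∩ H', hF.inter hF', hH.inter hH', inter_inter_inter_comm _ _ _ _⟩

/-- By the π-λ theorem the martingale identity has to be checked only on intersections of a price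
event and an observation event. -/
lemma setIntegral_eq_of_sup {Ω : Type*} [mΩ : MeasurableSpace Ω] {P : Measure Ω}
    [IsProbabilityMeasure P] {m₁ m₂ : MeasurableSpace Ω} (h₁ : m₁ ≤ mΩ) (h₂ : m₂ ≤ mΩ)
    {f g : Ω → ℝ} (hf : Integrable f P) (hg : Integrable g P)
    (h : ∀ F H, MeasurableSet[m₁] F → MeasurableSet[m₂] H →
      ∫ ω in F ∩ H, f ω ∂P = ∫ ω in F ∩ H, g ω ∂P) {A : Set Ω}
    (hA : MeasurableSet[m₁ ⊔ m₂] A) : ∫ ω in A, f ω ∂P = ∫ ω in A, g ω ∂P := by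
  have hle : m₁ ⊔ m₂ ≤ mΩ := sup_le h₁ h₂
  induction A, hA using MeasurableSpace.induction_on_inter
    (generateFrom_inter_eq_sup m₁ m₂).symm (isPiSystem_inter m₁ m₂) with
  | empty => simp
  | basic A hA =>
    obtain ⟨F, H, hF, hH, rfl⟩ := hA
    exact h F H hF hH
  | compl A hA ih =>
    have huniv := h univ univ (@MeasurableSet.univ _ m₁) (@MeasurableSet.univ _ m₂)
    rw [inter_univ, Measure.restrict_univ] at huniv
    rw [setIntegral_compl (hle A hA) hf, setIntegral_compl (hle A hA) hg, ih, huniv]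
  | iUnion A hd hA ih =>
    rw [integral_iUnion (fun i => hle _ (hA i)) hd hf.integrableOn,
      integral_iUnion (fun i => hle _ (hA i)) hd hg.integrableOn]
    simp_rw [ih]

namespace DarkPoolExtension

variable {Ω : Type*} [mΩ : MeasurableSpace Ω] {P : Measure Ω} [IsProbabilityMeasure P]
  {D : DarkPoolExtension Ω} {M : AlmgrenChrissModel P} {θ : ℝ≥0}

lemma IndependenceAssumption.indep_observation
    (h : D.IndependenceAssumption M θ (Measure.dirac ⊤)) (Xhat Ξ : ℝ) (t : ℝ≥0) :
    Indep (⨆ t, (M.𝓕 t : MeasurableSpace Ω)) (D.observation Xhat Ξ t) P := by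
  rw [Indep_iff]
  intro F H hF hH
  have := h.measureReal_inter hF (h.observation_le_eventually Xhat Ξ t H hH)
  rw [measureReal_def, measureReal_def, measureReal_def, ← ENNReal.toReal_mul] at this
  exact (ENNReal.toReal_eq_toReal_iff' (measure_ne_top _ _)
    (ENNReal.mul_ne_top (measure_ne_top _ _) (measure_ne_top _ _))).1 this

/-- 1_F P⁰_s is measurable for 𝓕_∞, hence independent of the observation event H. The formula holds
whether or not r ≤ s. -/
lemma IndependenceAssumption.setIntegral_inter
    (h : D.IndependenceAssumption M θ (Measure.dirac ⊤)) (Xhat Ξ : ℝ) {r s t : ℝ≥0}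
    {F H : Set Ω} (hF : MeasurableSet[M.𝓕 r] F) (hH : MeasurableSet[D.observation Xhat Ξ t] H) :
    ∫ ω in F ∩ H, M.P0 s ω ∂P = P.real H * ∫ ω in F, M.P0 s ω ∂P := by
  have hFm := M.𝓕.le r F hF
  have hF_le : (⨆ t, (M.𝓕 t : MeasurableSpace Ω)) ≤ mΩ := iSup_le M.𝓕.le
  have hobs := (D.observation Xhat Ξ).le t
  have hHm := hobs H hH
  have hsm : StronglyMeasurable[⨆ t, (M.𝓕 t : MeasurableSpace Ω)] (F.indicator (M.P0 s)) := by
    refine StronglyMeasurable.indicator ?_ (le_iSup (fun t => (M.𝓕 t : MeasurableSpace Ω)) r F hF)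
    exact (M.martingale.stronglyMeasurable s).mono
      (le_iSup (fun t => (M.𝓕 t : MeasurableSpace Ω)) s)
  have hint : Integrable (F.indicator (M.P0 s)) P := (M.martingale.integrable s).indicator hFm
  have hc := condExp_indep_eq hF_le hobs hsm (h.indep_observation Xhat Ξ t)
  rw [inter_comm, ← setIntegral_indicator hFm, ← setIntegral_condExp hobs hint hH,
    setIntegral_congr_ae hHm (hc.mono fun ω hω _ => hω), setIntegral_const,
    integral_indicator hFm, smul_eq_mul]

lemma IndependenceAssumption.setIntegral_sup
    (h : D.IndependenceAssumption M θ (Measure.dirac ⊤)) {Xhat Ξ : ℝ} {r s : ℝ≥0} (hrs : r ≤ s)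
    {A : Set Ω} (hA : MeasurableSet[M.𝓕 r ⊔ D.observation Xhat Ξ r] A) :
    ∫ ω in A, M.P0 r ω ∂P = ∫ ω in A, M.P0 s ω ∂P := by
  refine setIntegral_eq_of_sup (M.𝓕.le r) ((D.observation Xhat Ξ).le r) (M.martingale.integrable r)
    (M.martingale.integrable s) (fun F H hF hH => ?_) hA
  rw [h.setIntegral_inter Xhat Ξ hF hH, h.setIntegral_inter Xhat Ξ hF hH,
    M.martingale.setIntegral_eq hrs hF]

/-- The identity holds for the unregularised enlargement by independence. A set in 𝓖_t is handled at
times u_n ↓ t, and right-continuity of the paths carries the identity back to t. -/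
theorem IndependenceAssumption.martingale
    (h : D.IndependenceAssumption M θ (Measure.dirac ⊤)) (Xhat Ξ : ℝ) :
    Martingale M.P0 (D.𝓖 M Xhat Ξ) P := by
  have hadapted : ∀ t, StronglyMeasurable[D.𝓖 M Xhat Ξ t] (M.P0 t) := fun t =>
    (M.martingale.stronglyMeasurable t).mono (le_sup_left.trans (le_𝓖 M Xhat Ξ t))
  refine ⟨hadapted, fun t s hts => ?_⟩
  rcases hts.eq_or_lt with rfl | hts
  · rw [condExp_of_stronglyMeasurable _ (hadapted t) (M.martingale.integrable t)]
  refine (ae_eq_condExp_of_forall_setIntegral_eq ((D.𝓖 M Xhat Ξ).le t) (M.martingale.integrable s)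
    (fun _ _ _ => (M.martingale.integrable t).integrableOn) (fun A hA _ => ?_)
    (hadapted t).aestronglyMeasurable).symm
  obtain ⟨u, hu_anti, hu_mem, hu_lim⟩ := exists_seq_strictAnti_tendsto' hts
  have hconst : ∀ n, ∫ ω in A, M.P0 (u n) ω ∂P = ∫ ω in A, M.P0 s ω ∂P := fun n =>
    h.setIntegral_sup (hu_mem n).2.le (𝓖_le_of_lt M Xhat Ξ (hu_mem n).1 A hA)
  -- The variables P⁰_{u_n} are conditional expectations of the single variable P⁰_s, hence
  -- uniformly integrable; this upgrades pathwise convergence to L¹.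
  have hui : UnifIntegrable (fun n => M.P0 (u n)) 1 P :=
    UnifIntegrable.ae_eq (((M.martingale.integrable s).uniformIntegrable_condExp
      (fun n => M.𝓕.le (u n))).2.1) fun n => M.martingale.condExp_ae_eq (hu_mem n).2.le
  have hlim : ∀ ω, Tendsto (fun n => M.P0 (u n) ω) atTop (𝓝 (M.P0 t ω)) := fun ω =>
    ((M.cadlag ω t).1.tendsto).comp (tendsto_nhdsWithin_iff.2
      ⟨hu_lim, Eventually.of_forall fun n => (hu_mem n).1⟩)
  have hL1 := tendsto_Lp_finite_of_tendsto_ae le_rfl ENNReal.one_ne_top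
    (fun n => (M.martingale.integrable (u n)).1)
    (memLp_one_iff_integrable.2 (M.martingale.integrable t)) hui (Eventually.of_forall hlim)
  have := tendsto_setIntegral_of_L1' (M.P0 t) (M.martingale.integrable t).1
    (Eventually.of_forall fun n => M.martingale.integrable (u n)) hL1 A
  simp_rw [hconst] at this
  exact tendsto_nhds_unique this tendsto_const_nhds

end DarkPoolExtension

/-! ### Equidistant grids -/

/-- The grid `k T / (n + 1)`. -/
noncomputable def grid (T : ℝ≥0) (n k : ℕ) : ℝ≥0 := k * T / (n + 1)

/-- The index `k` with `t ∈ (grid T n k, grid T n (k + 1)]`. -/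
noncomputable def gridIndex (T : ℝ≥0) (n : ℕ) (t : ℝ) : ℕ := ⌈t * (n + 1) / T⌉₊ - 1

lemma coe_grid (T : ℝ≥0) (n k : ℕ) : (grid T n k : ℝ) = k * T / (n + 1) := by
  simp [grid]

lemma grid_zero (T : ℝ≥0) (n : ℕ) : grid T n 0 = 0 := by simp [grid]

lemma grid_last (T : ℝ≥0) (n : ℕ) : grid T n (n + 1) = T := by
  apply NNReal.coe_injective
  rw [coe_grid]
  push_cast
  field_simp

lemma monotone_grid (T : ℝ≥0) (n : ℕ) : Monotone (grid T n) := by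
  intro i j hij
  rw [← NNReal.coe_le_coe, coe_grid, coe_grid]
  gcongr

lemma coe_grid_succ (T : ℝ≥0) (n k : ℕ) :
    (grid T n (k + 1) : ℝ) = grid T n k + T / (n + 1) := by
  rw [coe_grid, coe_grid]
  push_cast
  ring

lemma measurable_gridIndex (T : ℝ≥0) (n : ℕ) : Measurable (gridIndex T n) := by
  unfold gridIndex
  have h : Measurable (fun t : ℝ => ⌈t * (n + 1) / T⌉₊) :=
    Nat.measurable_ceil.comp (by fun_prop)
  exact (Measurable.of_discrete (f := fun k : ℕ => k - 1)).comp h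

lemma gridIndex_mem {T : ℝ≥0} (n : ℕ) {t : ℝ} (ht : t ∈ Ioc (0 : ℝ) T) :
    (grid T n (gridIndex T n t) : ℝ) < t ∧ t ≤ grid T n (gridIndex T n t + 1)
      ∧ gridIndex T n t < n + 1 := by
  have hT : (0 : ℝ) < T := ht.1.trans_le ht.2
  have hx : 0 < t * (n + 1) / T := by have := ht.1; positivity
  have hc : 0 < ⌈t * (n + 1) / T⌉₊ := Nat.ceil_pos.2 hx
  have e : gridIndex T n t + 1 = ⌈t * (n + 1) / T⌉₊ := Nat.sub_add_cancel hc
  have h1 : t * (n + 1) / T ≤ ((gridIndex T n t + 1 : ℕ) : ℝ) := by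
    rw [e]; exact Nat.le_ceil _
  have h2 : ((gridIndex T n t : ℕ) : ℝ) < t * (n + 1) / T :=
    Nat.lt_ceil.1 (by omega)
  refine ⟨?_, ?_, ?_⟩
  · rw [coe_grid, div_lt_iff₀ (by positivity)]
    rwa [lt_div_iff₀ hT] at h2
  · rw [coe_grid, le_div_iff₀ (by positivity)]
    rwa [div_le_iff₀ hT] at h1
  · have : t * (n + 1) / T ≤ (n + 1 : ℕ) := by
      rw [div_le_iff₀ hT]
      push_cast
      nlinarith [ht.2, (Nat.cast_nonneg n : (0 : ℝ) ≤ n)]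
    exact_mod_cast h2.trans_le this

lemma gridIndex_eq {T : ℝ≥0} {n k : ℕ} {t : ℝ} (h1 : (grid T n k : ℝ) < t)
    (h2 : t ≤ grid T n (k + 1)) (htT : t ≤ T) : gridIndex T n t = k := by
  have ht : t ∈ Ioc (0 : ℝ) T := ⟨(NNReal.coe_nonneg _).trans_lt h1, htT⟩
  obtain ⟨h3, h4, -⟩ := gridIndex_mem n ht
  have a : gridIndex T n t < k + 1 := by
    by_contra hlt
    have := NNReal.coe_le_coe.2 (monotone_grid T n (not_lt.1 hlt))
    linarith
  have b : k < gridIndex T n t + 1 := by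
    by_contra hlt
    have := NNReal.coe_le_coe.2 (monotone_grid T n (not_lt.1 hlt))
    linarith
  omega

/-- Left end points converge strictly from the left, which keeps integrands non-anticipating; right
end points (`tendsto_grid_gridIndex_succ`) converge from the right, where càdlàg paths are
continuous. -/
lemma tendsto_grid_gridIndex {T : ℝ≥0} {t : ℝ≥0} (ht : (t : ℝ) ∈ Ioc (0 : ℝ) T) :
    Tendsto (fun n => grid T n (gridIndex T n t)) atTop (𝓝[<] t) := by
  have h0 : Tendsto (fun n : ℕ => (t : ℝ) - T / (n + 1)) atTop (𝓝 ((t : ℝ) - 0)) :=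
    tendsto_const_nhds.sub (tendsto_const_div_atTop_nhds_zero_nat (T : ℝ) |>.comp
      (tendsto_add_atTop_nat 1) |>.congr fun n => by simp)
  rw [sub_zero] at h0
  rw [tendsto_nhdsWithin_iff]
  constructor
  · rw [← NNReal.tendsto_coe]
    refine tendsto_of_tendsto_of_tendsto_of_le_of_le h0 tendsto_const_nhds (fun n => ?_)
      fun n => ?_
    · have := (gridIndex_mem n ht).2.1
      rw [coe_grid_succ] at this
      show (t : ℝ) - T / (n + 1) ≤ _
      linarith
    · exact (gridIndex_mem n ht).1.le
  · exact Eventually.of_forall fun n => NNReal.coe_lt_coe.1 (gridIndex_mem n ht).1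

lemma tendsto_grid_gridIndex_succ {T : ℝ≥0} {t : ℝ≥0} (ht : (t : ℝ) ∈ Ioc (0 : ℝ) T) :
    Tendsto (fun n => grid T n (gridIndex T n t + 1)) atTop (𝓝[≥] t) := by
  have h0 : Tendsto (fun n : ℕ => (t : ℝ) + T / (n + 1)) atTop (𝓝 ((t : ℝ) + 0)) :=
    tendsto_const_nhds.add (tendsto_const_div_atTop_nhds_zero_nat (T : ℝ) |>.comp
      (tendsto_add_atTop_nat 1) |>.congr fun n => by simp)
  rw [add_zero] at h0
  rw [tendsto_nhdsWithin_iff]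
  constructor
  · rw [← NNReal.tendsto_coe]
    refine tendsto_of_tendsto_of_tendsto_of_le_of_le tendsto_const_nhds h0 (fun n => ?_)
      fun n => ?_
    · exact (gridIndex_mem n ht).2.1
    · have := (gridIndex_mem n ht).1
      show (grid T n (gridIndex T n t + 1) : ℝ) ≤ (t : ℝ) + T / (n + 1)
      rw [coe_grid_succ]
      linarith
  · exact Eventually.of_forall fun n => NNReal.coe_le_coe.1 (gridIndex_mem n ht).2.1

lemma integral_step_mul {T : ℝ≥0} (n : ℕ) {ξ : ℝ → ℝ} (hξ : IntervalIntegrable ξ volume 0 T)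
    (f : ℕ → ℝ) :
    ∫ t in (0 : ℝ)..T, f (gridIndex T n t) * ξ t
      = ∑ k ∈ Finset.range (n + 1), f k * ∫ t in (grid T n k : ℝ)..(grid T n (k + 1)), ξ t := by
  have hsub : ∀ k < n + 1, uIoc (grid T n k : ℝ) (grid T n (k + 1)) ⊆ Ioc (0 : ℝ) T := by
    intro k hk
    have h1 := NNReal.coe_le_coe.2 (monotone_grid T n k.le_succ)
    have h2 := NNReal.coe_le_coe.2 (monotone_grid T n (Nat.succ_le_of_lt hk))
    rw [grid_last] at h2
    rw [uIoc_of_le h1]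
    exact Ioc_subset_Ioc (NNReal.coe_nonneg _) h2
  have hcongr : ∀ k < n + 1, ∀ t ∈ uIoc (grid T n k : ℝ) (grid T n (k + 1)),
      f k * ξ t = f (gridIndex T n t) * ξ t := by
    intro k hk t ht
    have htT := hsub k hk ht
    rw [uIoc_of_le (NNReal.coe_le_coe.2 (monotone_grid T n k.le_succ))] at ht
    rw [gridIndex_eq ht.1 ht.2 htT.2]
  have hint : ∀ k < n + 1, IntervalIntegrable ξ volume (grid T n k : ℝ) (grid T n (k + 1)) := by
    intro k hk
    rw [intervalIntegrable_iff] at hξ ⊢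
    rw [uIoc_of_le (NNReal.coe_nonneg T)] at hξ
    exact hξ.mono_set (hsub k hk)
  have := intervalIntegral.sum_integral_adjacent_intervals (μ := volume)
    (f := fun t => f (gridIndex T n t) * ξ t) (a := fun k => (grid T n k : ℝ)) (n := n + 1)
    (fun k hk => ((hint k hk).const_mul (f k)).congr (hcongr k hk))
  simp only [grid_zero, grid_last, NNReal.coe_zero] at this
  rw [← this]
  refine Finset.sum_congr rfl fun k hk => ?_
  rw [← intervalIntegral.integral_const_mul]
  exact intervalIntegral.integral_congr_ae (Eventually.of_forall fun t ht =>
    (hcongr k (Finset.mem_range.1 hk) t ht).symm)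

/-! ### Càdlàg paths -/

lemma IsCadlag.tendsto {f : ℝ≥0 → ℝ} (hf : IsCadlag f) (t : ℝ≥0) :
    Tendsto f (𝓝[≥] t) (𝓝 (f t)) :=
  (continuousWithinAt_Ioi_iff_Ici.1 (hf t).1)

lemma IsCadlag.exists_bound {f : ℝ≥0 → ℝ} (hf : IsCadlag f) (T : ℝ≥0) :
    ∃ C, ∀ t ≤ T, |f t| ≤ C := by
  have hcompact : IsCompact (Icc 0 T) := isCompact_Icc
  have := hcompact.induction_on (p := fun s => ∃ C, ∀ t ∈ s, |f t| ≤ C) ⟨0, by simp⟩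
    (fun s t hst ⟨C, hC⟩ => ⟨C, fun x hx => hC x (hst hx)⟩)
    (fun s t ⟨C, hC⟩ ⟨C', hC'⟩ => ⟨max C C', fun x hx => hx.elim
      (fun h => (hC x h).trans (le_max_left _ _)) fun h => (hC' x h).trans (le_max_right _ _)⟩)
    (fun t _ => ?_)
  · obtain ⟨C, hC⟩ := this
    exact ⟨C, fun t ht => hC t ⟨zero_le, ht⟩⟩
  · obtain ⟨l, hl⟩ := (hf t).2
    have h1 : ∀ᶠ s in 𝓝[<] t, |f s| ≤ |l| + 1 :=
      (hl.abs.eventually (gt_mem_nhds (lt_add_one |l|))).mono fun s hs => le_of_lt hs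
    have h2 : ∀ᶠ s in 𝓝[≥] t, |f s| ≤ |f t| + 1 :=
      ((hf.tendsto t).abs.eventually (gt_mem_nhds (lt_add_one |f t|))).mono
        fun s hs => le_of_lt hs
    have h3 : ∀ᶠ s in 𝓝 t, |f s| ≤ max (|l| + 1) (|f t| + 1) := by
      rw [← nhdsLT_sup_nhdsGE, eventually_sup]
      exact ⟨h1.mono fun s hs => hs.trans (le_max_left _ _),
        h2.mono fun s hs => hs.trans (le_max_right _ _)⟩
    exact ⟨_, mem_nhdsWithin_of_mem_nhds h3, _, fun s hs => hs⟩

lemma IsCadlag.tendsto_grid {f : ℝ≥0 → ℝ} (hf : IsCadlag f) {T t : ℝ≥0}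
    (ht : (t : ℝ) ∈ Ioc (0 : ℝ) T) :
    Tendsto (fun n => f (grid T n (gridIndex T n t + 1))) atTop (𝓝 (f t)) :=
  (hf.tendsto t).comp (tendsto_grid_gridIndex_succ ht)

lemma IsCadlag.aestronglyMeasurable {f : ℝ≥0 → ℝ} (hf : IsCadlag f) (T : ℝ≥0) :
    AEStronglyMeasurable (fun t : ℝ => f t.toNNReal) (volume.restrict (Ioc (0 : ℝ) T)) := by
  refine aestronglyMeasurable_of_tendsto_ae atTop
    (f := fun n t => f (grid T n (gridIndex T n t + 1))) (fun n => ?_) ?_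
  · exact ((Measurable.of_discrete (f := fun k : ℕ => f (grid T n (k + 1)))).comp
      (measurable_gridIndex T n)).aestronglyMeasurable
  · filter_upwards [ae_restrict_mem measurableSet_Ioc] with t ht
    have hc : ((t.toNNReal : ℝ≥0) : ℝ) = t := Real.coe_toNNReal t ht.1.le
    have := hf.tendsto_grid (T := T) (t := t.toNNReal) (by rwa [hc])
    rwa [hc] at this

lemma IsCadlag.intervalIntegrable_mul {f : ℝ≥0 → ℝ} (hf : IsCadlag f) {T : ℝ≥0} {ξ : ℝ → ℝ}
    (hξ : IntervalIntegrable ξ volume 0 T) :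
    IntervalIntegrable (fun t => ξ t * f t.toNNReal) volume 0 T := by
  obtain ⟨C, hC⟩ := hf.exists_bound T
  rw [intervalIntegrable_iff_integrableOn_Ioc_of_le (NNReal.coe_nonneg T)] at hξ ⊢
  refine hξ.mul_bdd (c := C) (hf.aestronglyMeasurable T) ?_
  filter_upwards [ae_restrict_mem measurableSet_Ioc] with t ht
  exact hC _ (Real.toNNReal_le_iff_le_coe.2 ht.2)

/-- Riemann–Stieltjes sums with right end points converge. -/
lemma IsCadlag.tendsto_sum_mul_increment {f : ℝ≥0 → ℝ} (hf : IsCadlag f) {T : ℝ≥0} {ξ : ℝ → ℝ}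
    (hξ : IntervalIntegrable ξ volume 0 T) :
    Tendsto (fun n => ∑ k ∈ Finset.range (n + 1), f (grid T n (k + 1))
        * ∫ t in (grid T n k : ℝ)..(grid T n (k + 1)), ξ t) atTop
      (𝓝 (∫ t in (0 : ℝ)..T, ξ t * f t.toNNReal)) := by
  obtain ⟨C, hC⟩ := hf.exists_bound T
  simp_rw [← integral_step_mul _ hξ (fun k => f (grid T _ (k + 1)))]
  refine intervalIntegral.tendsto_integral_filter_of_dominated_convergence (fun t => C * |ξ t|)
    (Eventually.of_forall fun n => ?_) (Eventually.of_forall fun n => ?_)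
    (hξ.abs.const_mul C) ?_
  · refine AEStronglyMeasurable.mul ?_ (intervalIntegrable_iff.1 hξ).1
    exact ((Measurable.of_discrete (f := fun k : ℕ => f (grid T n (k + 1)))).comp
      (measurable_gridIndex T n)).aestronglyMeasurable
  · refine Eventually.of_forall fun t ht => ?_
    rw [uIoc_of_le (NNReal.coe_nonneg T)] at ht
    rw [norm_mul, Real.norm_eq_abs, Real.norm_eq_abs]
    refine mul_le_mul_of_nonneg_right (hC _ ?_) (abs_nonneg _)
    have := monotone_grid T n (Nat.succ_le_of_lt (gridIndex_mem n ht).2.2)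
    rwa [grid_last] at this
  · refine Eventually.of_forall fun t ht => ?_
    rw [uIoc_of_le (NNReal.coe_nonneg T)] at ht
    have hc : ((t.toNNReal : ℝ≥0) : ℝ) = t := Real.coe_toNNReal t ht.1.le
    have := hf.tendsto_grid (T := T) (t := t.toNNReal) (by rwa [hc])
    rw [hc] at this
    rw [mul_comm (ξ t)]
    exact this.mul_const _

lemma tendsto_sum_grid_mul {T : ℝ≥0} {G : ℝ≥0 → ℝ} {g : ℝ → ℝ} {C : ℝ} (hG : ∀ t, |G t| ≤ C)
    (hlim : ∀ᵐ t, t ∈ Ioc (0 : ℝ) T →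
      Tendsto (fun n => G (grid T n (gridIndex T n t))) atTop (𝓝 (g t))) :
    Tendsto (fun n : ℕ => ∑ k ∈ Finset.range (n + 1), G (grid T n k) * (T / (n + 1))) atTop
      (𝓝 (∫ t in (0 : ℝ)..T, g t)) := by
  have e : ∀ n : ℕ, ∑ k ∈ Finset.range (n + 1), G (grid T n k) * ((T : ℝ) / (n + 1))
      = ∫ t in (0 : ℝ)..T, G (grid T n (gridIndex T n t)) * 1 := by
    intro n
    rw [integral_step_mul n intervalIntegrable_const (fun k => G (grid T n k))]
    refine Finset.sum_congr rfl fun k _ => ?_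
    rw [intervalIntegral.integral_const, coe_grid_succ, smul_eq_mul]
    ring
  simp_rw [e, mul_one]
  refine intervalIntegral.tendsto_integral_filter_of_dominated_convergence (fun _ => C)
    (Eventually.of_forall fun n => ?_) (Eventually.of_forall fun n => ?_)
    intervalIntegrable_const ?_
  · exact ((Measurable.of_discrete (f := fun k : ℕ => G (grid T n k))).comp
      (measurable_gridIndex T n)).aestronglyMeasurable
  · exact Eventually.of_forall fun t _ => hG _
  · filter_upwards [hlim] with t ht htT
    rw [uIoc_of_le (NNReal.coe_nonneg T)] at htT
    exact ht htT

lemma sum_indicator_grid {T : ℝ≥0} (n : ℕ) {t : ℝ≥0} (ht : 0 < t) (c : ℕ → ℝ) :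
    ∑ k ∈ Finset.range (n + 1), (if grid T n k < t ∧ t ≤ grid T n (k + 1) then c k else 0)
      = if t ≤ T then c (gridIndex T n t) else 0 := by
  split_ifs with htT
  · have hmem : (t : ℝ) ∈ Ioc (0 : ℝ) T := ⟨by exact_mod_cast ht, by exact_mod_cast htT⟩
    obtain ⟨h1, h2, h3⟩ := gridIndex_mem n hmem
    rw [Finset.sum_eq_single (gridIndex T n t), if_pos ⟨by exact_mod_cast h1, by exact_mod_cast h2⟩]
    · intro k _ hk
      refine if_neg fun h => hk ?_
      exact (gridIndex_eq (by exact_mod_cast h.1) (by exact_mod_cast h.2) hmem.2).symm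
    · intro h
      exact absurd (Finset.mem_range.2 h3) h
  · refine Finset.sum_eq_zero fun k hk => if_neg fun h => htT ?_
    have := monotone_grid T n (Nat.succ_le_of_lt (Finset.mem_range.1 hk))
    rw [grid_last] at this
    exact h.2.trans this

/-! ### The compensator of the first arrival -/

namespace DarkPoolExtension

variable {Ω : Type*} [mΩ : MeasurableSpace Ω] {P : Measure Ω} [IsProbabilityMeasure P]
  {D : DarkPoolExtension Ω} {M : AlmgrenChrissModel P} {θ : ℝ≥0}

/-- The memoryless property says that, restricted to 𝓖_t, P on {s < τ} is a multiple of P on {t <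
τ}. It therefore passes from sets to 𝓖_t-measurable functions. -/
lemma IndependenceAssumption.setIntegral_lt_τ
    (h : D.IndependenceAssumption M θ (Measure.dirac ⊤)) {Xhat Ξ : ℝ} {t s : ℝ≥0} (hts : t ≤ s)
    {φ : Ω → ℝ} (hφ : StronglyMeasurable[D.𝓖 M Xhat Ξ t] φ) :
    ∫ ω in {ω | s < D.τ 0 ω}, φ ω ∂P
      = Real.exp (-(θ * (s - t))) * ∫ ω in {ω | t < D.τ 0 ω}, φ ω ∂P := by
  have hle := (D.𝓖 M Xhat Ξ).le t
  have hm : (P.restrict {ω | s < D.τ 0 ω}).trim hle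
      = (Real.exp (-(θ * (s - t)))).toNNReal • (P.restrict {ω | t < D.τ 0 ω}).trim hle := by
    refine @Measure.ext _ (D.𝓖 M Xhat Ξ t) _ _ fun A hA => ?_
    rw [Measure.smul_apply, trim_measurableSet_eq hle hA, trim_measurableSet_eq hle hA,
      Measure.restrict_apply (hle A hA), Measure.restrict_apply (hle A hA)]
    have := h.measure_inter_lt_τ hts hA
    rw [measureReal_def, measureReal_def] at this
    rw [ENNReal.smul_def, smul_eq_mul, ← ENNReal.toReal_eq_toReal_iff' (measure_ne_top _ _)
      (ENNReal.mul_ne_top ENNReal.coe_ne_top (measure_ne_top _ _)), this, ENNReal.toReal_mul,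
      ENNReal.coe_toReal, Real.coe_toNNReal _ (Real.exp_nonneg _)]
  rw [integral_trim hle hφ, hm, integral_smul_nnreal_measure, ← integral_trim hle hφ,
    NNReal.smul_def, Real.coe_toNNReal _ (Real.exp_nonneg _), smul_eq_mul]

lemma IndependenceAssumption.integral_arrival
    (h : D.IndependenceAssumption M θ (Measure.dirac ⊤)) {Xhat Ξ : ℝ} {t s : ℝ≥0} (hts : t ≤ s)
    {φ : Ω → ℝ} (hφ : StronglyMeasurable[D.𝓖 M Xhat Ξ t] φ) (hφi : Integrable φ P) :
    ∫ ω, (if t < D.τ 0 ω ∧ D.τ 0 ω ≤ s then φ ω else 0) ∂P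
      = (1 - Real.exp (-(θ * (s - t)))) * ∫ ω, (if t < D.τ 0 ω then φ ω else 0) ∂P := by
  have hm : ∀ r, MeasurableSet {ω | r < D.τ 0 ω} := fun r =>
    measurableSet_lt measurable_const (D.τ_measurable 0)
  have e : ∀ ω, (if t < D.τ 0 ω ∧ D.τ 0 ω ≤ s then φ ω else 0)
      = {ω | t < D.τ 0 ω}.indicator φ ω - {ω | s < D.τ 0 ω}.indicator φ ω := by
    intro ω
    by_cases h1 : t < D.τ 0 ω
    · by_cases h2 : s < D.τ 0 ω
      · simp [indicator, h1, h2]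
      · simp [indicator, h1, h2, not_lt.1 h2]
    · have h2 : ¬ s < D.τ 0 ω := fun h2 => h1 (lt_of_le_of_lt hts h2)
      simp [indicator, h1, h2]
  have e' : ∀ ω, (if t < D.τ 0 ω then φ ω else 0) = {ω | t < D.τ 0 ω}.indicator φ ω := by
    intro ω
    by_cases h1 : t < D.τ 0 ω <;> simp [indicator, h1]
  simp_rw [e, e']
  rw [integral_sub (hφi.indicator (hm t)) (hφi.indicator (hm s)), integral_indicator (hm t),
    integral_indicator (hm s), h.setIntegral_lt_τ hts hφ]
  ring

lemma tendsto_one_sub_exp_div (θ T : ℝ) (hT : 0 < T) :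
    Tendsto (fun n : ℕ => (1 - Real.exp (-(θ * (T / (n + 1))))) / (T / (n + 1))) atTop (𝓝 θ) := by
  have hd : HasDerivAt (fun x : ℝ => 1 - Real.exp (-(θ * x))) θ 0 := by
    have := (((hasDerivAt_id (0 : ℝ)).const_mul θ).neg.exp).const_sub 1
    simpa using this
  have hs := hd.tendsto_slope
  have hu : Tendsto (fun n : ℕ => T / ((n : ℝ) + 1)) atTop (𝓝[≠] 0) := by
    rw [tendsto_nhdsWithin_iff]
    refine ⟨?_, Eventually.of_forall fun n => (by positivity : T / ((n : ℝ) + 1) ≠ 0)⟩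
    exact (tendsto_const_div_atTop_nhds_zero_nat T).comp (tendsto_add_atTop_nat 1)
      |>.congr fun n => by simp
  refine (hs.comp hu).congr fun n => ?_
  simp [slope_def_field]

/-- The compensator formula for the first arrival time. -/
theorem IndependenceAssumption.integral_at_arrival
    (h : D.IndependenceAssumption M θ (Measure.dirac ⊤)) {Xhat Ξ : ℝ} {T : ℝ≥0} {ρ : Ω → ℝ≥0}
    (hρ : IsStoppingTime (D.𝓖 M Xhat Ξ) (fun ω => (ρ ω : WithTop ℝ≥0)))
    (hρT : ∀ᵐ ω ∂P, ρ ω < T) {F : ℝ≥0 → Ω → ℝ}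
    (hF : ∀ t, StronglyMeasurable[D.𝓖 M Xhat Ξ t] (F t)) {C : ℝ} (hC : ∀ t ω, |F t ω| ≤ C)
    (hcont : ∀ᵐ ω ∂P, ContinuousOn (fun t => F t ω) (Iic T)) :
    Integrable (fun ω => if D.τ 0 ω ≤ ρ ω then F (D.τ 0 ω) ω else 0) P ∧
    Integrable (fun ω => ∫ t in (0 : ℝ)..(min (D.τ 0 ω) (ρ ω) : ℝ≥0), F t.toNNReal ω) P ∧
    ∫ ω, (if D.τ 0 ω ≤ ρ ω then F (D.τ 0 ω) ω else 0) ∂P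
      = θ * ∫ ω, (∫ t in (0 : ℝ)..(min (D.τ 0 ω) (ρ ω) : ℝ≥0), F t.toNNReal ω) ∂P := by
  have hT : 0 < T := by
    obtain ⟨ω, hω⟩ := hρT.exists
    exact zero_le.trans_lt hω
  have hC0 : 0 ≤ C := by
    obtain ⟨ω, -⟩ := hρT.exists
    exact (abs_nonneg _).trans (hC 0 ω)
  -- Killing F from ρ on keeps it adapted. The left end points stay strictly below t, so the strict
  -- condition at them becomes t ≤ ρ in the limit.
  set φ : ℝ≥0 → Ω → ℝ := fun t => {ω | t < ρ ω}.indicator (F t) with hφdef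
  have hρm : ∀ t, MeasurableSet[D.𝓖 M Xhat Ξ t] {ω | t < ρ ω} := by
    intro t
    have e : {ω | t < ρ ω} = {ω | (t : WithTop ℝ≥0) < ρ ω} := by
      ext ω
      exact (WithTop.coe_lt_coe (a := ρ ω) (b := t)).symm
    rw [e]
    exact hρ.measurableSet_gt t
  have hφm : ∀ t, StronglyMeasurable[D.𝓖 M Xhat Ξ t] (φ t) := fun t => (hF t).indicator (hρm t)
  have hφC : ∀ t ω, |φ t ω| ≤ C := by
    intro t ω
    simp only [hφdef, indicator]
    split_ifs
    · exact hC t ω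
    · simpa using hC0
  have hφi : ∀ t, Integrable (φ t) P := fun t =>
    Integrable.of_bound ((hφm t).mono ((D.𝓖 M Xhat Ξ).le t)).aestronglyMeasurable C
      (Eventually.of_forall (hφC t))
  have hτm : ∀ t, MeasurableSet {ω | t < D.τ 0 ω} := fun t =>
    measurableSet_lt measurable_const (D.τ_measurable 0)
  have hτm' : ∀ t, MeasurableSet {ω | D.τ 0 ω ≤ t} := fun t =>
    measurableSet_le (D.τ_measurable 0) measurable_const
  have hφm' : ∀ t, Measurable (φ t) := fun t =>
    ((hφm t).mono ((D.𝓖 M Xhat Ξ).le t)).measurable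
  -- the discretised jump term
  set a : ℕ → Ω → ℝ := fun n ω => ∑ k ∈ Finset.range (n + 1),
    (if grid T n k < D.τ 0 ω ∧ D.τ 0 ω ≤ grid T n (k + 1) then φ (grid T n k) ω else 0) with hadef
  set c : ℕ → Ω → ℝ := fun n ω => ∑ k ∈ Finset.range (n + 1),
    (if grid T n k < D.τ 0 ω then φ (grid T n k) ω else 0) * (T / (n + 1)) with hcdef
  have hterm : ∀ n k, Measurable
      (fun ω => if grid T n k < D.τ 0 ω then φ (grid T n k) ω else 0) := fun n k =>
    Measurable.ite (hτm _) (hφm' _) measurable_const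
  have hterm' : ∀ n k, Measurable (fun ω =>
      if grid T n k < D.τ 0 ω ∧ D.τ 0 ω ≤ grid T n (k + 1) then φ (grid T n k) ω else 0) :=
    fun n k => Measurable.ite ((hτm _).inter (hτm' _)) (hφm' _) measurable_const
  have hite : ∀ (p : Prop) [Decidable p] t ω, |if p then φ t ω else 0| ≤ C := by
    intro p _ t ω
    split_ifs
    · exact hφC t ω
    · simpa using hC0
  have ha_eq : ∀ n ω, a n ω
      = if D.τ 0 ω ≤ T then φ (grid T n (gridIndex T n (D.τ 0 ω))) ω else 0 := fun n ω =>
    sum_indicator_grid n ((D.τ_pos ω)) (fun k => φ (grid T n k) ω)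
  have ha_meas : ∀ n, AEStronglyMeasurable (a n) P := fun n =>
    (Finset.measurable_sum _ fun k _ => hterm' n k).aestronglyMeasurable
  have hc_meas : ∀ n, AEStronglyMeasurable (c n) P := fun n =>
    (Finset.measurable_sum _ fun k _ => (hterm n k).mul_const _).aestronglyMeasurable
  have ha_bd : ∀ n ω, |a n ω| ≤ C := by
    intro n ω
    rw [ha_eq]
    exact hite _ _ _
  have hc_bd : ∀ n ω, |c n ω| ≤ C * T := by
    intro n ω
    refine (Finset.abs_sum_le_sum_abs _ _).trans ?_
    refine (Finset.sum_le_sum (g := fun _ => C * ((T : ℝ) / (n + 1))) fun k _ => ?_).trans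
      (le_of_eq ?_)
    · rw [abs_mul, abs_of_nonneg (by positivity : (0 : ℝ) ≤ T / (n + 1))]
      exact mul_le_mul_of_nonneg_right (hite _ _ _) (by positivity)
    · rw [Finset.sum_const, Finset.card_range, nsmul_eq_mul]
      push_cast
      field_simp
  have hlimφ : ∀ ω, ContinuousOn (fun t => F t ω) (Iic T) → ρ ω < T → ∀ t : ℝ≥0,
      (t : ℝ) ∈ Ioc (0 : ℝ) T → Tendsto (fun n => φ (grid T n (gridIndex T n t)) ω) atTop
        (𝓝 (if t ≤ ρ ω then F t ω else 0)) := by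
    intro ω hω hωT t ht
    have hg := tendsto_grid_gridIndex ht
    have htT : t ≤ T := by exact_mod_cast ht.2
    split_ifs with htρ
    · have h1 : Tendsto (fun n => F (grid T n (gridIndex T n t)) ω) atTop (𝓝 (F t ω)) := by
        refine (hω t htT).tendsto.comp (tendsto_nhdsWithin_iff.2
          ⟨(tendsto_nhdsWithin_iff.1 hg).1, ?_⟩)
        filter_upwards [(tendsto_nhdsWithin_iff.1 hg).2] with n hn
        exact (le_of_lt hn).trans htT
      refine h1.congr' ?_
      filter_upwards [(tendsto_nhdsWithin_iff.1 hg).2] with n hn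
      have : grid T n (gridIndex T n t) < ρ ω := lt_of_lt_of_le hn htρ
      simp [hφdef, this]
    · refine tendsto_const_nhds.congr' ?_
      filter_upwards [(tendsto_nhdsWithin_iff.1 hg).1.eventually
        (lt_mem_nhds (not_le.1 htρ))] with n hn
      simp [hφdef, not_lt.2 (le_of_lt hn)]
  have ha_lim : ∀ᵐ ω ∂P, Tendsto (fun n => a n ω) atTop
      (𝓝 (if D.τ 0 ω ≤ ρ ω then F (D.τ 0 ω) ω else 0)) := by
    filter_upwards [hρT, hcont] with ω hωT hω
    simp_rw [ha_eq]
    by_cases hτT : D.τ 0 ω ≤ T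
    · simp only [hτT, if_true]
      exact hlimφ ω hω hωT _ ⟨by exact_mod_cast D.τ_pos ω, by exact_mod_cast hτT⟩
    · have : ¬ D.τ 0 ω ≤ ρ ω := fun h' => hτT (h'.trans hωT.le)
      simp [hτT, this]
  have hc_lim : ∀ᵐ ω ∂P, Tendsto (fun n => c n ω) atTop
      (𝓝 (∫ t in (0 : ℝ)..(min (D.τ 0 ω) (ρ ω) : ℝ≥0), F t.toNNReal ω)) := by
    filter_upwards [hρT, hcont] with ω hωT hω
    set σ : ℝ≥0 := min (D.τ 0 ω) (ρ ω) with hσ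
    have hσT : (σ : ℝ) ≤ T := NNReal.coe_le_coe.2 ((min_le_right _ _).trans hωT.le)
    have hlim := tendsto_sum_grid_mul (T := T)
      (G := fun t => if t < D.τ 0 ω then φ t ω else 0)
      (g := (Iic (σ : ℝ)).indicator (fun t => F t.toNNReal ω)) (C := C) (fun t => hite _ _ _) ?_
    · have e : ∫ t in (0 : ℝ)..T, (Iic (σ : ℝ)).indicator (fun t => F t.toNNReal ω) t
          = ∫ t in (0 : ℝ)..σ, F t.toNNReal ω := by
        rw [intervalIntegral.integral_of_le (NNReal.coe_nonneg T),
          intervalIntegral.integral_of_le (NNReal.coe_nonneg σ),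
          setIntegral_indicator measurableSet_Iic, Ioc_inter_Iic, min_eq_right hσT]
      rw [← e]
      exact hlim
    -- The single time t = τ is a null set, so it is enough to treat t < τ and t > τ.
    · filter_upwards [Measure.ae_ne volume ((D.τ 0 ω : ℝ))] with t htτ ht
      have hc : ((t.toNNReal : ℝ≥0) : ℝ) = t := Real.coe_toNNReal t ht.1.le
      have h1 := hlimφ ω hω hωT t.toNNReal (by rwa [hc])
      have hg := tendsto_grid_gridIndex (T := T) (t := t.toNNReal) (by rwa [hc])
      rw [hc] at h1 hg
      have hne : t.toNNReal ≠ D.τ 0 ω := fun h' => htτ (by rw [← h', hc])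
      rcases lt_or_gt_of_ne hne with hlt | hgt
      · have e : (Iic (σ : ℝ)).indicator (fun t => F t.toNNReal ω) t
            = if t.toNNReal ≤ ρ ω then F t.toNNReal ω else 0 := by
          have : t ∈ Iic (σ : ℝ) ↔ t.toNNReal ≤ ρ ω := by
            rw [mem_Iic, ← hc, NNReal.coe_le_coe, hc, hσ, le_min_iff]
            exact and_iff_right hlt.le
          by_cases h' : t.toNNReal ≤ ρ ω
          · rw [indicator_of_mem (this.2 h'), if_pos h']
          · rw [indicator_of_notMem (fun h'' => h' (this.1 h'')), if_neg h']
        rw [e]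
        refine h1.congr' ?_
        filter_upwards [(tendsto_nhdsWithin_iff.1 hg).2] with n hn
        rw [if_pos (lt_trans hn hlt)]
      · have e : (Iic (σ : ℝ)).indicator (fun t => F t.toNNReal ω) t = 0 := by
          refine indicator_of_notMem (fun h' => ?_) _
          rw [mem_Iic, ← hc, NNReal.coe_le_coe, hσ, le_min_iff] at h'
          exact absurd h'.1 (not_le.2 hgt)
        rw [e]
        refine tendsto_const_nhds.congr' ?_
        filter_upwards [(tendsto_nhdsWithin_iff.1 hg).1.eventually (lt_mem_nhds hgt)] with n hn
        rw [if_neg (not_lt.2 (le_of_lt hn))]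
  have hA := tendsto_integral_of_dominated_convergence (fun _ => C) ha_meas (integrable_const C)
    (fun n => Eventually.of_forall (ha_bd n)) ha_lim
  have hCl := tendsto_integral_of_dominated_convergence (fun _ => C * T) hc_meas
    (integrable_const _) (fun n => Eventually.of_forall (hc_bd n)) hc_lim
  -- All cells have the same length, so the conditional arrival probability is one common factor.
  -- Divided by the cell length it tends to θ.
  have hac : ∀ n : ℕ, ∫ ω, a n ω ∂P
      = (1 - Real.exp (-(θ * ((T : ℝ) / (n + 1))))) / ((T : ℝ) / (n + 1)) * ∫ ω, c n ω ∂P := by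
    intro n
    have hTn : (0 : ℝ) < (T : ℝ) / (n + 1) := by
      have : (0 : ℝ) < T := by exact_mod_cast hT
      positivity
    rw [hadef, hcdef]
    simp only
    rw [integral_finsetSum _ fun k _ => Integrable.of_bound (hterm' n k).aestronglyMeasurable C
        (Eventually.of_forall fun ω => hite _ _ _),
      integral_finsetSum _ fun k _ => (Integrable.of_bound (hterm n k).aestronglyMeasurable C
        (Eventually.of_forall fun ω => hite _ _ _)).mul_const _, Finset.mul_sum]
    refine Finset.sum_congr rfl fun k _ => ?_
    rw [h.integral_arrival (monotone_grid T n k.le_succ) (hφm _) (hφi _), integral_mul_const,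
      coe_grid_succ, add_sub_cancel_left]
    field_simp
  refine ⟨?_, ?_, ?_⟩
  · refine Integrable.of_bound (aestronglyMeasurable_of_tendsto_ae atTop ha_meas ha_lim) C ?_
    refine Eventually.of_forall fun ω => ?_
    split_ifs
    · exact hC _ _
    · simpa using hC0
  · refine Integrable.of_bound (aestronglyMeasurable_of_tendsto_ae atTop hc_meas hc_lim) (C * T) ?_
    filter_upwards [hc_lim] with ω hω
    exact le_of_tendsto' hω.norm fun n => hc_bd n ω
  · simp_rw [hac] at hA
    refine tendsto_nhds_unique hA ((tendsto_one_sub_exp_div θ T (by exact_mod_cast hT)).mul hCl)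

end DarkPoolExtension

/-! ### Measurability of the traded volume -/

section Measurability

variable {Ω : Type*} [mΩ : MeasurableSpace Ω] {P : Measure Ω}

/-- Clamping the time variable at t leaves the integral unchanged and makes the integrand a function
on [0, t] × Ω, where progressive measurability applies. -/
lemma stronglyMeasurable_integral_of_progressive {𝓖 : Filtration ℝ≥0 mΩ} {u : ℝ≥0 → Ω → ℝ}
    (hu : IsStronglyProgressive 𝓖 u) (t : ℝ≥0) :
    StronglyMeasurable[𝓖 t] (fun ω => ∫ s in (0 : ℝ)..t, u s.toNNReal ω) := by
  have e : (fun ω => ∫ s in (0 : ℝ)..t, u s.toNNReal ω)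
      = fun ω => ∫ s, u (min s.toNNReal t) ω ∂(volume.restrict (Ioc (0 : ℝ) t)) := by
    ext ω
    rw [intervalIntegral.integral_of_le (NNReal.coe_nonneg t)]
    refine setIntegral_congr_fun measurableSet_Ioc fun s hs => ?_
    rw [min_eq_left (Real.toNNReal_le_iff_le_coe.2 hs.2)]
  rw [e]
  refine @StronglyMeasurable.integral_prod_left ℝ Ω ℝ _ (𝓖 t) (volume.restrict (Ioc (0 : ℝ) t))
    _ _ _ (fun s ω => u (min s.toNNReal t) ω) ?_
  have hm : @Measurable (ℝ × Ω) (Iic t × Ω) (@Prod.instMeasurableSpace _ _ _ (𝓖 t))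
      (@Prod.instMeasurableSpace _ _ _ (𝓖 t))
      (fun p : ℝ × Ω =>
        ((⟨min p.1.toNNReal t, mem_Iic.2 (min_le_right _ _)⟩ : Iic t), p.2)) := by
    let : MeasurableSpace Ω := 𝓖 t
    have h1 : Measurable fun p : ℝ × Ω => min p.1.toNNReal t :=
      (measurable_real_toNNReal.comp measurable_fst).min measurable_const
    exact (h1.subtype_mk (h := fun p => mem_Iic.2 (min_le_right _ _))).prodMk measurable_snd
  exact (hu t).comp_measurable hm

lemma predictable_le_prod (𝓖 : Filtration ℝ≥0 mΩ) :
    𝓖.predictable ≤ (Prod.instMeasurableSpace : MeasurableSpace (ℝ≥0 × Ω)) :=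
  measurableSpace_le_predictable_of_measurableSet
    (fun A hA => (measurableSet_singleton _).prod (𝓖.le _ A hA))
    (fun i A hA => measurableSet_Ioi.prod (𝓖.le i A hA))

lemma stronglyMeasurable_uncurry_of_predictable {𝓖 : Filtration ℝ≥0 mΩ} {u : ℝ≥0 → Ω → ℝ}
    (hu : IsStronglyPredictable 𝓖 u) :
    StronglyMeasurable (Function.uncurry fun (s : ℝ) ω => u s.toNNReal ω) :=
  (StronglyMeasurable.mono hu (predictable_le_prod 𝓖)).comp_measurable
    (g := fun p : ℝ × Ω => (p.1.toNNReal, p.2))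
    ((measurable_real_toNNReal.comp measurable_fst).prodMk measurable_snd)

namespace DarkPoolExtension

variable [IsProbabilityMeasure P] {D : DarkPoolExtension Ω} {M : AlmgrenChrissModel P}

/-- Given τ ≤ t, the failure ρ < τ is witnessed by a rational q with ρ ≤ q < τ ≤ t, an event already
known at time q. -/
lemma measurableSet_τ_le_min {Xhat Ξ : ℝ} {ρ : Ω → ℝ≥0}
    (hρ : IsStoppingTime (D.𝓖 M Xhat Ξ) (fun ω => (ρ ω : WithTop ℝ≥0))) (t : ℝ≥0) :
    MeasurableSet[D.𝓖 M Xhat Ξ t] {ω | D.τ 0 ω ≤ min t (ρ ω)} := by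
  have hρm : ∀ r, MeasurableSet[D.𝓖 M Xhat Ξ r] {ω | ρ ω ≤ r} := fun r => by
    have e : {ω | ρ ω ≤ r} = {ω | (ρ ω : WithTop ℝ≥0) ≤ r} := by
      ext ω
      exact (WithTop.coe_le_coe (a := r) (b := ρ ω)).symm
    rw [e]
    exact hρ r
  have e : {ω | D.τ 0 ω ≤ min t (ρ ω)} = {ω | D.τ 0 ω ≤ t} \
      ⋃ q : ℚ, {ω | (q : ℝ).toNNReal ≤ t ∧ ρ ω ≤ (q : ℝ).toNNReal ∧ ¬ D.τ 0 ω ≤ (q : ℝ).toNNReal}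
      := by
    ext ω
    simp only [mem_ofPred_eq, le_min_iff, Set.mem_sdiff, mem_iUnion, not_exists, not_and, not_not]
    refine and_congr_right fun ht => ⟨fun h q _ h2 => h.trans h2, fun h => ?_⟩
    by_contra hlt
    obtain ⟨q, hq0, hq1⟩ := exists_rat_btwn (NNReal.coe_lt_coe.2 (not_le.1 hlt))
    have hqc : ((q : ℝ).toNNReal : ℝ) = q :=
      Real.coe_toNNReal _ ((NNReal.coe_nonneg _).trans hq0.le)
    have h1 : ρ ω ≤ (q : ℝ).toNNReal := by rw [← NNReal.coe_le_coe, hqc]; exact hq0.le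
    have h2 : (q : ℝ).toNNReal < D.τ 0 ω := by rw [← NNReal.coe_lt_coe, hqc]; exact hq1
    exact absurd (h q (h2.le.trans ht) h1) (not_le.2 h2)
  rw [e]
  refine (measurableSet_τ_le M Xhat Ξ t).diff (MeasurableSet.iUnion fun q => ?_)
  by_cases hq : (q : ℝ).toNNReal ≤ t
  · simp only [hq, true_and]
    exact ((D.𝓖 M Xhat Ξ).mono hq _ (hρm _)).inter
      ((D.𝓖 M Xhat Ξ).mono hq _ (measurableSet_τ_le M Xhat Ξ _)).compl
  · simp only [hq, false_and]
    exact @MeasurableSet.empty _ (D.𝓖 M Xhat Ξ t)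

end DarkPoolExtension

end Measurability

/-! ### The position and the gains from the unaffected price -/

lemma sum_neg_mul_increment (B p : ℕ → ℝ) (n : ℕ) :
    ∑ k ∈ Finset.range n, -B k * (p (k + 1) - p k)
      = B 0 * p 0 - B n * p n + ∑ k ∈ Finset.range n, p (k + 1) * (B (k + 1) - B k) := by
  induction n with
  | zero => simp
  | succ n ih =>
    rw [Finset.sum_range_succ, Finset.sum_range_succ, ih]
    ring

namespace Strategy

variable {Ω : Type*} [mΩ : MeasurableSpace Ω] {P : Measure Ω} [IsProbabilityMeasure P]
  {M : AlmgrenChrissModel P} {D : DarkPoolExtension Ω} {X₀ : ℝ} {T : ℝ≥0} {χ : Strategy Ω}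
  {θ : ℝ≥0}

/-- The number of shares held at time `t`. -/
noncomputable def position (D : DarkPoolExtension Ω) (X₀ : ℝ) (χ : Strategy Ω) (t : ℝ≥0) (ω : Ω) :
    ℝ :=
  X₀ + χ.traded t ω + if D.τ 0 ω ≤ min t (χ.ρ ω) then χ.Xhat else 0

/-- The part of the costs that is due to the unaffected price process. -/
noncomputable def priceCost (M : AlmgrenChrissModel P) (D : DarkPoolExtension Ω) (X₀ : ℝ) (T : ℝ≥0)
    (χ : Strategy Ω) (ω : Ω) : ℝ :=
  X₀ * M.P0 0 ω + (∫ t in (0 : ℝ)..T, χ.ξ t.toNNReal ω * M.P0 t.toNNReal ω)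
    + if D.τ 0 ω ≤ χ.ρ ω then χ.Xhat * M.P0 (D.τ 0 ω) ω else 0

lemma IsAdmissible.stronglyMeasurable_traded (hχ : χ.IsAdmissible M D X₀ T) (t : ℝ≥0) :
    StronglyMeasurable[D.𝓖 M χ.Xhat χ.Ξ t] (χ.traded t) :=
  stronglyMeasurable_integral_of_progressive hχ.predictable.isStronglyProgressive t

lemma IsAdmissible.stronglyMeasurable_position (hχ : χ.IsAdmissible M D X₀ T) (t : ℝ≥0) :
    StronglyMeasurable[D.𝓖 M χ.Xhat χ.Ξ t] (position D X₀ χ t) := by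
  refine (stronglyMeasurable_const.add (hχ.stronglyMeasurable_traded t)).add ?_
  exact StronglyMeasurable.ite (DarkPoolExtension.measurableSet_τ_le_min hχ.isStoppingTime t)
    stronglyMeasurable_const stronglyMeasurable_const

lemma position_zero (χ : Strategy Ω) (ω : Ω) : position D X₀ χ 0 ω = X₀ := by
  have : ¬ D.τ 0 ω ≤ min 0 (χ.ρ ω) := by
    rw [min_eq_left zero_le, not_le]
    exact D.τ_pos ω
  rw [position, if_neg this]
  simp [traded]

lemma IsAdmissible.position_T (hχ : χ.IsAdmissible M D X₀ T)
    (h : D.IndependenceAssumption M θ (Measure.dirac ⊤)) :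
    ∀ᵐ ω ∂P, position D X₀ χ T ω = 0 := by
  filter_upwards [hχ.liquidation, hχ.ρ_lt, h.ae_regular] with ω h1 h2 h3
  rw [h3.Z_eq] at h1
  rw [position, min_eq_right h2.le]
  exact h1

lemma traded_sub_traded {ω : Ω}
    (hω : IntervalIntegrable (fun s : ℝ => χ.ξ s.toNNReal ω) volume 0 T) {s t : ℝ≥0}
    (hst : s ≤ t) (ht : t ≤ T) :
    χ.traded t ω - χ.traded s ω = ∫ r in (s : ℝ)..t, χ.ξ r.toNNReal ω := by
  refine intervalIntegral.integral_interval_sub_left (hω.mono_set ?_) (hω.mono_set ?_)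
  · rw [uIcc_of_le (NNReal.coe_nonneg _), uIcc_of_le (NNReal.coe_nonneg _)]
    exact Icc_subset_Icc_right (NNReal.coe_le_coe.2 ht)
  · rw [uIcc_of_le (NNReal.coe_nonneg _), uIcc_of_le (NNReal.coe_nonneg _)]
    exact Icc_subset_Icc_right (NNReal.coe_le_coe.2 (hst.trans ht))

lemma grid_le {T : ℝ≥0} {n k : ℕ} (hk : k ≤ n + 1) : grid T n k ≤ T := by
  have := monotone_grid T n hk
  rwa [grid_last] at this

lemma position_sub_position {ω : Ω}
    (hω : IntervalIntegrable (fun s : ℝ => χ.ξ s.toNNReal ω) volume 0 T) {n k : ℕ}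
    (hk : k < n + 1) :
    position D X₀ χ (grid T n (k + 1)) ω - position D X₀ χ (grid T n k) ω
      = (∫ r in (grid T n k : ℝ)..(grid T n (k + 1)), χ.ξ r.toNNReal ω)
        + if grid T n k < D.τ 0 ω ∧ D.τ 0 ω ≤ grid T n (k + 1) then
            (if D.τ 0 ω ≤ χ.ρ ω then χ.Xhat else 0) else 0 := by
  have hmono := monotone_grid T n k.le_succ
  rw [← traded_sub_traded hω hmono (grid_le hk), position, position]
  have : (if D.τ 0 ω ≤ min (grid T n (k + 1)) (χ.ρ ω) then χ.Xhat else 0)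
      - (if D.τ 0 ω ≤ min (grid T n k) (χ.ρ ω) then χ.Xhat else 0)
      = if grid T n k < D.τ 0 ω ∧ D.τ 0 ω ≤ grid T n (k + 1) then
            (if D.τ 0 ω ≤ χ.ρ ω then χ.Xhat else 0) else 0 := by
    by_cases h1 : D.τ 0 ω ≤ χ.ρ ω
    · by_cases h2 : D.τ 0 ω ≤ grid T n k
      · simp [h1, h2, h2.trans hmono, not_lt.2 h2]
      · by_cases h3 : D.τ 0 ω ≤ grid T n (k + 1)
        · simp [h1, h2, h3, not_le.1 h2]
        · simp [h1, h2, h3]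
    · simp [h1]
  rw [← this]
  ring

/-- The sums `∑ P⁰_{t_{k+1}} (B_{t_{k+1}} - B_{t_k})` along the grid, `B` being the position. -/
noncomputable def discreteCost (M : AlmgrenChrissModel P) (D : DarkPoolExtension Ω) (X₀ : ℝ)
    (T : ℝ≥0) (χ : Strategy Ω) (n : ℕ) (ω : Ω) : ℝ :=
  X₀ * M.P0 0 ω + ∑ k ∈ Finset.range (n + 1), M.P0 (grid T n (k + 1)) ω
    * (position D X₀ χ (grid T n (k + 1)) ω - position D X₀ χ (grid T n k) ω)

/-- The position changes by trading and by one jump at τ. Right end points make P⁰ evaluated at the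
jump converge to P⁰_τ itself rather than to its left limit. -/
lemma tendsto_discreteCost {ω : Ω}
    (hω : IntervalIntegrable (fun s : ℝ => χ.ξ s.toNNReal ω) volume 0 T) (hρ : χ.ρ ω < T) :
    Tendsto (fun n => discreteCost M D X₀ T χ n ω) atTop (𝓝 (priceCost M D X₀ T χ ω)) := by
  have e : ∀ n, discreteCost M D X₀ T χ n ω = X₀ * M.P0 0 ω
      + (∑ k ∈ Finset.range (n + 1), M.P0 (grid T n (k + 1)) ω
        * ∫ r in (grid T n k : ℝ)..(grid T n (k + 1)), χ.ξ r.toNNReal ω)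
      + if D.τ 0 ω ≤ T then M.P0 (grid T n (gridIndex T n (D.τ 0 ω) + 1)) ω
          * (if D.τ 0 ω ≤ χ.ρ ω then χ.Xhat else 0) else 0 := by
    intro n
    rw [← sum_indicator_grid n (D.τ_pos ω) (fun k => M.P0 (grid T n (k + 1)) ω
      * (if D.τ 0 ω ≤ χ.ρ ω then χ.Xhat else 0)), discreteCost, add_assoc,
      ← Finset.sum_add_distrib]
    congr 1
    refine Finset.sum_congr rfl fun k hk => ?_
    rw [position_sub_position hω (Finset.mem_range.1 hk), mul_add, mul_ite, mul_zero]
  simp_rw [e, priceCost]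
  refine (tendsto_const_nhds.add ((M.cadlag ω).tendsto_sum_mul_increment hω)).add ?_
  by_cases hτ : D.τ 0 ω ≤ χ.ρ ω
  · have hτT : D.τ 0 ω ≤ T := hτ.trans hρ.le
    simp only [hτ, hτT, if_true]
    rw [mul_comm]
    exact ((M.cadlag ω).tendsto_grid
      ⟨by exact_mod_cast D.τ_pos ω, by exact_mod_cast hτT⟩).mul_const _
  · simp [hτ]

/-- The costs due to the unaffected price are a limit of transforms of `P⁰`. -/
lemma IsAdmissible.exists_transform (hχ : χ.IsAdmissible M D X₀ T)
    (h : D.IndependenceAssumption M θ (Measure.dirac ⊤)) :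
    ∃ c : ℝ, 0 < c ∧ ∃ b : ℕ → ℕ → Ω → ℝ,
      (∀ m k, StronglyMeasurable[D.𝓖 M χ.Xhat χ.Ξ (grid T m k)] (b m k)) ∧
      (∀ m k ω, |b m k ω| ≤ 1) ∧
      ∀ᵐ ω ∂P, Tendsto (fun m => transform M.P0 (grid T m) (b m) (m + 1) ω) atTop
        (𝓝 (priceCost M D X₀ T χ ω / c)) := by
  obtain ⟨C, hC⟩ := hχ.bounded
  set c : ℝ := |X₀| + |C| + |χ.Xhat| + 1 with hcdef
  have hc : 0 < c := by positivity
  -- The position is bounded only almost surely, while a bound for every ω is required. Clipping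
  -- provides it and is almost surely inactive, because c exceeds the bound of the position.
  refine ⟨c, hc, fun m k ω => max (-1) (min 1 (-position D X₀ χ (grid T m k) ω / c)),
    fun m k => ?_, fun m k ω => ?_, ?_⟩
  · have hcont : Continuous fun x : ℝ => max (-1) (min 1 (-x / c)) := by fun_prop
    exact hcont.comp_stronglyMeasurable (hχ.stronglyMeasurable_position _)
  · rw [abs_le]
    exact ⟨le_max_left _ _, max_le (by norm_num) (min_le_left _ _)⟩
  · filter_upwards [hC, hχ.integrable, hχ.ρ_lt, hχ.position_T h] with ω hωC hω hωρ hωT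
    refine ((tendsto_discreteCost (M := M) (D := D) (X₀ := X₀) hω hωρ).div_const c).congr
      fun m => ?_
    have hb : ∀ k < m + 1, max (-1) (min 1 (-position D X₀ χ (grid T m k) ω / c))
        = -position D X₀ χ (grid T m k) ω / c := by
      intro k hk
      have h1 : |position D X₀ χ (grid T m k) ω| ≤ c := by
        have h2 := hωC _ (grid_le hk.le)
        have h3 : |if D.τ 0 ω ≤ min (grid T m k) (χ.ρ ω) then χ.Xhat else 0| ≤ |χ.Xhat| := by
          split_ifs
          · exact le_rfl
          · simp
        have h4 := abs_add_three X₀ (χ.traded (grid T m k) ω)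
          (if D.τ 0 ω ≤ min (grid T m k) (χ.ρ ω) then χ.Xhat else 0)
        rw [position]
        have := le_abs_self C
        linarith
      rw [abs_le] at h1
      rw [min_eq_right, max_eq_right]
      · rw [le_div_iff₀ hc]; linarith
      · rw [div_le_one hc]; linarith
    have e : transform M.P0 (grid T m)
        (fun k ω => max (-1) (min 1 (-position D X₀ χ (grid T m k) ω / c))) (m + 1) ω
        = (∑ k ∈ Finset.range (m + 1), -position D X₀ χ (grid T m k) ω
          * (M.P0 (grid T m (k + 1)) ω - M.P0 (grid T m k) ω)) / c := by
      rw [transform, Finset.sum_div]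
      refine Finset.sum_congr rfl fun k hk => ?_
      rw [hb k (Finset.mem_range.1 hk)]
      ring
    -- Boundary terms of the summation by parts: the position is X₀ at time 0 and 0 at time T.
    rw [e, sum_neg_mul_increment (fun k => position D X₀ χ (grid T m k) ω)
      (fun k => M.P0 (grid T m k) ω), grid_last, hωT, grid_zero, position_zero, discreteCost]
    ring

theorem IsAdmissible.integrable_priceCost (hχ : χ.IsAdmissible M D X₀ T)
    (h : D.IndependenceAssumption M θ (Measure.dirac ⊤)) {F : Ω → ℝ} (hF : Integrable F P)
    (hLF : ∀ᵐ ω ∂P, priceCost M D X₀ T χ ω ≤ F ω) :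
    Integrable (priceCost M D X₀ T χ) P ∧ 0 ≤ ∫ ω, priceCost M D X₀ T χ ω ∂P := by
  obtain ⟨c, hc, b, hb, hb1, hlim⟩ := hχ.exists_transform h
  obtain ⟨h1, h2⟩ := integrable_and_integral_nonneg_of_tendsto_transform
    (h.martingale χ.Xhat χ.Ξ) (T := T) (fun m => monotone_grid T m) (grid_last T) hb hb1 hlim
    (hF.div_const c) (hLF.mono fun ω hω => div_le_div_of_nonneg_right hω hc.le)
  constructor
  · have := h1.mul_const c
    simpa [div_mul_cancel₀ _ hc.ne'] using this
  · rw [integral_div] at h2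
    have := mul_nonneg h2 hc.le
    rwa [div_mul_cancel₀ _ hc.ne'] at this

/-- Once integrable, both signs of the limit are admissible, and the one-sided inequality applied to
b and to -b forces mean zero. -/
theorem IsAdmissible.integral_priceCost (hχ : χ.IsAdmissible M D X₀ T)
    (h : D.IndependenceAssumption M θ (Measure.dirac ⊤))
    (hL : Integrable (priceCost M D X₀ T χ) P) : ∫ ω, priceCost M D X₀ T χ ω ∂P = 0 := by
  obtain ⟨c, hc, b, hb, hb1, hlim⟩ := hχ.exists_transform h
  have hneg : ∀ m ω, transform M.P0 (grid T m) (fun k => -b m k) (m + 1) ω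
      = -transform M.P0 (grid T m) (b m) (m + 1) ω := by
    intro m ω
    simp [transform]
  obtain ⟨-, h2⟩ := integrable_and_integral_nonneg_of_tendsto_transform
    (h.martingale χ.Xhat χ.Ξ) (T := T) (fun m => monotone_grid T m) (grid_last T)
    (b := fun m k => -b m k) (fun m k => (hb m k).neg) (fun m k ω => by simpa using hb1 m k ω)
    (L := fun ω => -(priceCost M D X₀ T χ ω / c))
    (hlim.mono fun ω hω => by simp_rw [hneg]; exact hω.neg)
    (hL.div_const c).neg (Eventually.of_forall fun ω => le_rfl)
  obtain ⟨-, h1⟩ := hχ.integrable_priceCost h hL (Eventually.of_forall fun ω => le_rfl)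
  rw [integral_neg, integral_div] at h2
  have h3 : (∫ ω, priceCost M D X₀ T χ ω ∂P) / c ≤ 0 := by linarith
  have := mul_nonpos_of_nonpos_of_nonneg h3 hc.le
  rw [div_mul_cancel₀ _ hc.ne'] at this
  linarith

end Strategy

/-! ### Extended integrals of real functions -/

section ExtIntegral

variable {α : Type*} [MeasurableSpace α] {ν : Measure α} {f : α → ℝ}

lemma extIntegral_congr {f g : α → EReal} (h : f =ᵐ[ν] g) : extIntegral ν f = extIntegral ν g := by
  rw [extIntegral, extIntegral, lintegral_congr_ae (h.mono fun x hx => congrArg EReal.toENNReal hx),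
    lintegral_congr_ae (h.mono fun x hx => congrArg (fun y : EReal => (-y).toENNReal) hx)]

lemma hasExtIntegral_congr {f g : α → EReal} (h : f =ᵐ[ν] g) :
    HasExtIntegral ν f ↔ HasExtIntegral ν g := by
  rw [HasExtIntegral, HasExtIntegral,
    lintegral_congr_ae (h.mono fun x hx => congrArg EReal.toENNReal hx),
    lintegral_congr_ae (h.mono fun x hx => congrArg (fun y : EReal => (-y).toENNReal) hx)]

lemma lintegral_neg_coe_toENNReal (f : α → ℝ) :
    ∫⁻ x, (-(f x : EReal)).toENNReal ∂ν = ∫⁻ x, ENNReal.ofReal (-f x) ∂ν :=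
  lintegral_congr fun x => by
    rw [← EReal.coe_neg, EReal.toENNReal_of_ne_top (EReal.coe_ne_top _), EReal.toReal_coe]

lemma lintegral_coe_toENNReal (f : α → ℝ) :
    ∫⁻ x, (f x : EReal).toENNReal ∂ν = ∫⁻ x, ENNReal.ofReal (f x) ∂ν :=
  lintegral_congr fun x => by
    rw [EReal.toENNReal_of_ne_top (EReal.coe_ne_top _), EReal.toReal_coe]

lemma lintegral_ofReal_ne_top (hf : Integrable f ν) : ∫⁻ x, ENNReal.ofReal (f x) ∂ν ≠ ⊤ :=
  ne_top_of_le_ne_top (hasFiniteIntegral_iff_enorm.1 hf.2).ne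
    (lintegral_mono fun x => Real.ofReal_le_enorm (f x))

lemma integrable_of_lintegral_ofReal_ne_top (hf : AEStronglyMeasurable f ν)
    (h1 : ∫⁻ x, ENNReal.ofReal (f x) ∂ν ≠ ⊤) (h2 : ∫⁻ x, ENNReal.ofReal (-f x) ∂ν ≠ ⊤) :
    Integrable f ν := by
  refine ⟨hf, hasFiniteIntegral_iff_enorm.2 ?_⟩
  have e : ∀ x, ‖f x‖ₑ = ENNReal.ofReal (f x) + ENNReal.ofReal (-f x) := by
    intro x
    rcases le_total 0 (f x) with h | h
    · rw [Real.enorm_eq_ofReal h, ENNReal.ofReal_of_nonpos (p := -f x) (by linarith), add_zero]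
    · rw [Real.enorm_eq_ofReal_abs, abs_of_nonpos h, ENNReal.ofReal_of_nonpos h, zero_add]
  simp_rw [e]
  rw [lintegral_add_left' hf.aemeasurable.ennreal_ofReal]
  exact ENNReal.add_lt_top.2 ⟨h1.lt_top, h2.lt_top⟩

lemma extIntegral_coe (hf : Integrable f ν) :
    extIntegral ν (fun x => (f x : EReal)) = ((∫ x, f x ∂ν : ℝ) : EReal) := by
  have h1 := lintegral_ofReal_ne_top hf
  have h2 : ∫⁻ x, ENNReal.ofReal (-f x) ∂ν ≠ ⊤ := lintegral_ofReal_ne_top hf.neg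
  rw [extIntegral, lintegral_coe_toENNReal, lintegral_neg_coe_toENNReal,
    integral_eq_lintegral_pos_part_sub_lintegral_neg_part hf, EReal.coe_sub,
    EReal.coe_ennreal_toReal h1, EReal.coe_ennreal_toReal h2]

lemma hasExtIntegral_coe (hf : Integrable f ν) : HasExtIntegral ν (fun x => (f x : EReal)) := by
  left
  rw [lintegral_coe_toENNReal]
  exact lintegral_ofReal_ne_top hf

lemma extIntegral_eq_top {f : α → EReal} (h1 : ∫⁻ x, (f x).toENNReal ∂ν = ⊤)
    (h2 : ∫⁻ x, (-f x).toENNReal ∂ν ≠ ⊤) : extIntegral ν f = ⊤ := by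
  rw [extIntegral, h1]
  lift (∫⁻ x, (-f x).toENNReal ∂ν) to ℝ≥0 using h2 with r
  rfl

end ExtIntegral

namespace Strategy

variable {Ω : Type*} [mΩ : MeasurableSpace Ω] {P : Measure Ω} [IsProbabilityMeasure P]
  {M : AlmgrenChrissModel P} {D : DarkPoolExtension Ω} {X₀ η : ℝ} {T : ℝ≥0} {χ : Strategy Ω}
  {θ : ℝ≥0}

/-- The costs that are due to price impact. -/
noncomputable def impactCost (M : AlmgrenChrissModel P) (D : DarkPoolExtension Ω) (η X₀ : ℝ)
    (T : ℝ≥0) (χ : Strategy Ω) (ω : Ω) : ℝ :=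
  M.γ / 2 * X₀ ^ 2 + η * (∫ t in (0 : ℝ)..T, χ.ξ t.toNNReal ω ^ 2)
    + if D.τ 0 ω ≤ χ.ρ ω then
        M.γ * χ.Xhat * (X₀ + χ.traded (D.τ 0 ω) ω) + M.γ * χ.Xhat ^ 2 / 2 else 0

lemma traded_toNNReal {t : ℝ} (ht : 0 ≤ t) (ω : Ω) :
    χ.traded t.toNNReal ω = ∫ s in (0 : ℝ)..t, χ.ξ s.toNNReal ω := by
  rw [traded, Real.coe_toNNReal t ht]

lemma sum_dark_cost (h : D.IndependenceAssumption M θ (Measure.dirac ⊤)) (hα : D.α = 0)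
    (hκ : D.κ = 0) {ω : Ω} (hω : D.Regular ω) :
    ∑ i ∈ Finset.range (D.N (χ.ρ ω) ω), D.Y χ.Xhat χ.Ξ i ω *
          (χ.darkPrice M D (D.τ i ω) ω
            + D.α * M.γ * (∑ j ∈ Finset.range i, D.Y χ.Xhat χ.Ξ j ω)
            + D.β (D.Y χ.Xhat χ.Ξ i ω))
      = if D.τ 0 ω ≤ χ.ρ ω then
          χ.Xhat * (M.P0 (D.τ 0 ω) ω + M.γ * χ.traded (D.τ 0 ω) ω) else 0 := by
  simp only [hα, h.β_eq_zero, Pi.zero_apply, zero_mul, add_zero, darkPrice, hκ]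
  exact hω.sum_Y_mul χ.Xhat χ.Ξ (χ.ρ ω)
    fun i => M.P0 (D.τ i ω) ω + M.γ * χ.traded (D.τ i ω) ω

lemma integrable_exchange {ω : Ω}
    (hω : IntervalIntegrable (fun s : ℝ => χ.ξ s.toNNReal ω) volume 0 T) :
    IntervalIntegrable (fun t : ℝ => χ.ξ t.toNNReal ω
      * (M.P0 t.toNNReal ω + M.γ * ∫ s in (0 : ℝ)..t, χ.ξ s.toNNReal ω)) volume 0 T := by
  simp_rw [mul_add]
  refine ((M.cadlag ω).intervalIntegrable_mul hω).add (hω.mul_continuousOn ?_)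
  exact (intervalIntegral.continuousOn_primitive_interval' hω left_mem_uIcc).const_mul _

lemma exchange_eq (hh : ∀ x, M.h x = η * x) {ω : Ω} :
    extIntegral (volume.restrict (Ioc (0 : ℝ) T))
        (fun t => ((χ.ξ t.toNNReal ω * χ.price M t.toNNReal ω : ℝ) : EReal))
      = extIntegral (volume.restrict (Ioc (0 : ℝ) T))
        (fun t => ((χ.ξ t.toNNReal ω
          * (M.P0 t.toNNReal ω + M.γ * ∫ s in (0 : ℝ)..t, χ.ξ s.toNNReal ω)
            + η * χ.ξ t.toNNReal ω ^ 2 : ℝ) : EReal)) := by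
  refine extIntegral_congr ?_
  filter_upwards [ae_restrict_mem measurableSet_Ioc] with t ht
  rw [price, hh, traded_toNNReal ht.1.le]
  congr 1
  ring

/-- The permanent impact at the exchange is γ/2 times the squared net volume. Liquidation fixes that
volume as -X₀ - q or -X₀, and expanding the square gives the terms of `impactCost`. -/
lemma cost_eq (h : D.IndependenceAssumption M θ (Measure.dirac ⊤)) (hα : D.α = 0) (hκ : D.κ = 0)
    (hh : ∀ x, M.h x = η * x) {ω : Ω} (hR : D.Regular ω)
    (hω : IntervalIntegrable (fun s : ℝ => χ.ξ s.toNNReal ω) volume 0 T)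
    (hω2 : IntervalIntegrable (fun s : ℝ => χ.ξ s.toNNReal ω ^ 2) volume 0 T)
    (hL : X₀ + χ.traded T ω + D.Z χ.Xhat χ.Ξ (χ.ρ ω) ω = 0) :
    χ.cost M D X₀ T ω
      = ((priceCost M D X₀ T χ ω + impactCost M D η X₀ T χ ω : ℝ) : EReal) := by
  have hint := ((integrable_exchange (M := M) hω).add (hω2.const_mul η))
  have hT : (0 : ℝ) ≤ T := T.2
  rw [cost, sum_dark_cost h hα hκ hR, exchange_eq hh, extIntegral_coe
    ((intervalIntegrable_iff_integrableOn_Ioc_of_le hT).1 hint),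
    ← intervalIntegral.integral_of_le hT]
  rw [← EReal.coe_add, ← EReal.coe_add, ← EReal.coe_add]
  congr 1
  rw [hR.Z_eq] at hL
  have e1 : ∫ t in (0 : ℝ)..T, (χ.ξ t.toNNReal ω
          * (M.P0 t.toNNReal ω + M.γ * ∫ s in (0 : ℝ)..t, χ.ξ s.toNNReal ω)
            + η * χ.ξ t.toNNReal ω ^ 2)
      = (∫ t in (0 : ℝ)..T, χ.ξ t.toNNReal ω * M.P0 t.toNNReal ω)
        + M.γ * (χ.traded T ω ^ 2 / 2) + η * ∫ t in (0 : ℝ)..T, χ.ξ t.toNNReal ω ^ 2 := by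
    rw [intervalIntegral.integral_add (integrable_exchange hω) (hω2.const_mul η),
      intervalIntegral.integral_const_mul]
    congr 1
    have hc : ContinuousOn (fun t : ℝ => ∫ s in (0 : ℝ)..t, χ.ξ s.toNNReal ω) (uIcc 0 T) :=
      intervalIntegral.continuousOn_primitive_interval' hω left_mem_uIcc
    rw [traded, ← integral_mul_primitive hω, ← intervalIntegral.integral_const_mul,
      ← intervalIntegral.integral_add ((M.cadlag ω).intervalIntegrable_mul hω)
        ((hω.mul_continuousOn hc).const_mul _)]
    refine intervalIntegral.integral_congr fun t _ => ?_
    ring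
  rw [e1, hα, priceCost, impactCost]
  split_ifs at hL ⊢
  · have : χ.traded T ω = -X₀ - χ.Xhat := by linarith
    rw [this]
    ring
  · have : χ.traded T ω = -X₀ := by linarith
    rw [this]
    ring

/-- On one path P⁰ and the traded volume are bounded, so completing the square in ξ bounds the
integrand from below. Only its positive part can diverge, and it does when ξ² is not integrable. -/
lemma cost_eq_top (hη : 0 < η) (hh : ∀ x, M.h x = η * x) {ω : Ω}
    (hω : IntervalIntegrable (fun s : ℝ => χ.ξ s.toNNReal ω) volume 0 T)
    (hω2 : ¬ IntervalIntegrable (fun s : ℝ => χ.ξ s.toNNReal ω ^ 2) volume 0 T) :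
    χ.cost M D X₀ T ω = ⊤ := by
  have hT : (0 : ℝ) ≤ T := T.2
  have hint := (intervalIntegrable_iff_integrableOn_Ioc_of_le hT).1
    (integrable_exchange (M := M) hω)
  have hξ := (intervalIntegrable_iff_integrableOn_Ioc_of_le hT).1 hω
  rw [intervalIntegrable_iff_integrableOn_Ioc_of_le hT] at hω2
  obtain ⟨K, hK⟩ := (M.cadlag ω).exists_bound T
  have hc : ContinuousOn (fun t : ℝ => ∫ s in (0 : ℝ)..t, χ.ξ s.toNNReal ω) (uIcc 0 T) :=
    intervalIntegral.continuousOn_primitive_interval' hω left_mem_uIcc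
  obtain ⟨K', hK'⟩ := isCompact_uIcc.exists_bound_of_continuousOn hc
  have hneg : ∫⁻ t in Ioc (0 : ℝ) T, ENNReal.ofReal (-(χ.ξ t.toNNReal ω
          * (M.P0 t.toNNReal ω + M.γ * ∫ s in (0 : ℝ)..t, χ.ξ s.toNNReal ω)
            + η * χ.ξ t.toNNReal ω ^ 2)) ≠ ⊤ := by
    refine ne_top_of_le_ne_top (b := ∫⁻ t in Ioc (0 : ℝ) T,
      ENNReal.ofReal ((K + M.γ * K') ^ 2 / (4 * η))) (by
        rw [lintegral_const]
        exact ENNReal.mul_ne_top ENNReal.ofReal_ne_top (measure_ne_top _ _)) ?_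
    refine setLIntegral_mono' measurableSet_Ioc fun t ht => ENNReal.ofReal_le_ofReal ?_
    have h1 := hK t.toNNReal (Real.toNNReal_le_iff_le_coe.2 ht.2)
    have h2 := hK' t (by rw [uIcc_of_le hT]; exact ⟨ht.1.le, ht.2⟩)
    rw [Real.norm_eq_abs] at h2
    set x := χ.ξ t.toNNReal ω
    set a := M.P0 t.toNNReal ω + M.γ * ∫ s in (0 : ℝ)..t, χ.ξ s.toNNReal ω with ha
    have h3 : |a| ≤ K + M.γ * K' := by
      refine (abs_add_le _ _).trans (add_le_add h1 ?_)
      rw [abs_mul, abs_of_pos M.γ_pos]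
      exact mul_le_mul_of_nonneg_left h2 M.γ_pos.le
    have h4 : a ^ 2 ≤ (K + M.γ * K') ^ 2 :=
      sq_le_sq' (by linarith [neg_abs_le a]) ((le_abs_self a).trans h3)
    rw [le_div_iff₀ (by positivity)]
    nlinarith [sq_nonneg (a + 2 * η * x)]
  have htop : extIntegral (volume.restrict (Ioc (0 : ℝ) T))
        (fun t => ((χ.ξ t.toNNReal ω
          * (M.P0 t.toNNReal ω + M.γ * ∫ s in (0 : ℝ)..t, χ.ξ s.toNNReal ω)
            + η * χ.ξ t.toNNReal ω ^ 2 : ℝ) : EReal)) = ⊤ := by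
    refine extIntegral_eq_top ?_ (by rwa [lintegral_neg_coe_toENNReal])
    rw [lintegral_coe_toENNReal]
    by_contra hne
    have hi := integrable_of_lintegral_ofReal_ne_top
      (hint.1.add ((hξ.1.pow 2).const_mul η)) hne hneg
    refine hω2 ?_
    have := (hi.sub hint).const_mul η⁻¹
    refine this.congr (Eventually.of_forall fun t => ?_)
    simp only [Pi.sub_apply, Pi.add_apply, Pi.pow_apply]
    field_simp
    ring
  rw [cost, exchange_eq hh, htop, EReal.coe_add_top, EReal.top_add_coe, EReal.top_add_coe]

lemma IsAdmissible.measurableSet_integrable_sq (hχ : χ.IsAdmissible M D X₀ T) :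
    MeasurableSet {ω | ∫⁻ s in Ioc (0 : ℝ) T, ENNReal.ofReal (χ.ξ s.toNNReal ω ^ 2) = ⊤} := by
  have hm := (stronglyMeasurable_uncurry_of_predictable hχ.predictable).measurable
  have : Measurable fun ω => ∫⁻ s in Ioc (0 : ℝ) T, ENNReal.ofReal (χ.ξ s.toNNReal ω ^ 2) :=
    Measurable.lintegral_prod_left'
      (f := fun p : ℝ × Ω => ENNReal.ofReal (χ.ξ p.1.toNNReal p.2 ^ 2))
      (hm.pow_const 2).ennreal_ofReal
  exact this (measurableSet_singleton _)

end Strategy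

/-! ### The lower bound -/

lemma AlmgrenChrissModel.η_pos {Ω : Type*} [MeasurableSpace Ω] {P : Measure Ω}
    (M : AlmgrenChrissModel P) {η : ℝ} (hh : ∀ x, M.h x = η * x) : 0 < η := by
  have := M.isImpactFunction.strictMono (zero_lt_one' ℝ)
  rw [hh, hh] at this
  linarith

lemma intervalIntegrable_sq_iff {ξ : ℝ → ℝ} {T : ℝ≥0} (hξ : IntervalIntegrable ξ volume 0 T) :
    IntervalIntegrable (fun s => ξ s ^ 2) volume 0 T
      ↔ ∫⁻ s in Ioc (0 : ℝ) T, ENNReal.ofReal (ξ s ^ 2) ≠ ⊤ := by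
  rw [intervalIntegrable_iff_integrableOn_Ioc_of_le (NNReal.coe_nonneg T)] at hξ ⊢
  refine ⟨lintegral_ofReal_ne_top, fun h => integrable_of_lintegral_ofReal_ne_top (hξ.1.pow 2) h ?_⟩
  have e : ∀ s, ENNReal.ofReal (-ξ s ^ 2) = 0 := fun s =>
    ENNReal.ofReal_of_nonpos (neg_nonpos.2 (sq_nonneg (ξ s)))
  simp [e]

/-- Optimisation over the order size: the gap is a multiple of a square that vanishes at `Xhat` =
-2ηθX₀/(2ηθ - γ). When the minimum is 0 the right side is already nonnegative. -/
lemma quadratic_bound {γ η θ X₀ Xhat : ℝ} (hγ : 0 < γ) (hη : 0 < η) (h : γ < 2 * η * θ) :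
    -(γ ^ 2 / 2 * X₀ ^ 2 * (1 / (2 * η * θ - γ))) ≤ γ / 2 * X₀ ^ 2
      + min (γ * Xhat ^ 2 / 2 - γ ^ 2 * Xhat ^ 2 / (4 * η * θ) + γ * Xhat * X₀) 0 := by
  have hd : 0 < 2 * η * θ - γ := by linarith
  have hθ : 0 < η * θ := by nlinarith
  have h0 : 0 ≤ γ ^ 2 / 2 * X₀ ^ 2 * (1 / (2 * η * θ - γ)) := by positivity
  rcases le_total (γ * Xhat ^ 2 / 2 - γ ^ 2 * Xhat ^ 2 / (4 * η * θ) + γ * Xhat * X₀) 0 with h1 | h1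
  · rw [min_eq_left h1]
    have e : γ / 2 * X₀ ^ 2
      + (γ * Xhat ^ 2 / 2 - γ ^ 2 * Xhat ^ 2 / (4 * η * θ) + γ * Xhat * X₀)
      + γ ^ 2 / 2 * X₀ ^ 2 * (1 / (2 * η * θ - γ))
      = γ / (4 * (η * θ) * (2 * η * θ - γ)) * ((2 * η * θ - γ) * Xhat + 2 * η * θ * X₀) ^ 2 := by
      have hη' := hη.ne'
      have hθ' : θ ≠ 0 := by rintro rfl; simp at hθ
      field_simp
      ring
    have : 0 ≤ γ / (4 * (η * θ) * (2 * η * θ - γ))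
      * ((2 * η * θ - γ) * Xhat + 2 * η * θ * X₀) ^ 2 := by positivity
    linarith
  · rw [min_eq_right h1]
    have : 0 ≤ γ / 2 * X₀ ^ 2 := by positivity
    linarith

namespace Strategy

variable {Ω : Type*} [mΩ : MeasurableSpace Ω] {P : Measure Ω} [IsProbabilityMeasure P]
  {M : AlmgrenChrissModel P} {D : DarkPoolExtension Ω} {X₀ η : ℝ} {T : ℝ≥0} {χ : Strategy Ω}
  {θ : ℝ≥0}

lemma continuousOn_traded {ω : Ω}
    (hω : IntervalIntegrable (fun s : ℝ => χ.ξ s.toNNReal ω) volume 0 T) :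
    ContinuousOn (fun t => χ.traded t ω) (Iic T) := by
  have hc := intervalIntegral.continuousOn_primitive_interval' hω left_mem_uIcc
  refine hc.comp (f := fun t : ℝ≥0 => (t : ℝ)) NNReal.continuous_coe.continuousOn fun t ht => ?_
  simpa [uIcc_of_le (NNReal.coe_nonneg T)] using ht

lemma IsAdmissible.integral_at_arrival (hχ : χ.IsAdmissible M D X₀ T)
    (h : D.IndependenceAssumption M θ (Measure.dirac ⊤)) {k : ℝ → ℝ} (hk : Continuous k) :
    Integrable (fun ω => if D.τ 0 ω ≤ χ.ρ ω then k (X₀ + χ.traded (D.τ 0 ω) ω) else 0) P ∧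
    Integrable (fun ω => ∫ t in (0 : ℝ)..(min (D.τ 0 ω) (χ.ρ ω) : ℝ≥0),
      k (X₀ + ∫ u in (0 : ℝ)..t, χ.ξ u.toNNReal ω)) P ∧
    ∫ ω, (if D.τ 0 ω ≤ χ.ρ ω then k (X₀ + χ.traded (D.τ 0 ω) ω) else 0) ∂P
      = θ * ∫ ω, (∫ t in (0 : ℝ)..(min (D.τ 0 ω) (χ.ρ ω) : ℝ≥0),
        k (X₀ + ∫ u in (0 : ℝ)..t, χ.ξ u.toNNReal ω)) ∂P := by
  obtain ⟨C, hC⟩ := hχ.bounded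
  -- The compensator formula needs a bound for every ω, but the traded volume is bounded only almost
  -- surely; k is therefore composed with a clamp.
  set κ : ℝ → ℝ := fun y => k (X₀ + max (-|C|) (min |C| y)) with hκ
  have hκc : Continuous κ := by fun_prop
  obtain ⟨K, hK⟩ := (isCompact_Icc (a := -|C|) (b := |C|)).exists_bound_of_continuousOn
    (f := fun y => k (X₀ + y)) (by fun_prop)
  have hκK : ∀ y, |κ y| ≤ K := fun y => hK _ ⟨le_max_left _ _,
    max_le (neg_le_self (abs_nonneg C)) (min_le_left _ _)⟩
  have hκe : ∀ y, |y| ≤ C → κ y = k (X₀ + y) := by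
    intro y hy
    have h1 := abs_le.1 (hy.trans (le_abs_self C))
    rw [hκ]
    simp only
    rw [min_eq_right h1.2, max_eq_right h1.1]
  obtain ⟨h1, h2, h3⟩ := h.integral_at_arrival hχ.isStoppingTime hχ.ρ_lt
    (F := fun t ω => κ (χ.traded t ω))
    (fun t => hκc.comp_stronglyMeasurable (hχ.stronglyMeasurable_traded t))
    (fun t ω => hκK _)
    (hχ.integrable.mono fun ω hω => hκc.comp_continuousOn (continuousOn_traded hω))
  have e1 : (fun ω => if D.τ 0 ω ≤ χ.ρ ω then κ (χ.traded (D.τ 0 ω) ω) else 0)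
      =ᵐ[P] fun ω => if D.τ 0 ω ≤ χ.ρ ω then k (X₀ + χ.traded (D.τ 0 ω) ω) else 0 := by
    filter_upwards [hC, hχ.ρ_lt] with ω hω hρ
    split_ifs with hτ
    · exact hκe _ (hω _ (hτ.trans hρ.le))
    · rfl
  have e2 : (fun ω => ∫ t in (0 : ℝ)..(min (D.τ 0 ω) (χ.ρ ω) : ℝ≥0), κ (χ.traded t.toNNReal ω))
      =ᵐ[P] fun ω => ∫ t in (0 : ℝ)..(min (D.τ 0 ω) (χ.ρ ω) : ℝ≥0),
        k (X₀ + ∫ u in (0 : ℝ)..t, χ.ξ u.toNNReal ω) := by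
    filter_upwards [hC, hχ.ρ_lt] with ω hω hρ
    refine intervalIntegral.integral_congr fun t ht => ?_
    rw [uIcc_of_le (NNReal.coe_nonneg _)] at ht
    have htT : t.toNNReal ≤ T :=
      (Real.toNNReal_le_iff_le_coe.2 ht.2).trans ((min_le_right _ _).trans hρ.le)
    rw [hκe _ (hω _ htT), traded_toNNReal ht.1]
  rw [integral_congr_ae e1, integral_congr_ae e2] at h3
  exact ⟨h1.congr e1, h2.congr e2, h3⟩

/-- The verification inequality is applied up to τ ∧ ρ with G = θk, k = g - v. If τ ≤ ρ then v(X_τ)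
+ k(X_τ) is the dark-pool payoff g(X_τ); otherwise v ≤ 0 suffices. Trading costs after τ ∧ ρ are
dropped. The two k-terms cancel in expectation. -/
lemma impactCost_ge (hη : 0 < η) (hθ : 0 < θ) {ω : Ω} (hρ : χ.ρ ω < T)
    (hω : IntervalIntegrable (fun s : ℝ => χ.ξ s.toNNReal ω) volume 0 T)
    (hω2 : IntervalIntegrable (fun s : ℝ => χ.ξ s.toNNReal ω ^ 2) volume 0 T) {k : ℝ → ℝ}
    (hk : k = fun x => M.γ * χ.Xhat * x + M.γ * χ.Xhat ^ 2 / 2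
      - min (M.γ * χ.Xhat ^ 2 / 2 - M.γ ^ 2 * χ.Xhat ^ 2 / (4 * η * θ) + M.γ * χ.Xhat * x) 0) :
    M.γ / 2 * X₀ ^ 2
      + min (M.γ * χ.Xhat ^ 2 / 2 - M.γ ^ 2 * χ.Xhat ^ 2 / (4 * η * θ) + M.γ * χ.Xhat * X₀) 0
      + (if D.τ 0 ω ≤ χ.ρ ω then k (X₀ + χ.traded (D.τ 0 ω) ω) else 0)
      - θ * (∫ t in (0 : ℝ)..(min (D.τ 0 ω) (χ.ρ ω) : ℝ≥0),
        k (X₀ + ∫ u in (0 : ℝ)..t, χ.ξ u.toNNReal ω)) ≤ impactCost M D η X₀ T χ ω := by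
  have hθ' : (0 : ℝ) < θ := hθ
  set a := M.γ * χ.Xhat ^ 2 / 2 - M.γ ^ 2 * χ.Xhat ^ 2 / (4 * η * θ) with ha
  set b := M.γ * χ.Xhat with hb
  set t : ℝ≥0 := min (D.τ 0 ω) (χ.ρ ω) with ht
  have htT : t ≤ T := (min_le_right _ _).trans hρ.le
  have hsub : uIcc (0 : ℝ) t ⊆ uIcc (0 : ℝ) T := by
    rw [uIcc_of_le (NNReal.coe_nonneg t), uIcc_of_le (NNReal.coe_nonneg T)]
    exact Icc_subset_Icc_right htT
  have hkc : Continuous k := by rw [hk]; fun_prop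
  have hq : M.γ * χ.Xhat ^ 2 / 2 = a + b ^ 2 / (4 * η * θ) := by
    rw [ha, hb, mul_pow]; ring
  have hka : ∀ y, k y = a + b * y + b ^ 2 / (4 * η * θ) - min (a + b * y) 0 := by
    intro y
    rw [hk]
    simp only
    rw [hq]
    ring
  have key := min_affine_le_of_subsolution (a := a) (b := b) (x₀ := X₀) (t := t)
    (G := fun y => θ * k y) t.2 hη (hω.mono_set hsub) (hω2.mono_set hsub)
    (by fun_prop) (fun y hy => by
      rw [hka, min_eq_right hy]
      have : 0 ≤ b ^ 2 / (4 * η * θ) := by positivity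
      exact mul_nonneg hθ'.le (by linarith)) (fun y hy => by
      rw [hka, min_eq_left hy.le]
      have : 4 * η * (θ * (a + b * y + b ^ 2 / (4 * η * θ) - (a + b * y))) = b ^ 2 := by
        field_simp
        ring
      exact this.ge)
  have hI : ∫ s in (0 : ℝ)..t, (η * χ.ξ s.toNNReal ω ^ 2
        + θ * k (X₀ + ∫ u in (0 : ℝ)..s, χ.ξ u.toNNReal ω))
      = η * (∫ s in (0 : ℝ)..t, χ.ξ s.toNNReal ω ^ 2)
        + θ * ∫ s in (0 : ℝ)..t, k (X₀ + ∫ u in (0 : ℝ)..s, χ.ξ u.toNNReal ω) := by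
    rw [intervalIntegral.integral_add ((hω2.mono_set hsub).const_mul η),
      intervalIntegral.integral_const_mul, intervalIntegral.integral_const_mul]
    refine (ContinuousOn.intervalIntegrable ?_).const_mul _
    exact hkc.comp_continuousOn (continuousOn_const.add
      (intervalIntegral.continuousOn_primitive_interval' (hω.mono_set hsub) left_mem_uIcc))
  rw [hI] at key
  have hmono : ∫ s in (0 : ℝ)..t, χ.ξ s.toNNReal ω ^ 2
      ≤ ∫ s in (0 : ℝ)..T, χ.ξ s.toNNReal ω ^ 2 :=
    intervalIntegral.integral_mono_interval le_rfl t.2 htT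
      (Eventually.of_forall fun s => sq_nonneg _) hω2
  have hmono' := mul_le_mul_of_nonneg_left hmono hη.le
  rw [impactCost]
  by_cases hτ : D.τ 0 ω ≤ χ.ρ ω
  · have hte : t = D.τ 0 ω := min_eq_left hτ
    rw [if_pos hτ, if_pos hτ, hka, hq]
    rw [traded]
    rw [hte] at key hmono' ⊢
    linarith
  · rw [if_neg hτ, if_neg hτ]
    have := min_le_right (a + b * (X₀ + ∫ u in (0 : ℝ)..t, χ.ξ u.toNNReal ω)) 0
    linarith

lemma IsAdmissible.le_integral_impactCost (hχ : χ.IsAdmissible M D X₀ T)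
    (h : D.IndependenceAssumption M θ (Measure.dirac ⊤)) (hη : 0 < η) (hγ : M.γ < 2 * η * θ)
    (h2 : ∀ᵐ ω ∂P, IntervalIntegrable (fun s : ℝ => χ.ξ s.toNNReal ω ^ 2) volume 0 T)
    (hint : Integrable (impactCost M D η X₀ T χ) P) :
    -(M.γ ^ 2 / 2 * X₀ ^ 2 * (1 / (2 * η * θ - M.γ))) ≤ ∫ ω, impactCost M D η X₀ T χ ω ∂P := by
  refine (quadratic_bound (Xhat := χ.Xhat) M.γ_pos hη hγ).trans ?_
  obtain ⟨i1, i2, i3⟩ := hχ.integral_at_arrival h (k := fun x => M.γ * χ.Xhat * x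
    + M.γ * χ.Xhat ^ 2 / 2
      - min (M.γ * χ.Xhat ^ 2 / 2 - M.γ ^ 2 * χ.Xhat ^ 2 / (4 * η * θ) + M.γ * χ.Xhat * x) 0)
    (by fun_prop)
  have := integral_mono_ae (((integrable_const (M.γ / 2 * X₀ ^ 2
      + min (M.γ * χ.Xhat ^ 2 / 2 - M.γ ^ 2 * χ.Xhat ^ 2 / (4 * η * θ) + M.γ * χ.Xhat * X₀) 0)).add
      i1).sub (i2.const_mul (θ : ℝ))) hint (by
    filter_upwards [hχ.ρ_lt, hχ.integrable, h2] with ω ω1 ω2 ω3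
    exact impactCost_ge hη h.θ_pos ω1 ω2 ω3 rfl)
  rw [integral_sub' ((integrable_const _).add i1) (i2.const_mul _),
    integral_add' (integrable_const _) i1, integral_const_mul, i3, integral_const] at this
  simpa using this

lemma IsAdmissible.aestronglyMeasurable_priceCost (hχ : χ.IsAdmissible M D X₀ T) :
    AEStronglyMeasurable (priceCost M D X₀ T χ) P := by
  refine aestronglyMeasurable_of_tendsto_ae atTop (f := fun n => discreteCost M D X₀ T χ n)
    (fun n => ?_) ?_
  · have hP : ∀ t, StronglyMeasurable (M.P0 t) := fun t => (M.martingale.1 t).mono (M.𝓕.le t)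
    have hB : ∀ t, StronglyMeasurable (position D X₀ χ t) := fun t =>
      (hχ.stronglyMeasurable_position t).mono ((D.𝓖 M χ.Xhat χ.Ξ).le t)
    have : StronglyMeasurable fun ω => discreteCost M D X₀ T χ n ω :=
      ((hP 0).const_mul X₀).add
        (Finset.stronglyMeasurable_fun_sum _ fun k _ => (hP _).mul ((hB _).sub (hB _)))
    exact this.aestronglyMeasurable
  · filter_upwards [hχ.integrable, hχ.ρ_lt] with ω h1 h2
    exact tendsto_discreteCost h1 h2

lemma IsAdmissible.aestronglyMeasurable_impactCost (hχ : χ.IsAdmissible M D X₀ T)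
    (h : D.IndependenceAssumption M θ (Measure.dirac ⊤)) :
    AEStronglyMeasurable (impactCost M D η X₀ T χ) P := by
  obtain ⟨i1, -, -⟩ := hχ.integral_at_arrival h
    (k := fun x => M.γ * χ.Xhat * x + M.γ * χ.Xhat ^ 2 / 2) (by fun_prop)
  have hm : StronglyMeasurable fun p : ℝ × Ω => χ.ξ p.1.toNNReal p.2 ^ 2 :=
    (stronglyMeasurable_uncurry_of_predictable hχ.predictable).pow 2
  have h1 : StronglyMeasurable fun ω => ∫ s in (0 : ℝ)..T, χ.ξ s.toNNReal ω ^ 2 := by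
    simp only [intervalIntegral.integral_of_le (NNReal.coe_nonneg T)]
    exact hm.integral_prod_left'
  exact (stronglyMeasurable_const.add (h1.const_mul η)).aestronglyMeasurable.add i1.1

lemma IsAdmissible.exists_le_impactCost (hχ : χ.IsAdmissible M D X₀ T) (hη : 0 < η) :
    ∃ c : ℝ, 0 ≤ c ∧ ∀ᵐ ω ∂P, -c ≤ impactCost M D η X₀ T χ ω := by
  obtain ⟨C, hC⟩ := hχ.bounded
  refine ⟨|M.γ * χ.Xhat| * (|X₀| + |C|), by positivity, ?_⟩
  filter_upwards [hC, hχ.ρ_lt] with ω h1 h2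
  have h3 : 0 ≤ M.γ / 2 * X₀ ^ 2 := by have := M.γ_pos; positivity
  have h4 : 0 ≤ η * ∫ t in (0 : ℝ)..T, χ.ξ t.toNNReal ω ^ 2 :=
    mul_nonneg hη.le (intervalIntegral.integral_nonneg T.2 fun t _ => sq_nonneg _)
  have h5 : 0 ≤ |M.γ * χ.Xhat| * (|X₀| + |C|) := by positivity
  rw [impactCost]
  split_ifs with hτ
  · have h6 : 0 ≤ M.γ * χ.Xhat ^ 2 / 2 := by have := M.γ_pos; positivity
    have h7 : |X₀ + χ.traded (D.τ 0 ω) ω| ≤ |X₀| + |C| :=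
      (abs_add_le _ _).trans (add_le_add le_rfl
        ((h1 _ (hτ.trans h2.le)).trans (le_abs_self C)))
    have h8 := neg_abs_le (M.γ * χ.Xhat * (X₀ + χ.traded (D.τ 0 ω) ω))
    rw [abs_mul] at h8
    have h9 := mul_le_mul_of_nonneg_left h7 (abs_nonneg (M.γ * χ.Xhat))
    linarith
  · linarith

lemma IsAdmissible.cost_ae_eq (hχ : χ.IsAdmissible M D X₀ T)
    (h : D.IndependenceAssumption M θ (Measure.dirac ⊤)) (hα : D.α = 0) (hκ : D.κ = 0)
    (hh : ∀ x, M.h x = η * x)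
    (h2 : ∀ᵐ ω ∂P, IntervalIntegrable (fun s : ℝ => χ.ξ s.toNNReal ω ^ 2) volume 0 T) :
    χ.cost M D X₀ T =ᵐ[P] fun ω =>
      ((priceCost M D X₀ T χ ω + impactCost M D η X₀ T χ ω : ℝ) : EReal) := by
  filter_upwards [hχ.integrable, h2, hχ.liquidation, h.ae_regular] with ω ω1 ω2 ω3 ω4
  exact cost_eq h hα hκ hh ω4 ω1 ω2 ω3

/-- The expected costs of an admissible strategy are bounded from below, for every horizon. -/
theorem IsAdmissible.le_extIntegral_cost (hχ : χ.IsAdmissible M D X₀ T)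
    (h : D.IndependenceAssumption M θ (Measure.dirac ⊤)) (hα : D.α = 0) (hκ : D.κ = 0)
    (hh : ∀ x, M.h x = η * x) (hγ : M.γ < 2 * η * θ)
    (hext : HasExtIntegral P (χ.cost M D X₀ T)) :
    ((-(M.γ ^ 2 / 2 * X₀ ^ 2 * (1 / (2 * η * θ - M.γ))) : ℝ) : EReal)
      ≤ extIntegral P (χ.cost M D X₀ T) := by
  have hη := M.η_pos hh
  by_cases hpos : ∫⁻ ω, (χ.cost M D X₀ T ω).toENNReal ∂P = ⊤
  · rw [extIntegral_eq_top hpos (hext.resolve_left (not_not.2 hpos))]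
    exact le_top
  -- Otherwise the costs would be +∞ with positive probability, contradicting the finite integral of
  -- their positive part.
  have h2 : ∀ᵐ ω ∂P, IntervalIntegrable (fun s : ℝ => χ.ξ s.toNNReal ω ^ 2) volume 0 T := by
    set A := {ω | ∫⁻ s in Ioc (0 : ℝ) T, ENNReal.ofReal (χ.ξ s.toNNReal ω ^ 2) = ⊤} with hA
    have hPA : P A = 0 := by
      by_contra hne
      refine hpos (top_unique ?_)
      calc (⊤ : ℝ≥0∞) = ∫⁻ ω, A.indicator (fun _ => ⊤) ω ∂P := by
            rw [lintegral_indicator hχ.measurableSet_integrable_sq, setLIntegral_const,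
              ENNReal.top_mul hne]
        _ ≤ _ := lintegral_mono_ae ?_
      filter_upwards [hχ.integrable] with ω hω
      by_cases hωA : ω ∈ A
      · rw [cost_eq_top hη hh hω (by rw [intervalIntegrable_sq_iff hω]; exact not_not.2 hωA)]
        simp
      · simp [hωA]
    filter_upwards [hχ.integrable, measure_eq_zero_iff_ae_notMem.1 hPA] with ω hω hωA
    exact (intervalIntegrable_sq_iff hω).2 hωA
  have he := hχ.cost_ae_eq h hα hκ hh h2
  set R : Ω → ℝ := fun ω => priceCost M D X₀ T χ ω + impactCost M D η X₀ T χ ω with hR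
  have hRm : AEStronglyMeasurable R P :=
    hχ.aestronglyMeasurable_priceCost.add (hχ.aestronglyMeasurable_impactCost h)
  have hRpos : ∫⁻ ω, ENNReal.ofReal (R ω) ∂P ≠ ⊤ := by
    rw [← lintegral_coe_toENNReal, ← lintegral_congr_ae (he.mono fun ω hω => congrArg _ hω)]
    exact hpos
  have hRp : Integrable (fun ω => max (R ω) 0) P := by
    refine integrable_of_lintegral_ofReal_ne_top (hRm.sup aestronglyMeasurable_const) ?_ ?_
    · simpa [ENNReal.ofReal_max] using hRpos
    · have : ∀ ω, ENNReal.ofReal (-max (R ω) 0) = 0 := fun ω =>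
        ENNReal.ofReal_of_nonpos (neg_nonpos.2 (le_max_right _ _))
      simp [this]
  obtain ⟨c, hc0, hc⟩ := hχ.exists_le_impactCost (η := η) (D := D) (M := M) hη
  -- As the impact costs are at least -c, the price costs are at most R⁺ + c. This is the one-sided
  -- domination that the transform theorem needs.
  obtain ⟨hL, hL0⟩ := hχ.integrable_priceCost h (hRp.add (integrable_const c)) (by
    filter_upwards [hc] with ω hω
    have := le_max_left (R ω) 0
    simp only [hR, Pi.add_apply] at this ⊢
    linarith)
  have hRi : Integrable R P := by
    refine Integrable.mono' ((hL.abs.add (integrable_const c)).add hRp) hRm ?_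
    filter_upwards [hc] with ω hω
    have h1 := le_max_left (R ω) 0
    have h2 := le_max_right (R ω) 0
    have h3 := neg_abs_le (priceCost M D X₀ T χ ω)
    have h4 := abs_nonneg (priceCost M D X₀ T χ ω)
    simp only [Pi.add_apply, Real.norm_eq_abs]
    rw [abs_le]
    constructor
    · have : R ω = priceCost M D X₀ T χ ω + impactCost M D η X₀ T χ ω := rfl
      linarith
    · linarith
  have hQ : Integrable (impactCost M D η X₀ T χ) P :=
    (hRi.sub hL).congr (Eventually.of_forall fun ω => by simp [hR])
  rw [extIntegral_congr he, extIntegral_coe hRi, EReal.coe_le_coe_iff, integral_add hL hQ]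
  have := hχ.le_integral_impactCost h hη hγ h2 hQ
  linarith

end Strategy

/-! ### Strategies with bounded trading speed -/

section Fatou

variable {Ω : Type*} [mΩ : MeasurableSpace Ω] {P : Measure Ω}

lemma integrable_of_tendsto_of_integral_abs_le {G : ℕ → Ω → ℝ} {f : Ω → ℝ} {B : ℝ}
    (hG : ∀ n, Integrable (G n) P)
    (hGf : ∀ᵐ ω ∂P, Tendsto (fun n => G n ω) atTop (𝓝 (f ω)))
    (hB : ∀ n, ∫ ω, |G n ω| ∂P ≤ B) : Integrable f P := by
  refine ⟨aestronglyMeasurable_of_tendsto_ae atTop (fun n => (hG n).1) hGf,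
    hasFiniteIntegral_iff_enorm.2 ?_⟩
  calc ∫⁻ ω, ‖f ω‖ₑ ∂P = ∫⁻ ω, liminf (fun n => ‖G n ω‖ₑ) atTop ∂P :=
        lintegral_congr_ae (hGf.mono fun ω hω => hω.enorm.liminf_eq.symm)
    _ ≤ liminf (fun n => ∫⁻ ω, ‖G n ω‖ₑ ∂P) atTop :=
        lintegral_liminf_le' fun n => (hG n).1.aemeasurable.enorm
    _ ≤ ENNReal.ofReal B := by
        refine liminf_le_of_le (by isBoundedDefault) fun b hb => ?_
        obtain ⟨n, hn⟩ := hb.exists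
        refine hn.trans ?_
        rw [← ofReal_integral_norm_eq_lintegral_enorm (hG n)]
        exact ENNReal.ofReal_le_ofReal (hB n)
    _ < ⊤ := ENNReal.ofReal_lt_top

/-- The submartingale property of |X| with a nonnegative 𝓖_s-measurable weight, obtained by testing
X with the sign of X_s. -/
lemma integral_abs_mul_le_of_martingale [IsProbabilityMeasure P] {𝓖 : Filtration ℝ≥0 mΩ}
    {X : ℝ≥0 → Ω → ℝ} (hX : Martingale X 𝓖 P) {s t : ℝ≥0} (hst : s ≤ t) {Z : Ω → ℝ}
    (hZ : StronglyMeasurable[𝓖 s] Z) (hZ0 : ∀ ω, 0 ≤ Z ω) {C : ℝ} (hZC : ∀ ω, Z ω ≤ C) :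
    (∀ r, Integrable (fun ω => |X r ω| * Z ω) P) ∧
    ∫ ω, |X s ω| * Z ω ∂P ≤ ∫ ω, |X t ω| * Z ω ∂P := by
  have hZabs : ∀ ω, |Z ω| ≤ C := fun ω => by rw [abs_of_nonneg (hZ0 ω)]; exact hZC ω
  have hZm := (hZ.mono (𝓖.le s)).aestronglyMeasurable (μ := P)
  have hi : ∀ r, Integrable (fun ω => |X r ω| * Z ω) P := fun r =>
    (hX.integrable r).abs.mul_bdd hZm (Eventually.of_forall hZabs)
  refine ⟨hi, ?_⟩
  set σ : Ω → ℝ := fun ω => if 0 ≤ X s ω then 1 else -1 with hσ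
  have hσm : StronglyMeasurable[𝓖 s] σ :=
    StronglyMeasurable.ite ((hX.1 s).measurable measurableSet_Ici) stronglyMeasurable_const
      stronglyMeasurable_const
  have hσ1 : ∀ ω, |σ ω| = 1 := fun ω => by
    rw [hσ]; simp only; split_ifs <;> simp
  have hσX : ∀ ω, σ ω * X s ω = |X s ω| := fun ω => by
    rw [hσ]; simp only; split_ifs with h
    · rw [abs_of_nonneg h, one_mul]
    · rw [abs_of_neg (not_le.1 h)]; ring
  have hφ : ∀ ω, |σ ω * Z ω| ≤ C := fun ω => by rw [abs_mul, hσ1, one_mul]; exact hZabs ω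
  have h0 := integral_mul_increment_eq_zero hX hst (hσm.mul hZ) hφ
  have hφm : AEStronglyMeasurable (fun ω => σ ω * Z ω) P :=
    ((hσm.mul hZ).mono (𝓖.le s)).aestronglyMeasurable
  have hit : Integrable (fun ω => σ ω * Z ω * X t ω) P :=
    (hX.integrable t).bdd_mul hφm (Eventually.of_forall hφ)
  have e : ∫ ω, |X s ω| * Z ω ∂P = ∫ ω, σ ω * Z ω * X t ω ∂P := by
    have : ∀ ω, (σ * Z) ω * (X t ω - X s ω) = σ ω * Z ω * X t ω - |X s ω| * Z ω := fun ω => by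
      rw [← hσX, Pi.mul_apply]; ring
    simp_rw [this] at h0
    rw [integral_sub hit (hi s)] at h0
    linarith
  rw [e]
  refine integral_mono hit (hi t) fun ω => ?_
  calc σ ω * Z ω * X t ω ≤ |σ ω * Z ω * X t ω| := le_abs_self _
    _ = |X t ω| * Z ω := by rw [abs_mul, abs_mul, hσ1, abs_of_nonneg (hZ0 ω)]; ring

end Fatou

namespace Strategy

variable {Ω : Type*} [mΩ : MeasurableSpace Ω] {P : Measure Ω} [IsProbabilityMeasure P]
  {M : AlmgrenChrissModel P} {D : DarkPoolExtension Ω} {X₀ η : ℝ} {T : ℝ≥0} {χ : Strategy Ω}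
  {θ : ℝ≥0} {K : ℝ}

lemma aestronglyMeasurable_of_predictable
    (hχ : IsStronglyPredictable (D.𝓖 M χ.Xhat χ.Ξ) χ.ξ) (ω : Ω) (ν : Measure ℝ) :
    AEStronglyMeasurable (fun s : ℝ => χ.ξ s.toNNReal ω) ν :=
  ((stronglyMeasurable_uncurry_of_predictable hχ).comp_measurable
    (measurable_id.prodMk measurable_const : Measurable fun s : ℝ => (s, ω))).aestronglyMeasurable

lemma intervalIntegrable_of_bounded
    (hχ : IsStronglyPredictable (D.𝓖 M χ.Xhat χ.Ξ) χ.ξ) (hK : ∀ s ω, |χ.ξ s ω| ≤ K) (ω : Ω)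
    (a b : ℝ) : IntervalIntegrable (fun s : ℝ => χ.ξ s.toNNReal ω) volume a b :=
  intervalIntegrable_const.mono_fun' (aestronglyMeasurable_of_predictable hχ ω _)
    (Eventually.of_forall fun _ => hK _ ω)

lemma intervalIntegrable_sq_of_bounded
    (hχ : IsStronglyPredictable (D.𝓖 M χ.Xhat χ.Ξ) χ.ξ) (hK : ∀ s ω, |χ.ξ s ω| ≤ K) (ω : Ω)
    (a b : ℝ) : IntervalIntegrable (fun s : ℝ => χ.ξ s.toNNReal ω ^ 2) volume a b :=
  (intervalIntegrable_const (c := K ^ 2)).mono_fun'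
    ((aestronglyMeasurable_of_predictable hχ ω _).pow 2) (Eventually.of_forall fun s => by
      simp only [Real.norm_eq_abs, abs_pow]
      exact pow_le_pow_left₀ (abs_nonneg _) (hK _ ω) 2)

/-- The supremum of |P⁰| need not be integrable, so it is not used as a majorant. Each cell
contributes at most |P⁰_{t_{k+1}}| Z_k, where Z_k bounds the variation of the position and is known
at t_{k+1}. The submartingale property replaces |P⁰_{t_{k+1}}| by |P⁰_T|, and ∑ Z_k ≤ KT + |q|.
Fatou concludes. -/
theorem IsAdmissible.integrable_priceCost_of_bounded (hχ : χ.IsAdmissible M D X₀ T)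
    (h : D.IndependenceAssumption M θ (Measure.dirac ⊤)) (hK : ∀ s ω, |χ.ξ s ω| ≤ K) :
    Integrable (priceCost M D X₀ T χ) P := by
  have hK0 : 0 ≤ K := by
    obtain ⟨ω, -⟩ := hχ.ρ_lt.exists
    exact (abs_nonneg _).trans (hK 0 ω)
  have hMart := h.martingale χ.Xhat χ.Ξ
  set Z : ℕ → ℕ → Ω → ℝ := fun n k ω => K * ((grid T n (k + 1) : ℝ) - grid T n k)
    + if grid T n k < D.τ 0 ω ∧ D.τ 0 ω ≤ grid T n (k + 1) then |χ.Xhat| else 0 with hZdef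
  have hmono : ∀ n k, (grid T n k : ℝ) ≤ grid T n (k + 1) := fun n k =>
    NNReal.coe_le_coe.2 (monotone_grid T n k.le_succ)
  have hZ0 : ∀ n k ω, 0 ≤ Z n k ω := fun n k ω =>
    add_nonneg (mul_nonneg hK0 (sub_nonneg.2 (hmono n k))) (by split_ifs <;> positivity)
  have hZC : ∀ n k ω, Z n k ω ≤ K * ((grid T n (k + 1) : ℝ) - grid T n k) + |χ.Xhat| :=
    fun n k ω => add_le_add le_rfl (by split_ifs <;> simp)
  have hZm : ∀ n k, StronglyMeasurable[D.𝓖 M χ.Xhat χ.Ξ (grid T n (k + 1))] (Z n k) := by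
    intro n k
    refine stronglyMeasurable_const.add
      (StronglyMeasurable.ite ?_ stronglyMeasurable_const stronglyMeasurable_const)
    have e : {ω | grid T n k < D.τ 0 ω ∧ D.τ 0 ω ≤ grid T n (k + 1)}
        = {ω | D.τ 0 ω ≤ grid T n k}ᶜ ∩ {ω | D.τ 0 ω ≤ grid T n (k + 1)} := by
      ext ω
      simp
    rw [e]
    exact ((D.𝓖 M χ.Xhat χ.Ξ).mono (monotone_grid T n k.le_succ) _
      (DarkPoolExtension.measurableSet_τ_le M χ.Xhat χ.Ξ _)).compl.inter
      (DarkPoolExtension.measurableSet_τ_le M χ.Xhat χ.Ξ _)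
  have hZsum : ∀ n ω, ∑ k ∈ Finset.range (n + 1), Z n k ω ≤ K * T + |χ.Xhat| := by
    intro n ω
    rw [hZdef]
    simp only
    rw [Finset.sum_add_distrib, ← Finset.mul_sum,
      Finset.sum_range_sub (fun k => (grid T n k : ℝ)), grid_last, grid_zero,
      sum_indicator_grid n (D.τ_pos ω) (fun _ => |χ.Xhat|), NNReal.coe_zero, sub_zero]
    refine add_le_add le_rfl ?_
    split_ifs <;> simp
  have hbound : ∀ n ω, |discreteCost M D X₀ T χ n ω|
      ≤ |X₀ * M.P0 0 ω| + ∑ k ∈ Finset.range (n + 1), |M.P0 (grid T n (k + 1)) ω| * Z n k ω := by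
    intro n ω
    refine (abs_add_le _ _).trans (add_le_add le_rfl
      ((Finset.abs_sum_le_sum_abs _ _).trans (Finset.sum_le_sum fun k hk => ?_)))
    rw [abs_mul, position_sub_position (intervalIntegrable_of_bounded hχ.predictable hK ω 0 T)
      (Finset.mem_range.1 hk)]
    refine mul_le_mul_of_nonneg_left ((abs_add_le _ _).trans (add_le_add ?_ ?_)) (abs_nonneg _)
    · have := intervalIntegral.norm_integral_le_of_norm_le_const (a := (grid T n k : ℝ))
        (b := grid T n (k + 1)) (f := fun r : ℝ => χ.ξ r.toNNReal ω) (C := K)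
        (fun r _ => hK _ ω)
      rwa [abs_of_nonneg (sub_nonneg.2 (hmono n k))] at this
    · split_ifs <;> simp
  have hk := fun n k (hk : k ∈ Finset.range (n + 1)) => integral_abs_mul_le_of_martingale hMart
    (grid_le (T := T) (Finset.mem_range.1 hk : k + 1 ≤ n + 1)) (hZm n k) (hZ0 n k) (hZC n k)
  have hdom : ∀ n, Integrable (fun ω => |X₀ * M.P0 0 ω|
      + ∑ k ∈ Finset.range (n + 1), |M.P0 (grid T n (k + 1)) ω| * Z n k ω) P := fun n =>
    ((hMart.integrable 0).const_mul X₀).abs.add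
      (integrable_finsetSum _ fun k hk' => (hk n k hk').1 _)
  have hPm : ∀ t, StronglyMeasurable (M.P0 t) := fun t => (M.martingale.1 t).mono (M.𝓕.le t)
  have hBm : ∀ t, StronglyMeasurable (position D X₀ χ t) := fun t =>
    (hχ.stronglyMeasurable_position t).mono ((D.𝓖 M χ.Xhat χ.Ξ).le t)
  have hdm : ∀ n, StronglyMeasurable fun ω => discreteCost M D X₀ T χ n ω := fun n =>
    ((hPm 0).const_mul X₀).add
      (Finset.stronglyMeasurable_fun_sum _ fun k _ => (hPm _).mul ((hBm _).sub (hBm _)))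
  have hdi : ∀ n, Integrable (fun ω => discreteCost M D X₀ T χ n ω) P := fun n =>
    (hdom n).mono' (hdm n).aestronglyMeasurable (Eventually.of_forall (hbound n))
  refine integrable_of_tendsto_of_integral_abs_le hdi
    (B := ∫ ω, |X₀ * M.P0 0 ω| ∂P + (K * T + |χ.Xhat|) * ∫ ω, |M.P0 T ω| ∂P) ?_ fun n => ?_
  · filter_upwards [hχ.integrable, hχ.ρ_lt] with ω h1 h2
    exact tendsto_discreteCost h1 h2
  refine (integral_mono (hdi n).abs (hdom n) (hbound n)).trans ?_
  rw [integral_add ((hMart.integrable 0).const_mul X₀).abs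
    (integrable_finsetSum _ fun k hk' => (hk n k hk').1 _),
    integral_finsetSum _ fun k hk' => (hk n k hk').1 _]
  refine add_le_add le_rfl ((Finset.sum_le_sum fun k hk' => (hk n k hk').2).trans ?_)
  rw [← integral_finsetSum _ fun k hk' => (hk n k hk').1 _, ← integral_const_mul]
  refine integral_mono (integrable_finsetSum _ fun k hk' => (hk n k hk').1 _)
    ((hMart.integrable T).abs.const_mul _) fun ω => ?_
  simp only
  rw [← Finset.mul_sum, mul_comm]
  exact mul_le_mul_of_nonneg_right (hZsum n ω) (abs_nonneg _)

end Strategy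

/-! ### Trading at constant speed until the first arrival -/

lemma integral_of_three_steps {f : ℝ → ℝ} {a b m S T : ℝ} (hm : 0 ≤ m) (hmS : m ≤ S) (hST : S ≤ T)
    (h1 : ∀ t ∈ Ioc 0 m, f t = a) (h2 : ∀ t ∈ Ioc m S, f t = 0) (h3 : ∀ t ∈ Ioc S T, f t = b) :
    ∫ t in (0 : ℝ)..T, f t = a * m + b * (T - S) := by
  rw [intervalIntegral.integral_of_le (hm.trans (hmS.trans hST))]
  have e : ∀ t ∈ Ioc 0 T, f t
      = (Ioc 0 m).indicator (fun _ => a) t + (Ioc S T).indicator (fun _ => b) t := by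
    intro t ht
    rcases le_or_gt t m with htm | htm
    · rw [h1 t ⟨ht.1, htm⟩, indicator_of_mem (show t ∈ Ioc 0 m from ⟨ht.1, htm⟩),
        indicator_of_notMem fun h => absurd h.1 (not_lt.2 (htm.trans hmS)), add_zero]
    · rw [indicator_of_notMem fun h => absurd h.2 (not_le.2 htm), zero_add]
      rcases le_or_gt t S with htS | htS
      · rw [h2 t ⟨htm, htS⟩, indicator_of_notMem fun h => absurd h.1 (not_lt.2 htS)]
      · rw [h3 t ⟨htS, ht.2⟩, indicator_of_mem (show t ∈ Ioc S T from ⟨htS, ht.2⟩)]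
  rw [setIntegral_congr_fun measurableSet_Ioc e, integral_add
    ((integrable_const a).indicator measurableSet_Ioc)
    ((integrable_const b).indicator measurableSet_Ioc), setIntegral_indicator measurableSet_Ioc,
    setIntegral_indicator measurableSet_Ioc,
    inter_eq_right.2 (Ioc_subset_Ioc_right (hmS.trans hST)),
    inter_eq_right.2 (Ioc_subset_Ioc_left (hm.trans hmS)), setIntegral_const, setIntegral_const,
    Real.volume_real_Ioc_of_le hm, Real.volume_real_Ioc_of_le hST, smul_eq_mul, smul_eq_mul]
  ring

variable {Ω : Type*} [mΩ : MeasurableSpace Ω] {P : Measure Ω} [IsProbabilityMeasure P]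
  {M : AlmgrenChrissModel P} {D : DarkPoolExtension Ω} {X₀ η q c : ℝ} {S T : ℝ≥0}
  {θ : ℝ≥0}

namespace DarkPoolExtension

/-- The position at time `S` after trading at speed `c` until the first arrival, with a dark-pool
order of size `q`. -/
noncomputable def residual (D : DarkPoolExtension Ω) (X₀ q c : ℝ) (S : ℝ≥0) (ω : Ω) : ℝ :=
  X₀ + c * (min (D.τ 0 ω) S : ℝ≥0) + if D.τ 0 ω ≤ S then q else 0

/-- Trade at speed `c` until the first arrival or time `S`, cancel the dark-pool order `q` at
time `S`, and liquidate the remaining position at constant speed on `(S, T]`. -/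
noncomputable def arrivalStrategy (D : DarkPoolExtension Ω) (X₀ q c : ℝ) (S T : ℝ≥0) :
    Strategy Ω where
  Xhat := q
  Ξ := 0
  ξ t ω := if t ≤ S then (if t ≤ D.τ 0 ω then c else 0) else -D.residual X₀ q c S ω / (T - S)
  ρ _ := S

/-- The complement {τ < t} is a countable union of the predictable rectangles (r, ∞) × {τ ≤ r} with
r rational. -/
lemma measurableSet_predictable_le_τ (M : AlmgrenChrissModel P) (Xhat Ξ : ℝ) :
    MeasurableSet[(D.𝓖 M Xhat Ξ).predictable] {p : ℝ≥0 × Ω | p.1 ≤ D.τ 0 p.2} := by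
  have e : {p : ℝ≥0 × Ω | p.1 ≤ D.τ 0 p.2}
      = (⋃ r : ℚ, Ioi (r : ℝ).toNNReal ×ˢ {ω | D.τ 0 ω ≤ (r : ℝ).toNNReal})ᶜ := by
    ext ⟨t, ω⟩
    simp only [mem_ofPred_eq, mem_compl_iff, mem_iUnion, mem_prod, mem_Ioi, not_exists, not_and]
    constructor
    · intro h r hr
      exact not_le.2 (hr.trans_le h)
    · intro h
      by_contra hlt
      obtain ⟨r, hr0, hr1⟩ := exists_rat_btwn (NNReal.coe_lt_coe.2 (not_le.1 hlt))
      have hrc : ((r : ℝ).toNNReal : ℝ) = r :=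
        Real.coe_toNNReal _ ((NNReal.coe_nonneg _).trans hr0.le)
      refine h r ?_ ?_
      · rw [← NNReal.coe_lt_coe, hrc]; exact hr1
      · rw [← NNReal.coe_le_coe, hrc]; exact hr0.le
  rw [e]
  exact (MeasurableSet.iUnion fun r => measurableSet_predictable_Ioi_prod
    (measurableSet_τ_le M Xhat Ξ _)).compl

lemma measurable_residual (M : AlmgrenChrissModel P) (Xhat Ξ : ℝ) (X₀ q c : ℝ) (S : ℝ≥0) :
    Measurable[D.𝓖 M Xhat Ξ S] (D.residual X₀ q c S) := by
  have h1 : Measurable[D.𝓖 M Xhat Ξ S] fun ω => min (D.τ 0 ω) S := by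
    refine measurable_of_Iic fun x => ?_
    rcases le_or_gt S x with h | h
    · have : (fun ω => min (D.τ 0 ω) S) ⁻¹' Iic x = univ := by
        ext ω
        simp [h]
      rw [this]
      exact MeasurableSet.univ
    · have : (fun ω => min (D.τ 0 ω) S) ⁻¹' Iic x = {ω | D.τ 0 ω ≤ x} := by
        ext ω
        simp [not_le.2 h]
      rw [this]
      exact (D.𝓖 M Xhat Ξ).mono h.le _ (measurableSet_τ_le M Xhat Ξ x)
  exact (measurable_const.add (measurable_const.mul (measurable_coe_nnreal_real.comp h1))).add
    (Measurable.ite (measurableSet_τ_le M Xhat Ξ S) measurable_const measurable_const)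

lemma arrivalStrategy_predictable (M : AlmgrenChrissModel P) (Xhat Ξ : ℝ) :
    IsStronglyPredictable (D.𝓖 M Xhat Ξ) (D.arrivalStrategy X₀ q c S T).ξ := by
  let : MeasurableSpace (ℝ≥0 × Ω) := (D.𝓖 M Xhat Ξ).predictable
  refine Measurable.stronglyMeasurable ?_
  have hS : MeasurableSet[(D.𝓖 M Xhat Ξ).predictable] {p : ℝ≥0 × Ω | p.1 ≤ S} := by
    have e : {p : ℝ≥0 × Ω | p.1 ≤ S} = (Ioi S ×ˢ univ)ᶜ := by
      ext p
      simp
    rw [e]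
    exact (measurableSet_predictable_Ioi_prod MeasurableSet.univ).compl
  have hg : Measurable fun p : ℝ≥0 × Ω => if p.1 ≤ D.τ 0 p.2 then c else 0 :=
    Measurable.ite (measurableSet_predictable_le_τ M Xhat Ξ) measurable_const measurable_const
  intro B hB
  have e : (Function.uncurry (D.arrivalStrategy X₀ q c S T).ξ) ⁻¹' B
      = ({p : ℝ≥0 × Ω | p.1 ≤ S} ∩ (fun p : ℝ≥0 × Ω => if p.1 ≤ D.τ 0 p.2 then c else 0) ⁻¹' B)
        ∪ Ioi S ×ˢ ((fun ω => -D.residual X₀ q c S ω / (T - S)) ⁻¹' B) := by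
    ext ⟨t, ω⟩
    by_cases ht : t ≤ S
    · simp [arrivalStrategy, ht, not_lt.2 ht]
    · simp [arrivalStrategy, ht, not_le.1 ht]
  rw [e]
  refine (hS.inter ?_).union (measurableSet_predictable_Ioi_prod
    (((measurable_residual M Xhat Ξ X₀ q c S).neg.div_const _) hB))
  exact hg hB

lemma abs_residual_le (ω : Ω) : |D.residual X₀ q c S ω| ≤ |X₀| + |c| * S + |q| := by
  refine (abs_add_three _ _ _).trans (add_le_add (add_le_add le_rfl ?_) ?_)
  · rw [abs_mul, NNReal.abs_eq]
    exact mul_le_mul_of_nonneg_left (NNReal.coe_le_coe.2 (min_le_right _ _)) (abs_nonneg _)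
  · split_ifs <;> simp

lemma arrivalStrategy_bound (hST : S < T) (s : ℝ≥0) (ω : Ω) :
    |(D.arrivalStrategy X₀ q c S T).ξ s ω| ≤ |c| + (|X₀| + |c| * S + |q|) / (T - S) := by
  have hST' : (0 : ℝ) < T - S := sub_pos.2 (NNReal.coe_lt_coe.2 hST)
  have h0 : 0 ≤ (|X₀| + |c| * S + |q|) / (T - S) := by positivity
  simp only [arrivalStrategy]
  split_ifs
  · linarith
  · rw [abs_zero]
    positivity
  · rw [abs_div, abs_neg, abs_of_pos hST']
    have := div_le_div_of_nonneg_right (D.abs_residual_le (X₀ := X₀) (q := q) (c := c) (S := S) ω)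
      hST'.le
    linarith [abs_nonneg c]

lemma arrivalStrategy_traded_of_le {t : ℝ≥0} (ht : t ≤ S) (ω : Ω) :
    (D.arrivalStrategy X₀ q c S T).traded t ω = c * (min (D.τ 0 ω) t : ℝ≥0) := by
  rw [Strategy.traded, integral_of_three_steps (a := c) (b := 0) (m := (min (D.τ 0 ω) t : ℝ≥0))
    (S := t) (NNReal.coe_nonneg _) (NNReal.coe_le_coe.2 (min_le_right _ _)) le_rfl]
  · ring
  · intro s hs
    have h1 : s.toNNReal ≤ min (D.τ 0 ω) t := Real.toNNReal_le_iff_le_coe.2 hs.2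
    simp [arrivalStrategy, (h1.trans (min_le_right _ _)).trans ht, h1.trans (min_le_left _ _)]
  · intro s hs
    have h1 : s.toNNReal ≤ t := Real.toNNReal_le_iff_le_coe.2 hs.2
    have h2 : min (D.τ 0 ω) t < s.toNNReal := Real.lt_toNNReal_iff_coe_lt.2 hs.1
    have h3 : ¬ s.toNNReal ≤ D.τ 0 ω := fun h => absurd (le_min h h1) (not_le.2 h2)
    simp [arrivalStrategy, h1.trans ht, h3]
  · intro s hs
    exact absurd hs.2 (not_le.2 hs.1)

lemma arrivalStrategy_integral_comp (hST : S ≤ T) {f : ℝ → ℝ} (hf : f 0 = 0) (ω : Ω) :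
    ∫ s in (0 : ℝ)..T, f ((D.arrivalStrategy X₀ q c S T).ξ s.toNNReal ω)
      = f c * (min (D.τ 0 ω) S : ℝ≥0) + f (-D.residual X₀ q c S ω / (T - S)) * (T - S) := by
  refine integral_of_three_steps (NNReal.coe_nonneg _) (NNReal.coe_le_coe.2 (min_le_right _ _))
    (NNReal.coe_le_coe.2 hST) (fun s hs => ?_) (fun s hs => ?_) fun s hs => ?_
  · have h1 : s.toNNReal ≤ min (D.τ 0 ω) S := Real.toNNReal_le_iff_le_coe.2 hs.2
    simp [arrivalStrategy, h1.trans (min_le_right _ _), h1.trans (min_le_left _ _)]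
  · have h1 : s.toNNReal ≤ S := Real.toNNReal_le_iff_le_coe.2 hs.2
    have h2 : min (D.τ 0 ω) S < s.toNNReal := Real.lt_toNNReal_iff_coe_lt.2 hs.1
    have h3 : ¬ s.toNNReal ≤ D.τ 0 ω := fun h => absurd (le_min h h1) (not_le.2 h2)
    simp [arrivalStrategy, h1, h3, hf]
  · have h1 : ¬ s.toNNReal ≤ S := not_le.2 (Real.lt_toNNReal_iff_coe_lt.2 hs.1)
    simp [arrivalStrategy, h1]

theorem arrivalStrategy_isAdmissible (h : D.IndependenceAssumption M θ (Measure.dirac ⊤))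
    (hST : S < T) : (D.arrivalStrategy X₀ q c S T).IsAdmissible M D X₀ T where
  Ξ_mem := ⟨le_rfl, abs_nonneg _⟩
  isStoppingTime := isStoppingTime_const _ S
  ρ_lt := Eventually.of_forall fun _ => hST
  predictable := arrivalStrategy_predictable M _ _
  integrable := Eventually.of_forall fun ω => Strategy.intervalIntegrable_of_bounded
    (arrivalStrategy_predictable M _ _) (arrivalStrategy_bound hST) ω 0 T
  bounded := by
    refine ⟨(|c| + (|X₀| + |c| * S + |q|) / (T - S)) * T, Eventually.of_forall fun ω t ht => ?_⟩
    have hST' : (0 : ℝ) < T - S := sub_pos.2 (NNReal.coe_lt_coe.2 hST)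
    have := intervalIntegral.norm_integral_le_of_norm_le_const (a := 0) (b := (t : ℝ))
      (f := fun r : ℝ => (D.arrivalStrategy X₀ q c S T).ξ r.toNNReal ω)
      (fun r _ => arrivalStrategy_bound hST _ ω)
    rw [sub_zero, NNReal.abs_eq] at this
    exact this.trans (mul_le_mul_of_nonneg_left (NNReal.coe_le_coe.2 ht) (by positivity))
  liquidation := by
    filter_upwards [h.ae_regular] with ω hω
    have hST' : (0 : ℝ) < T - S := sub_pos.2 (NNReal.coe_lt_coe.2 hST)
    have := D.arrivalStrategy_integral_comp (X₀ := X₀) (q := q) (c := c) hST.le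
      (f := fun x => x) rfl ω
    rw [hω.Z_eq, Strategy.traded, this, div_mul_cancel₀ _ hST'.ne', residual]
    simp only [arrivalStrategy]
    by_cases hτ : D.τ 0 ω ≤ S
    · simp only [hτ, if_true]
      ring
    · simp only [hτ, if_false]
      ring

lemma arrivalStrategy_impactCost (hST : S < T) (ω : Ω) :
    Strategy.impactCost M D η X₀ T (D.arrivalStrategy X₀ q c S T) ω
      = M.γ / 2 * X₀ ^ 2 + η * (c ^ 2 * (min (D.τ 0 ω) S : ℝ≥0)
          + D.residual X₀ q c S ω ^ 2 / (T - S))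
        + if D.τ 0 ω ≤ S then
            M.γ * q * (X₀ + c * D.τ 0 ω) + M.γ * q ^ 2 / 2 else 0 := by
  have hST' : (0 : ℝ) < T - S := sub_pos.2 (NNReal.coe_lt_coe.2 hST)
  rw [Strategy.impactCost, D.arrivalStrategy_integral_comp (X₀ := X₀) (q := q) (c := c) hST.le
      (f := fun x => x ^ 2) (by simp) ω]
  have e : (-D.residual X₀ q c S ω / (T - S)) ^ 2 * (T - S)
      = D.residual X₀ q c S ω ^ 2 / (T - S) := by
    field_simp
  rw [e]
  congr 1
  by_cases hτ : D.τ 0 ω ≤ S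
  · rw [arrivalStrategy_traded_of_le hτ, min_self]
    rfl
  · simp [arrivalStrategy, hτ]

theorem minimalExpectedCost_le (h : D.IndependenceAssumption M θ (Measure.dirac ⊤))
    (hα : D.α = 0) (hκ : D.κ = 0) (hh : ∀ x, M.h x = η * x) (hST : S < T) (q c : ℝ)
    (hQ : Integrable (Strategy.impactCost M D η X₀ T (D.arrivalStrategy X₀ q c S T)) P) :
    minimalExpectedCost M D X₀ T ≤ ((∫ ω,
      Strategy.impactCost M D η X₀ T (D.arrivalStrategy X₀ q c S T) ω ∂P : ℝ) : EReal) := by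
  have hadm := D.arrivalStrategy_isAdmissible (M := M) (X₀ := X₀) (q := q) (c := c) h hST
  have hL := hadm.integrable_priceCost_of_bounded h (arrivalStrategy_bound hST)
  have hL0 := hadm.integral_priceCost h hL
  have he := hadm.cost_ae_eq h hα hκ hh (Eventually.of_forall fun ω =>
    Strategy.intervalIntegrable_sq_of_bounded hadm.predictable (arrivalStrategy_bound hST) ω 0 T)
  have hi : Integrable (fun ω => Strategy.priceCost M D X₀ T (D.arrivalStrategy X₀ q c S T) ω
      + Strategy.impactCost M D η X₀ T (D.arrivalStrategy X₀ q c S T) ω) P := hL.add hQ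
  have hext : HasExtIntegral P ((D.arrivalStrategy X₀ q c S T).cost M D X₀ T) :=
    (hasExtIntegral_congr he).2 (hasExtIntegral_coe hi)
  refine (iInf₂_le (D.arrivalStrategy X₀ q c S T) ⟨hadm, hext⟩).trans ?_
  rw [extIntegral_congr he, extIntegral_coe hi, integral_add hL hQ, hL0, zero_add]

end DarkPoolExtension

/-! ### The limit of the minimal expected costs -/

namespace DarkPoolExtension

variable {Ω : Type*} [mΩ : MeasurableSpace Ω] {P : Measure Ω} [IsProbabilityMeasure P]
  {M : AlmgrenChrissModel P} {D : DarkPoolExtension Ω} {X₀ η q c : ℝ} {S T : ℝ≥0}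
  {θ : ℝ≥0}

lemma IndependenceAssumption.integral_τ (h : D.IndependenceAssumption M θ (Measure.dirac ⊤)) :
    Integrable (fun ω => (D.τ 0 ω : ℝ)) P ∧ ∫ ω, (D.τ 0 ω : ℝ) ∂P = 1 / θ := by
  have hθ : (0 : ℝ) < θ := h.θ_pos
  have hm : Measurable fun ω => (D.τ 0 ω : ℝ) := measurable_coe_nnreal_real.comp (D.τ_measurable 0)
  have hexp : IntegrableOn (fun t : ℝ => Real.exp (-(θ : ℝ) * t)) (Ioi 0) :=
    exp_neg_integrableOn_Ioi 0 hθ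
  have key : ∫⁻ ω, ENNReal.ofReal (D.τ 0 ω) ∂P = ENNReal.ofReal (1 / θ) := by
    rw [lintegral_eq_lintegral_meas_lt P (Eventually.of_forall fun ω => NNReal.coe_nonneg _)
      hm.aemeasurable]
    have e : ∀ t ∈ Ioi (0 : ℝ), P {ω | t < (D.τ 0 ω : ℝ)}
        = ENNReal.ofReal (Real.exp (-(θ : ℝ) * t)) := by
      intro t ht
      have h1 := h.measure_lt_τ t.toNNReal
      rw [Real.coe_toNNReal t (le_of_lt ht), ← neg_mul] at h1
      rw [← h1, ofReal_measureReal]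
      congr 1
      ext ω
      exact (Real.toNNReal_lt_iff_lt_coe (le_of_lt ht)).symm
    rw [setLIntegral_congr_fun measurableSet_Ioi e, ← ofReal_integral_eq_lintegral_ofReal hexp
      (Eventually.of_forall fun t => (Real.exp_pos _).le),
      integral_exp_mul_Ioi (neg_neg_of_pos hθ)]
    simp
  have hi : Integrable (fun ω => (D.τ 0 ω : ℝ)) P := by
    refine integrable_of_lintegral_ofReal_ne_top hm.aestronglyMeasurable
      (by rw [key]; exact ENNReal.ofReal_ne_top) ?_
    simp [ENNReal.ofReal_of_nonpos]
  refine ⟨hi, ?_⟩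
  rw [integral_eq_lintegral_of_nonneg_ae (Eventually.of_forall fun ω => NNReal.coe_nonneg _) hi.1,
    key, ENNReal.toReal_ofReal (by positivity)]

lemma half_lt (hT : 2 ≤ T) : T / 2 < T :=
  NNReal.half_lt_self (lt_of_lt_of_le two_pos hT).ne'

lemma coe_sub_half (T : ℝ≥0) : (T : ℝ) - (T / 2 : ℝ≥0) = T / 2 := by
  rw [NNReal.coe_div, NNReal.coe_ofNat]
  ring

/-- A majorant that is uniform in T and linear in τ: the squared residual grows like m² with m = τ ∧
T/2, but it is divided by T/2 and m² ≤ τ·T/2. The condition T ≥ 2 absorbs the constant part. -/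
lemma abs_impactCost_le (hη : 0 < η) (hT : 2 ≤ T) (ω : Ω) :
    |Strategy.impactCost M D η X₀ T (D.arrivalStrategy X₀ q c (T / 2) T) ω|
      ≤ M.γ / 2 * X₀ ^ 2 + η * (c ^ 2 * D.τ 0 ω
          + (2 * (|X₀| + |q|) ^ 2 + 2 * c ^ 2 * D.τ 0 ω))
        + (|M.γ * q| * (|X₀| + |c| * D.τ 0 ω) + M.γ * q ^ 2 / 2) := by
  have hγ := M.γ_pos
  have hT' : (2 : ℝ) ≤ T := by exact_mod_cast hT
  have hτ0 : (0 : ℝ) ≤ D.τ 0 ω := NNReal.coe_nonneg _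
  set m : ℝ := ((min (D.τ 0 ω) (T / 2) : ℝ≥0) : ℝ) with hm
  have hm0 : 0 ≤ m := NNReal.coe_nonneg _
  have hmτ : m ≤ D.τ 0 ω := NNReal.coe_le_coe.2 (min_le_left _ _)
  have hmT : m ≤ T / 2 := by
    have : m ≤ (T / 2 : ℝ≥0) := NNReal.coe_le_coe.2 (min_le_right _ _)
    rwa [NNReal.coe_div, NNReal.coe_ofNat] at this
  have hres : D.residual X₀ q c (T / 2) ω ^ 2 / (T / 2)
      ≤ 2 * (|X₀| + |q|) ^ 2 + 2 * c ^ 2 * D.τ 0 ω := by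
    have h1 : |D.residual X₀ q c (T / 2) ω| ≤ (|X₀| + |q|) + |c| * m := by
      refine (abs_add_three _ _ _).trans ?_
      have h2 : |if D.τ 0 ω ≤ T / 2 then q else 0| ≤ |q| := by split_ifs <;> simp
      rw [abs_mul, abs_of_nonneg hm0]
      linarith
    have h3 : D.residual X₀ q c (T / 2) ω ^ 2 ≤ ((|X₀| + |q|) + |c| * m) ^ 2 := by
      rw [← sq_abs]
      exact pow_le_pow_left₀ (abs_nonneg _) h1 2
    have h4 : ((|X₀| + |q|) + |c| * m) ^ 2 ≤ 2 * (|X₀| + |q|) ^ 2 + 2 * (c ^ 2 * m ^ 2) := by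
      have := sq_nonneg ((|X₀| + |q|) - |c| * m)
      rw [← sq_abs c]
      linarith
    have h5 : m ^ 2 ≤ D.τ 0 ω * (T / 2) := by
      rw [sq]
      exact mul_le_mul hmτ hmT hm0 hτ0
    have h6 := mul_le_mul_of_nonneg_left h5 (sq_nonneg c)
    have h7 : 2 * (|X₀| + |q|) ^ 2 ≤ 2 * (|X₀| + |q|) ^ 2 * (T / 2) :=
      le_mul_of_one_le_right (by positivity) (by linarith)
    rw [div_le_iff₀ (by linarith)]
    linarith
  have hdark : |if D.τ 0 ω ≤ T / 2 then
      M.γ * q * (X₀ + c * D.τ 0 ω) + M.γ * q ^ 2 / 2 else 0|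
      ≤ |M.γ * q| * (|X₀| + |c| * D.τ 0 ω) + M.γ * q ^ 2 / 2 := by
    split_ifs
    · refine (abs_add_le _ _).trans (add_le_add ?_ (abs_of_nonneg (by positivity)).le)
      rw [abs_mul]
      refine mul_le_mul_of_nonneg_left ((abs_add_le _ _).trans ?_) (abs_nonneg _)
      rw [abs_mul, abs_of_nonneg hτ0]
    · rw [abs_zero]
      positivity
  have hres0 : 0 ≤ D.residual X₀ q c (T / 2) ω ^ 2 / (T / 2) := by positivity
  rw [arrivalStrategy_impactCost (half_lt hT), coe_sub_half]
  refine (abs_add_three _ _ _).trans (add_le_add (add_le_add ?_ ?_) hdark)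
  · exact (abs_of_nonneg (by positivity)).le
  · rw [abs_of_nonneg (by positivity)]
    refine mul_le_mul_of_nonneg_left (add_le_add ?_ hres) hη.le
    exact mul_le_mul_of_nonneg_left hmτ (sq_nonneg c)

lemma integrable_abs_impactCost_bound (h : D.IndependenceAssumption M θ (Measure.dirac ⊤)) :
    Integrable (fun ω => M.γ / 2 * X₀ ^ 2 + η * (c ^ 2 * D.τ 0 ω
          + (2 * (|X₀| + |q|) ^ 2 + 2 * c ^ 2 * D.τ 0 ω))
        + (|M.γ * q| * (|X₀| + |c| * D.τ 0 ω) + M.γ * q ^ 2 / 2)) P := by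
  have hτ := h.integral_τ.1
  exact ((integrable_const _).add (((hτ.const_mul _).add
    ((integrable_const _).add (hτ.const_mul _))).const_mul _)).add
    ((((integrable_const _).add (hτ.const_mul _)).const_mul _).add (integrable_const _))

lemma integrable_impactCost (h : D.IndependenceAssumption M θ (Measure.dirac ⊤)) (hη : 0 < η)
    (hT : 2 ≤ T) :
    Integrable (Strategy.impactCost M D η X₀ T (D.arrivalStrategy X₀ q c (T / 2) T)) P :=
  (integrable_abs_impactCost_bound h).mono'
    ((arrivalStrategy_isAdmissible h (half_lt hT)).aestronglyMeasurable_impactCost h)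
    (Eventually.of_forall fun ω => abs_impactCost_le hη hT ω)

/-- Once T ≥ 2τ the residual no longer depends on T, and liquidating it over a period of length T/2
costs O(1/T). -/
lemma tendsto_impactCost (ω : Ω) :
    Tendsto (fun T : ℝ≥0 => Strategy.impactCost M D η X₀ T (D.arrivalStrategy X₀ q c (T / 2) T) ω)
      atTop (𝓝 (M.γ / 2 * X₀ ^ 2 + η * (c ^ 2 * D.τ 0 ω)
        + (M.γ * q * (X₀ + c * D.τ 0 ω) + M.γ * q ^ 2 / 2))) := by
  have hT : Tendsto (fun T : ℝ≥0 => (T : ℝ) / 2) atTop atTop :=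
    (NNReal.tendsto_coe_atTop.2 tendsto_id).atTop_div_const two_pos
  have h0 : Tendsto (fun T : ℝ≥0 => (X₀ + c * D.τ 0 ω + q) ^ 2 / ((T : ℝ) / 2)) atTop (𝓝 0) :=
    hT.const_div_atTop _
  have h1 := (((h0.const_add (c ^ 2 * (D.τ 0 ω : ℝ))).const_mul η).const_add
    (M.γ / 2 * X₀ ^ 2)).add_const (M.γ * q * (X₀ + c * D.τ 0 ω) + M.γ * q ^ 2 / 2)
  rw [add_zero] at h1
  refine h1.congr' ?_
  filter_upwards [eventually_ge_atTop (max 2 (2 * D.τ 0 ω))] with T hT2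
  have h2 : 2 ≤ T := (le_max_left _ _).trans hT2
  have hτ : D.τ 0 ω ≤ T / 2 := by
    rw [le_div_iff₀ two_pos, mul_comm]
    exact (le_max_right _ _).trans hT2
  rw [arrivalStrategy_impactCost (half_lt h2), coe_sub_half, residual, min_eq_left hτ, if_pos hτ,
    if_pos hτ]

theorem tendsto_integral_impactCost (h : D.IndependenceAssumption M θ (Measure.dirac ⊤))
    (hη : 0 < η) :
    Tendsto (fun T : ℝ≥0 => ∫ ω,
        Strategy.impactCost M D η X₀ T (D.arrivalStrategy X₀ q c (T / 2) T) ω ∂P) atTop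
      (𝓝 (M.γ / 2 * X₀ ^ 2 + η * (c ^ 2 * (1 / θ))
        + (M.γ * q * (X₀ + c * (1 / θ)) + M.γ * q ^ 2 / 2))) := by
  obtain ⟨hτ, hτe⟩ := h.integral_τ
  have e : ∫ ω, (M.γ / 2 * X₀ ^ 2 + η * (c ^ 2 * D.τ 0 ω)
        + (M.γ * q * (X₀ + c * D.τ 0 ω) + M.γ * q ^ 2 / 2)) ∂P
      = M.γ / 2 * X₀ ^ 2 + η * (c ^ 2 * (1 / θ))
        + (M.γ * q * (X₀ + c * (1 / θ)) + M.γ * q ^ 2 / 2) := by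
    have e1 : ∀ ω, M.γ / 2 * X₀ ^ 2 + η * (c ^ 2 * D.τ 0 ω)
        + (M.γ * q * (X₀ + c * D.τ 0 ω) + M.γ * q ^ 2 / 2)
        = (M.γ / 2 * X₀ ^ 2 + M.γ * q * X₀ + M.γ * q ^ 2 / 2)
          + (η * c ^ 2 + M.γ * q * c) * D.τ 0 ω := fun ω => by ring
    simp_rw [e1]
    rw [integral_add (integrable_const _) (hτ.const_mul _), integral_const_mul, hτe,
      integral_const, probReal_univ, one_smul]
    ring
  rw [← e]
  refine tendsto_integral_filter_of_dominated_convergence _ ?_ ?_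
    (integrable_abs_impactCost_bound (X₀ := X₀) (η := η) (q := q) (c := c) h)
    (Eventually.of_forall fun ω => tendsto_impactCost ω)
  · filter_upwards [eventually_ge_atTop 2] with T hT
    exact (integrable_impactCost h hη hT).1
  · filter_upwards [eventually_ge_atTop 2] with T hT
    exact Eventually.of_forall fun ω => abs_impactCost_le hη hT ω

end DarkPoolExtension

end DarkPool

/-! ### The uniform lower bound and the asymptotically optimal strategies. -/

theorem mainTheorem10 {Ω : Type*} [MeasurableSpace Ω] (P : Measure Ω) [IsProbabilityMeasure P]
    (M : DarkPool.AlmgrenChrissModel P) (D : DarkPool.DarkPoolExtension Ω)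
    (θ : ℝ≥0) (η X₀ : ℝ)
    (hInd : D.IndependenceAssumption M θ (Measure.dirac ⊤))
    (hα : D.α = 0) (hκ : D.κ = 0) (hh : ∀ x, M.h x = η * x)
    (hγη : M.γ / η < 2 * (θ : ℝ)) :
    Tendsto (fun T : ℝ≥0 => DarkPool.minimalExpectedCost M D X₀ T) atTop
      (𝓝 ((-(M.γ ^ 2 / 2 * X₀ ^ 2 * (1 / (2 * η * (θ : ℝ) - M.γ))) : ℝ) : EReal)) := by
  have hη := M.η_pos hh
  have hθ : (0 : ℝ) < θ := hInd.θ_pos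
  have hγ : M.γ < 2 * η * θ := by
    rw [div_lt_iff₀ hη] at hγη
    linarith
  have hd : 0 < 2 * η * θ - M.γ := by linarith
  -- The minimiser of the quadratic in `quadratic_bound`.
  set q : ℝ := -(2 * η * θ * X₀) / (2 * η * θ - M.γ) with hq
  -- The speed that minimises ηξ² + γqξ, i.e. the optimal feedback where v has slope γq.
  set c : ℝ := -(M.γ * q) / (2 * η) with hc
  have hlim := DarkPool.DarkPoolExtension.tendsto_integral_impactCost (X₀ := X₀) (q := q) (c := c)
    hInd hη
  have hval : M.γ / 2 * X₀ ^ 2 + η * (c ^ 2 * (1 / θ))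
      + (M.γ * q * (X₀ + c * (1 / θ)) + M.γ * q ^ 2 / 2)
      = -(M.γ ^ 2 / 2 * X₀ ^ 2 * (1 / (2 * η * θ - M.γ))) := by
    rw [hc, hq]
    field_simp
    ring
  rw [hval] at hlim
  refine tendsto_of_tendsto_of_tendsto_of_le_of_le' tendsto_const_nhds
    ((continuous_coe_real_ereal.tendsto _).comp hlim) (Eventually.of_forall fun T => ?_) ?_
  · exact le_iInf₂ fun χ hχ => hχ.1.le_extIntegral_cost hInd hα hκ hh hγ hχ.2
  · filter_upwards [eventually_ge_atTop 2] with T hT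
    exact DarkPool.DarkPoolExtension.minimalExpectedCost_le hInd hα hκ hh
      (DarkPool.DarkPoolExtension.half_lt hT) q c
      (DarkPool.DarkPoolExtension.integrable_impactCost hInd hη hT)
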